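/- Let $\mathcal{T}=\mathcal{T}_0\cup\mathcal{T}_1$ be the Wang set of 11 tiles, with horizontal (west/east) colours $\{0,1,2,3\}$ and vertical (south/north) colours $\{0,1,2,3,4\}$, whose tiles, written $(\text{west},\text{east},\text{south},\text{north})$, are $$\mathcal{T}_0=\{(0,0,1,0),(0,3,2,1),(1,0,2,2),(1,1,4,2),(1,3,2,3),(3,0,1,1),(3,1,1,1),(3,1,2,2),(3,3,3,1)\},$$ $$\mathcal{T}_1=\{(2,2,1,4),(2,2,0,2)\}.$$ A tiling by $\mathcal{T}$ is a map $f:\mathbb{Z}^2\to\mathcal{T}$ such that the east colour of $f(x,y)$ equals the west colour of $f(x+1,y)$ and the north colour of $f(x,y)$ equals the south colour of $f(x,y+1)$, for all $(x,y)\in\mathbb{Z}^2$. It is periodic if it is invariant under some nonzero translation of $\mathbb{Z}^2$. A bi-infinite word $u\in\{0,1\}^{\mathbb{Z}}$ is Sturmian of slope $\alpha$, for $\alpha$ irrational, if there is $\rho\in\mathbb{R}$ such that either $u_n=\lfloor (n+1)\alpha+\rho\rfloor-\lfloor n\alpha+\rho\rfloor$ for all $n\in\mathbb{Z}$, or $u_n=\lceil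 (n+1)\alpha+\rho\rceil-\lceil n\alpha+\rho\rceil$ for all $n\in\mathbb{Z}$ (so $\alpha$ is the frequency of the letter $1$). Let $\phi=\frac{1+\sqrt5}{2}$ and $\alpha=\frac{\phi^2}{5\phi^2-1}=\frac{1}{\phi+3}$. Then: 1. The Wang set $\mathcal{T}$ is aperiodic: there is a tiling by $\mathcal{T}$, and no tiling by $\mathcal{T}$ is periodic. 2. The set of finite words $v=v_0\cdots v_{\ell-1}\in\{0,1\}^*$ for which there are a tiling $f$ by $\mathcal{T}$ and $k\in\mathbb{Z}$ with $f(x,k+i)\in\mathcal{T}_{v_i}$ for all $x\in\mathbb{Z}$ and $0\le i<\ell$ is exactly the set of finite factors of the bi-infinite Sturmian words of slope $\alpha$. 3. The set of bi-infinite words $u\in\{0,1\}^{\mathbb{Z}}$ for which there is a tiling $f$ by $\mathcal{T}$ with $f(x,y)\in\mathcal{T}_{u_y}$ for all $x,y\in\mathbb{Z}$ is exactly the set of bi-infinite Sturmian words of slope $\alpha$. -/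

import Mathlib

/-- A Wang tile with horizontal colours `H` (west and east edges) and vertical colours `V`
(south and north edges). -/
structure WangTile (H V : Type*) where
  w : H
  e : H
  s : V
  n : V

/-- `f` is a tiling of the plane by the Wang set with set of tiles `T`: every cell carries a tile
of `T`, and contiguous edges have the same colour. -/
def IsTiling {H V : Type*} (T : Set (WangTile H V)) (f : ℤ → ℤ → WangTile H V) : Prop :=
  (∀ x y, f x y ∈ T) ∧
  (∀ x y, (f x y).e = (f (x + 1) y).w) ∧
  (∀ x y, (f x y).n = (f x (y + 1)).s)

/-- A tiling is periodic if it is invariant under some nonzero translation. -/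
def IsPeriodicTiling {H V : Type*} (f : ℤ → ℤ → WangTile H V) : Prop :=
  ∃ u v : ℤ, (u, v) ≠ (0, 0) ∧ ∀ x y, f x y = f (x + u) (y + v)

/-- A Wang set is aperiodic if it tiles the plane and none of its tilings is periodic. -/
def IsAperiodicWangSet {H V : Type*} (T : Set (WangTile H V)) : Prop :=
  (∃ f, IsTiling T f) ∧ ∀ f, IsTiling T f → ¬ IsPeriodicTiling f

/-- The nine tiles `⟨west, east, south, north⟩` of the component `T₀`, with horizontal colours
`0, 1, 3`. As a transducer, a tile is a transition from its west colour to its east colour that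
reads its south colour and writes its north colour. -/
def wangT0 : Set (WangTile (Fin 4) (Fin 5)) :=
  {⟨0, 0, 1, 0⟩, ⟨0, 3, 2, 1⟩, ⟨1, 0, 2, 2⟩, ⟨1, 1, 4, 2⟩, ⟨1, 3, 2, 3⟩,
   ⟨3, 0, 1, 1⟩, ⟨3, 1, 1, 1⟩, ⟨3, 1, 2, 2⟩, ⟨3, 3, 3, 1⟩}

/-- The two tiles `⟨west, east, south, north⟩` of the component `T₁`, with horizontal colour
`2`. -/
def wangT1 : Set (WangTile (Fin 4) (Fin 5)) :=
  {⟨2, 2, 1, 4⟩, ⟨2, 2, 0, 2⟩}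

/-- The component `T₀` or `T₁` of the Wang set, indexed by a letter of the alphabet `{0, 1}`. -/
def wangComponent (i : Fin 2) : Set (WangTile (Fin 4) (Fin 5)) :=
  if i = 0 then wangT0 else wangT1

/-- The Wang set `T = T₀ ∪ T₁` of eleven tiles. -/
def wangT : Set (WangTile (Fin 4) (Fin 5)) := wangT0 ∪ wangT1

/-- The bi-infinite composition `T_u` of the transducers `T₀`, `T₁` (in the order given by `u`,
from bottom to top) represents a valid tiling of the plane: some tiling has, for each `y`, all
tiles of its row `y` in `T_{u y}`. -/
def RepresentsTiling (u : ℤ → Fin 2) : Prop :=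
  ∃ f, IsTiling wangT f ∧ ∀ x y, f x y ∈ wangComponent (u y)

/-- The sequence of transducers `T_v` (`v` a finite word) appears in a tiling of the plane: some
tiling has consecutive rows, from bottom to top, whose tiles are in `T_{v 0}`, `T_{v 1}`, …. -/
def AppearsInTiling (v : List (Fin 2)) : Prop :=
  ∃ f, IsTiling wangT f ∧
    ∃ k : ℤ, ∀ (i : ℕ) (hi : i < v.length) (x : ℤ), f x (k + i) ∈ wangComponent v[i]

/-- A bi-infinite Sturmian word over `{0, 1}` of slope `α`: a lower or upper mechanical word of
irrational slope `α` (the slope is then the frequency of the letter `1`). -/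
def IsSturmian (α : ℝ) (u : ℤ → Fin 2) : Prop :=
  Irrational α ∧ ∃ ρ : ℝ,
    (∀ n : ℤ, ((u n : ℕ) : ℤ) = ⌊((n : ℝ) + 1) * α + ρ⌋ - ⌊(n : ℝ) * α + ρ⌋) ∨
    (∀ n : ℤ, ((u n : ℕ) : ℤ) = ⌈((n : ℝ) + 1) * α + ρ⌉ - ⌈(n : ℝ) * α + ρ⌉)

/-- The finite word `v` is a factor of the bi-infinite word `u`. -/
def IsFactor (v : List (Fin 2)) (u : ℤ → Fin 2) : Prop :=
  ∃ k : ℤ, ∀ (i : ℕ) (hi : i < v.length), u (k + i) = v[i]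

/-! A row of tiles is a run of a transducer that reads the south colours and writes the north
colours. The horizontal colour 2 occurs only in the second component and on both sides of its tiles,
so every row lies in one component and a tiling is a bi-infinite composition of the two transducers
along a word `u`. Finite computations with composed transducers exclude 11, 101, 1001, 00000, and
10001000 followed by 1. Hence `u` is a product of blocks 10000 and 1000 in which no two blocks 1000
are adjacent.

In a tiling, the strips 10000 and 1000 relate the row read to the row written in a rigid way,
recorded by a block path: the line is cut into blocks of lengths `p < q`, each of which carries a
mark, of the row read at its start or of the row written at its end. A mark stands for a run of two
or three equal digits. The lengths are consecutive Fibonacci numbers: 3, 5 for 10000 and 5, 8 for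
1000. The empty word also has its path, with lengths 2, 3, which cuts a row into its runs. A further
block `mix` has to be admitted for 1000, and it also arises from compositions.

The heart is the stacking of paths of levels `k + 1`, `k`, `k + 1`. The distance of two consecutive
marks of a shared row has to be a sum of blocks in both paths that share it. These constraints
exclude `mix` from all three paths and force the middle path to be a concatenation of five words,
which are the blocks of a path of level `k + 3` with the same outer rows
(`PureTriple.compose_isPath`, `PureTriple.compose_inMark`). The same rules forbid the stack `k + 1`,
`k`, `k + 1`, `k`, `k + 1` (`PureTriple.not_stacked`). So if blocks of level `k + 1` alternate with
blocks of level `k` or `k + 2`, the same holds one level higher (`Hierarchy.step`), with words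
`levelWord (k + 3) = levelWord (k + 1) ++ levelWord k ++ levelWord (k + 1)`.

These words code orbits of the rotation by the slope, and so do two consecutive ones
(`levelWord_codes`, `exists_codes_append`). Every factor of `u` lies in such a pair, so its number
of letters 1 differs from the expected one by less than 1, and `u` is Sturmian
(`isSturmian_of_balanced`).

Conversely, composition is inverted by substitutions on paths without `mix`. Descending to levels 0,
1, 2, one realises every level word by a strip of tiles (`LevelPath.exists_runWord`). By density of
the rotation every factor of a Sturmian word lies in a level word, and compactness yields a tiling.

A period with a vertical component would make the slope rational, against balance. A horizontal
period makes two rows equal by the pigeonhole principle, and repeating the strip between them gives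
a tiling with a vertical period. -/

/-- The blocks of a block path with short length `p` and long length `q`: a block is short or long,
and carries a mark of the input row at its start or a mark of the output row at its end; the block
`mix`, of length `2 * p`, carries a short mark of either row in its interior. -/
inductive Block
  | inS | inL | outS | outL | mix

namespace Block

/-- The length of a block. -/
def len (p q : ℤ) : Block → ℤ
  | inS => p
  | inL => q
  | outS => p
  | outL => q
  | mix => 2 * p

/-- Exchange of input and output. -/
def flip : Block → Block
  | inS => outS
  | inL => outL
  | outS => inS
  | outL => inL
  | mix => mix

@[simp] theorem flip_flip (b : Block) : b.flip.flip = b := by cases b <;> rfl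

@[simp] theorem len_flip (p q : ℤ) (b : Block) : b.flip.len p q = b.len p q := by cases b <;> rfl

@[simp] theorem len_inS (p q : ℤ) : inS.len p q = p := rfl
@[simp] theorem len_inL (p q : ℤ) : inL.len p q = q := rfl
@[simp] theorem len_outS (p q : ℤ) : outS.len p q = p := rfl
@[simp] theorem len_outL (p q : ℤ) : outL.len p q = q := rfl
@[simp] theorem len_mix (p q : ℤ) : mix.len p q = 2 * p := rfl

theorem len_ge {p q : ℤ} (hp : 0 < p) (hpq : p < q) (b : Block) : p ≤ b.len p q := by
  cases b <;> simp <;> omega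

end Block

/-! ### Block paths, their marks and their reflection -/

/-- `V x b` says that the block `b` starts at `x`; the blocks fill the line without overlaps. -/
structure IsPath (p q : ℤ) (V : ℤ → Block → Prop) : Prop where
  ne : ∃ x b, V x b
  succ : ∀ {x b}, V x b → ∃ c, V (x + b.len p q) c
  pred : ∀ {x b}, V x b → ∃ c, V (x - c.len p q) c
  sep : ∀ {x b y c}, V x b → V y c → x ≤ y → (x = y ∧ b = c) ∨ x + b.len p q ≤ y

/-- The marks of the input row of a block path; `false` stands for short, `true` for long. -/
def InMark (p q : ℤ) (V : ℤ → Block → Prop) (x : ℤ) : Bool → Prop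
  | false => V x .inS ∨ V (x - (q - p)) .mix
  | true => V x .inL

/-- The marks of the output row of a block path; `false` stands for short, `true` for long. -/
def OutMark (p q : ℤ) (V : ℤ → Block → Prop) (x : ℤ) : Bool → Prop
  | false => V (x - p) .outS ∨ V (x - (3 * p - q)) .mix
  | true => V (x - q) .outL

/-- The reflection of a block path. -/
def mirror (p q : ℤ) (V : ℤ → Block → Prop) (x : ℤ) (b : Block) : Prop :=
  V (-x - b.len p q) b.flip

section paths

variable {p q : ℤ} {V : ℤ → Block → Prop}

theorem mirror_iff {x y : ℤ} {b c : Block} (hy : y = -x - b.len p q) (hc : c = b.flip) :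
    mirror p q V x b ↔ V y c := by subst hy hc; rfl

theorem IsPath.mirror (hV : IsPath p q V) (hp : 0 < p) (hpq : p < q) :
    IsPath p q (mirror p q V) := by
  refine ⟨?_, ?_, ?_, ?_⟩
  · obtain ⟨x, b, h⟩ := hV.ne
    refine ⟨-x - b.len p q, b.flip, ?_⟩
    rw [mirror_iff (y := x) (c := b) (by simp) (by simp)]
    exact h
  · intro x b h
    obtain ⟨c, hc⟩ := hV.pred h
    refine ⟨c.flip, ?_⟩
    rw [mirror_iff (y := -x - b.len p q - c.len p q) (c := c) (by simp; ring) (by simp)]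
    exact hc
  · intro x b h
    obtain ⟨c, hc⟩ := hV.succ h
    refine ⟨c.flip, ?_⟩
    rw [mirror_iff (y := -x - b.len p q + b.flip.len p q) (c := c) (by simp) (by simp)]
    exact hc
  · intro x b y c hb hc hxy
    have hl := c.len_ge hp hpq
    rcases le_total (-y - c.len p q) (-x - b.len p q) with h | h
    · rcases hV.sep hc hb h with ⟨h1, h2⟩ | h1
      · have h3 : b = c := by rw [← Block.flip_flip b, ← h2, Block.flip_flip]
        subst h3
        left; exact ⟨by omega, rfl⟩
      · simp only [Block.len_flip] at h1
        right; omega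
    · rcases hV.sep hb hc h with ⟨h1, h2⟩ | h1
      · have h3 : b = c := by rw [← Block.flip_flip b, h2, Block.flip_flip]
        subst h3
        left; exact ⟨by omega, rfl⟩
      · simp only [Block.len_flip] at h1
        omega

theorem mirror_mirror : mirror p q (mirror p q V) = V := by
  funext x b
  apply propext
  show mirror p q V (-x - b.len p q) b.flip ↔ V x b
  rw [mirror_iff (y := x) (c := b) (by simp) (by simp)]

/-- Reflection exchanges the two rows, so each fact on input marks yields one on output marks. The
block `mix` is its own mirror image because its two marks sit at the offsets `q - p` and `3 * p -
q`, whose sum is its length. -/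
theorem inMark_mirror (x : ℤ) (t : Bool) :
    InMark p q (mirror p q V) x t ↔ OutMark p q V (-x) t := by
  cases t
  · simp only [InMark, OutMark]
    rw [mirror_iff (y := -x - p) (c := .outS) (by simp) rfl,
      mirror_iff (y := -x - (3 * p - q)) (c := .mix) (by simp; ring) rfl]
  · simp only [InMark, OutMark]
    rw [mirror_iff (y := -x - q) (c := .outL) (by simp) rfl]

theorem outMark_mirror (x : ℤ) (t : Bool) :
    OutMark p q (mirror p q V) x t ↔ InMark p q V (-x) t := by
  conv_rhs => rw [← mirror_mirror (p := p) (q := q) (V := V)]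
  rw [inMark_mirror, neg_neg]

/-- The block path has no block `mix`. -/
def NoMix (V : ℤ → Block → Prop) : Prop := ∀ x, ¬ V x .mix

theorem NoMix.mirror (h : NoMix V) : NoMix (mirror p q V) := fun _ hx => h _ hx

theorem IsPath.eq (hV : IsPath p q V) (hp : 0 < p) (hpq : p < q) {x : ℤ} {b c : Block}
    (hb : V x b) (hc : V x c) : b = c := by
  rcases hV.sep hb hc le_rfl with h | h
  · exact h.2
  · have := b.len_ge hp hpq; omega

theorem IsPath.le_of_lt (hV : IsPath p q V) {x y : ℤ} {b c : Block}
    (hb : V x b) (hc : V y c) (h : x < y) : x + b.len p q ≤ y := by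
  rcases hV.sep hb hc h.le with h1 | h1
  · omega
  · exact h1

/-! ### Blocks between consecutive marks -/

/-- The block that a given output mark belongs to. -/
theorem OutMark.exists_block {x : ℤ} {t : Bool} (h : OutMark p q V x t) :
    ∃ z b, V z b ∧ ((b = .outS ∧ x = z + p ∧ t = false) ∨ (b = .outL ∧ x = z + q ∧ t = true) ∨
      (b = .mix ∧ x = z + (3 * p - q) ∧ t = false)) := by
  cases t
  · rcases h with h | h
    · exact ⟨_, _, h, Or.inl ⟨rfl, by ring, rfl⟩⟩
    · exact ⟨_, _, h, Or.inr (Or.inr ⟨rfl, by ring, rfl⟩)⟩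
  · exact ⟨_, _, h, Or.inr (Or.inl ⟨rfl, by ring, rfl⟩)⟩

theorem OutMark.boundary (hV : IsPath p q V) {x : ℤ} {t : Bool} (h : OutMark p q V x t) :
    ∃ w b, V w b ∧ (w = x ∨ (w = x + (q - p) ∧ t = false ∧ V (x - (3 * p - q)) .mix)) := by
  obtain ⟨z, b, hb, hc⟩ := h.exists_block
  obtain ⟨c, hc'⟩ := hV.succ hb
  refine ⟨_, c, hc', ?_⟩
  rcases hc with ⟨rfl, h1, -⟩ | ⟨rfl, h1, -⟩ | ⟨rfl, h1, h2⟩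
  · left; simp [h1]
  · left; simp [h1]
  · right
    refine ⟨by simp; omega, h2, ?_⟩
    rw [show x - (3 * p - q) = z by omega]; exact hb

/-- From a block start between consecutive output marks, the block there either carries the next
mark, or ends before it. -/
theorem IsPath.out_step (hV : IsPath p q V) (hp : 0 < p) (hpq : p < q) (hq : q < 2 * p)
    {x z x' : ℤ} {b : Block} {t : Bool} (hz : V z b) (hxz : x ≤ z) (hzx : z < x')
    (hx' : OutMark p q V x' t) (hno : ∀ y t, x < y → y < x' → ¬ OutMark p q V y t) :
    (b = .inS ∧ z + p < x') ∨ (b = .inL ∧ z + q < x') ∨ (b = .outS ∧ x' = z + p ∧ t = false) ∨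
      (b = .outL ∧ x' = z + q ∧ t = true) ∨ (b = .mix ∧ x' = z + (3 * p - q) ∧ t = false) := by
  obtain ⟨z', b', hb', hc⟩ := hx'.exists_block
  have hlt : x' ≤ z' + b'.len p q := by
    rcases hc with ⟨rfl, h1, -⟩ | ⟨rfl, h1, -⟩ | ⟨rfl, h1, -⟩ <;> simp <;> omega
  have hlt' : z' < x' := by
    rcases hc with ⟨rfl, h1, -⟩ | ⟨rfl, h1, -⟩ | ⟨rfl, h1, -⟩ <;> omega
  have hle : z ≤ z' := by
    by_contra hcon
    have := hV.le_of_lt hb' hz (by omega)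
    omega
  rcases hle.eq_or_lt with rfl | hlt2
  · obtain rfl := hV.eq hp hpq hz hb'
    right; right; exact hc
  · have h1 := hV.le_of_lt hz hb' hlt2
    cases b
    · left; simp at h1; exact ⟨rfl, by omega⟩
    · right; left; simp at h1; exact ⟨rfl, by omega⟩
    · simp at h1
      exact absurd (show OutMark p q V (z + p) false from Or.inl (by simpa using hz))
        (hno _ _ (by omega) (by omega))
    · simp at h1
      exact absurd (show OutMark p q V (z + q) true by simpa [OutMark] using hz)
        (hno _ _ (by omega) (by omega))
    · simp at h1
      exact absurd (show OutMark p q V (z + (3 * p - q)) false from Or.inr (by simpa using hz))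
        (hno _ _ (by omega) (by omega))

/-- The blocks between two consecutive output marks at distance less than `3 * p`. -/
theorem IsPath.out_gap (hV : IsPath p q V) (hp : 0 < p) (hpq : p < q) (hq : q < 2 * p)
    {x x' : ℤ} {t t' : Bool} (hx : OutMark p q V x t) (hx' : OutMark p q V x' t') (hxx : x < x')
    (hg : x' < x + 3 * p)
    (hno : ∀ y t, x < y → y < x' → ¬ OutMark p q V y t) :
    ∃ w, (w = x ∨ (w = x + (q - p) ∧ t = false ∧ V (x - (3 * p - q)) .mix)) ∧
      ((V w .outS ∧ x' = w + p ∧ t' = false) ∨ (V w .outL ∧ x' = w + q ∧ t' = true) ∨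
        (V w .mix ∧ x' = w + (3 * p - q) ∧ t' = false) ∨
        (V w .inS ∧ V (w + p) .outS ∧ x' = w + p + p ∧ t' = false) ∨
        (V w .inS ∧ V (w + p) .outL ∧ x' = w + p + q ∧ t' = true) ∨
        (V w .inS ∧ V (w + p) .mix ∧ x' = w + p + (3 * p - q) ∧ t' = false) ∨
        (V w .inL ∧ V (w + q) .outS ∧ x' = w + q + p ∧ t' = false) ∨
        (V w .inL ∧ V (w + q) .outL ∧ x' = w + q + q ∧ t' = true) ∨
        (V w .inL ∧ V (w + q) .mix ∧ x' = w + q + (3 * p - q) ∧ t' = false)) := by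
  obtain ⟨w, b, hb, hw⟩ := hx.boundary hV
  refine ⟨w, hw, ?_⟩
  have hxw : x ≤ w := by omega
  have hwx : w < x' := by
    rcases hw with h | ⟨h, -, hm⟩
    · omega
    · obtain ⟨z, c, hz, hc⟩ := hx'.exists_block
      rcases lt_trichotomy z (x - (3 * p - q)) with hlt | heq | hgt
      · have := hV.le_of_lt hz hm hlt
        rcases hc with ⟨rfl, h1, -⟩ | ⟨rfl, h1, -⟩ | ⟨rfl, h1, -⟩ <;> simp at this <;> omega
      · subst heq
        obtain rfl := hV.eq hp hpq hm hz
        simp at hc; omega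
      · have := hV.le_of_lt hm hz hgt
        simp at this
        rcases hc with ⟨rfl, h1, -⟩ | ⟨rfl, h1, -⟩ | ⟨rfl, h1, -⟩ <;> omega
  -- At most one block without an output mark fits into the gap: after two of them the next output
  -- mark would be at least `3 * p` away, which `hg` excludes.
  have key : ∀ {d : ℤ} {c : Block}, p ≤ d → V (w + d) c → w + d < x' →
      (V (w + d) .outS ∧ x' = w + d + p ∧ t' = false) ∨
      (V (w + d) .outL ∧ x' = w + d + q ∧ t' = true) ∨
      (V (w + d) .mix ∧ x' = w + d + (3 * p - q) ∧ t' = false) := by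
    intro d c hd hc hlt
    obtain ⟨e, he⟩ := hV.succ hc
    rcases hV.out_step hp hpq hq hc (by omega) hlt hx' hno with ⟨rfl, h⟩ | ⟨rfl, h⟩ | ⟨rfl, h⟩ |
      ⟨rfl, h⟩ | ⟨rfl, h⟩
    · exfalso
      rcases hV.out_step hp hpq hq he (by simp; omega) (by simpa using h) hx' hno with
        ⟨rfl, h⟩ | ⟨rfl, h⟩ | ⟨rfl, h⟩ | ⟨rfl, h⟩ | ⟨rfl, h⟩ <;> simp at h <;> omega
    · exfalso
      rcases hV.out_step hp hpq hq he (by simp; omega) (by simpa using h) hx' hno with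
        ⟨rfl, h⟩ | ⟨rfl, h⟩ | ⟨rfl, h⟩ | ⟨rfl, h⟩ | ⟨rfl, h⟩ <;> simp at h <;> omega
    · exact Or.inl ⟨hc, h⟩
    · exact Or.inr (Or.inl ⟨hc, h⟩)
    · exact Or.inr (Or.inr ⟨hc, h⟩)
  obtain ⟨c, hc⟩ := hV.succ hb
  rcases hV.out_step hp hpq hq hb hxw hwx hx' hno with ⟨rfl, h⟩ | ⟨rfl, h⟩ | ⟨rfl, h⟩ |
    ⟨rfl, h⟩ | ⟨rfl, h⟩
  · rcases key le_rfl hc h with h | h | h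
    · exact Or.inr (Or.inr (Or.inr (Or.inl ⟨hb, h⟩)))
    · exact Or.inr (Or.inr (Or.inr (Or.inr (Or.inl ⟨hb, h⟩))))
    · exact Or.inr (Or.inr (Or.inr (Or.inr (Or.inr (Or.inl ⟨hb, h⟩)))))
  · rcases key hpq.le hc h with h | h | h
    · exact Or.inr (Or.inr (Or.inr (Or.inr (Or.inr (Or.inr (Or.inl ⟨hb, h⟩))))))
    · exact Or.inr (Or.inr (Or.inr (Or.inr (Or.inr (Or.inr (Or.inr (Or.inl ⟨hb, h⟩)))))))
    · exact Or.inr (Or.inr (Or.inr (Or.inr (Or.inr (Or.inr (Or.inr (Or.inr ⟨hb, h⟩)))))))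
  · exact Or.inl ⟨hb, h⟩
  · exact Or.inr (Or.inl ⟨hb, h⟩)
  · exact Or.inr (Or.inr (Or.inl ⟨hb, h⟩))

end paths

section paths

variable {p q : ℤ} {V : ℤ → Block → Prop}

/-- An input mark within a given block. -/
theorem InMark.of_mem (hV : IsPath p q V) (hp : 0 < p) (hpq : p < q) (hq : q < 2 * p) {z y : ℤ}
    {c : Block} {t : Bool} (hc : V z c) (hzy : z ≤ y) (hy : y < z + c.len p q)
    (h : InMark p q V y t) :
    (c = .inS ∧ y = z ∧ t = false) ∨ (c = .inL ∧ y = z ∧ t = true) ∨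
      (c = .mix ∧ y = z + (q - p) ∧ t = false) := by
  have key : ∀ s b, V s b → s ≤ y → y < s + b.len p q → s = z ∧ b = c := by
    intro s b hb h1 h2
    rcases le_total s z with h3 | h3
    · rcases hV.sep hb hc h3 with h4 | h4
      · exact h4
      · omega
    · rcases hV.sep hc hb h3 with h4 | h4
      · exact ⟨h4.1.symm, h4.2.symm⟩
      · omega
  cases t
  · rcases h with h | h
    · obtain ⟨h1, h2⟩ := key _ _ h le_rfl (by simp; omega)
      exact Or.inl ⟨h2.symm, h1, rfl⟩
    · obtain ⟨h1, h2⟩ := key _ _ h (by omega) (by simp; omega)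
      exact Or.inr (Or.inr ⟨h2.symm, by omega, rfl⟩)
  · obtain ⟨h1, h2⟩ := key _ _ h le_rfl (by simp; omega)
    exact Or.inr (Or.inl ⟨h2.symm, h1, rfl⟩)

/-- An output mark within a given block. -/
theorem OutMark.of_mem (hV : IsPath p q V) (hp : 0 < p) (hpq : p < q) (hq : q < 2 * p) {z y : ℤ}
    {c : Block} {t : Bool} (hc : V z c) (hzy : z < y) (hy : y ≤ z + c.len p q)
    (h : OutMark p q V y t) :
    (c = .outS ∧ y = z + p ∧ t = false) ∨ (c = .outL ∧ y = z + q ∧ t = true) ∨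
      (c = .mix ∧ y = z + (3 * p - q) ∧ t = false) := by
  have h1 : mirror p q V (-z - c.len p q) c.flip := by
    rw [mirror_iff (y := z) (c := c) (by simp) (by simp)]; exact hc
  have := InMark.of_mem (hV.mirror hp hpq) hp hpq hq h1 (y := -y) (t := t) (by omega)
    (by simp; omega) (by rw [inMark_mirror, neg_neg]; exact h)
  cases c <;> simp [Block.flip] at this hy ⊢ <;> exact ⟨by omega, this.2⟩

end paths

/-! ### Stacked paths and the exclusion of `mix` -/

/-- Three consecutive block paths, with lengths `(q, p + q)`, `(p, q)`, `(q, p + q)`, such that the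
output marks of each are the input marks of the next one. -/
structure Triple (p q : ℤ) (V₁ V V₂ : ℤ → Block → Prop) : Prop where
  hp : 0 < p
  hpq : p < q
  hq : q < 2 * p
  h₁ : IsPath q (p + q) V₁
  h : IsPath p q V
  h₂ : IsPath q (p + q) V₂
  m₁ : ∀ x t, OutMark q (p + q) V₁ x t ↔ InMark p q V x t
  m₂ : ∀ x t, OutMark p q V x t ↔ InMark q (p + q) V₂ x t

namespace Triple

variable {p q : ℤ} {V₁ V V₂ : ℤ → Block → Prop}

theorem mirror (T : Triple p q V₁ V V₂) :
    Triple p q (mirror q (p + q) V₂) (mirror p q V) (mirror q (p + q) V₁) where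
  hp := T.hp
  hpq := T.hpq
  hq := T.hq
  h₁ := T.h₂.mirror (by have := T.hp; have := T.hpq; omega) (by have := T.hp; omega)
  h := T.h.mirror T.hp T.hpq
  h₂ := T.h₁.mirror (by have := T.hp; have := T.hpq; omega) (by have := T.hp; omega)
  m₁ x t := by rw [outMark_mirror, inMark_mirror, T.m₂]
  m₂ x t := by rw [outMark_mirror, inMark_mirror, T.m₁]

/-- The input marks of the middle path are the output marks of the first one, so their distances are
sums of block lengths of `V₁`. Comparing this short list with the sums possible in `V` drives all
that follows. -/
theorem gap (T : Triple p q V₁ V V₂) {x x' : ℤ} {t t' : Bool} (hx : InMark p q V x t)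
    (hx' : InMark p q V x' t') (hxx : x < x') (hg : x' < x + 3 * q)
    (hno : ∀ y t, x < y → y < x' → ¬ InMark p q V y t) :
    ∃ w, (w = x ∨ (w = x + p ∧ t = false ∧ V₁ (x - (2 * q - p)) .mix)) ∧
      ((V₁ w .outS ∧ x' = w + q ∧ t' = false) ∨ (V₁ w .outL ∧ x' = w + (p + q) ∧ t' = true) ∨
        (V₁ w .mix ∧ x' = w + (2 * q - p) ∧ t' = false) ∨
        (V₁ w .inS ∧ V₁ (w + q) .outS ∧ x' = w + q + q ∧ t' = false) ∨
        (V₁ w .inS ∧ V₁ (w + q) .outL ∧ x' = w + q + (p + q) ∧ t' = true) ∨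
        (V₁ w .inS ∧ V₁ (w + q) .mix ∧ x' = w + q + (2 * q - p) ∧ t' = false) ∨
        (V₁ w .inL ∧ V₁ (w + (p + q)) .outS ∧ x' = w + (p + q) + q ∧ t' = false) ∨
        (V₁ w .inL ∧ V₁ (w + (p + q)) .outL ∧ x' = w + (p + q) + (p + q) ∧ t' = true) ∨
        (V₁ w .inL ∧ V₁ (w + (p + q)) .mix ∧ x' = w + (p + q) + (2 * q - p) ∧ t' = false)) := by
  have := T.hp; have := T.hpq; have := T.hq
  have := T.h₁.out_gap (by omega) (by omega) (by omega) ((T.m₁ _ _).2 hx) ((T.m₁ _ _).2 hx') hxx hg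
    (fun y t h1 h2 h3 => hno y t h1 h2 ((T.m₁ _ _).1 h3))
  simpa only [show p + q - q = p by ring, show 3 * q - (p + q) = 2 * q - p by ring] using this

/-- The block after a block `mix` carries no input mark. -/
theorem not_in_after_mix (T : Triple p q V₁ V V₂) (hr : 3 * p < 2 * q) {z : ℤ} {c : Block}
    (hz : V z .mix) (hc : V (z + 2 * p) c) : c = .outS ∨ c = .outL := by
  have := T.hp; have hpq := T.hpq; have := T.hq
  have hx : InMark p q V (z + (q - p)) false := Or.inr (by simpa using hz)
  have hno : ∀ y t, z + (q - p) < y → y < z + 2 * p → ¬ InMark p q V y t := by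
    intro y t h1 h2 h3
    rcases InMark.of_mem T.h T.hp T.hpq T.hq hz (by omega) (by simpa using h2) h3 with h | h | h
    · simp at h
    · simp at h
    · omega
  cases c
  · exfalso
    -- The marks would be `3 * p - q` apart, less than the smallest admissible distance `q`, because
    -- `3 * p < 2 * q`.
    obtain ⟨w, hw, hc⟩ := T.gap hx (show InMark p q V (z + 2 * p) false from Or.inl hc) (by omega)
      (by omega) hno
    omega
  · exfalso
    obtain ⟨w, hw, hc⟩ := T.gap hx (show InMark p q V (z + 2 * p) true from hc) (by omega)
      (by omega) hno
    omega
  · simp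
  · simp
  · exfalso
    -- The marks of two adjacent blocks `mix` are `2 * p` apart, strictly between the admissible
    -- distances `q` and `2 * q - p`.
    obtain ⟨w, hw, hc⟩ := T.gap hx (x' := z + (p + q)) (t' := false)
      (Or.inr (by rw [show z + (p + q) - (q - p) = z + 2 * p by ring]; exact hc)) (by omega)
      (by omega) (by
        intro y t h1 h2 h3
        rcases lt_or_ge y (z + 2 * p) with h | h
        · exact hno y t h1 h h3
        · rcases InMark.of_mem T.h T.hp T.hpq T.hq hc h (by simp; omega) h3 with h | h | h
          · simp at h
          · simp at h
          · omega)
    omega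

/-- Adjacent blocks with input marks. -/
theorem in_in (T : Triple p q V₁ V V₂) {z : ℤ} {b c : Block} (hb : b = .inS ∨ b = .inL)
    (hz : V z b) (hc : V (z + b.len p q) c) :
    (b = .inL ∧ c = .inS ∧ V₁ z .outS) ∨ c = .outS ∨ c = .outL ∨ c = .mix := by
  have hp := T.hp; have hpq := T.hpq; have hq := T.hq
  obtain ⟨t, ht, hx, -⟩ : ∃ t, (t = true ↔ b = .inL) ∧ InMark p q V z t ∧ True := by
    rcases hb with rfl | rfl
    · exact ⟨false, by simp, Or.inl hz, trivial⟩
    · exact ⟨true, by simp, hz, trivial⟩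
  have hlen := b.len_ge hp hpq
  have hno : ∀ y t, z < y → y < z + b.len p q → ¬ InMark p q V y t := by
    intro y t h1 h2 h3
    rcases InMark.of_mem T.h hp hpq hq hz h1.le h2 h3 with h | h | h
    · omega
    · omega
    · rcases hb with rfl | rfl <;> simp at h
  have hlt : b.len p q < 2 * q := by rcases hb with rfl | rfl <;> simp <;> omega
  cases c
  · obtain ⟨w, hw, hc⟩ := T.gap hx (show InMark p q V (z + b.len p q) false from Or.inl hc)
      (by omega) (by omega) hno
    rcases hb with rfl | rfl
    · simp at hc; omega
    · left
      simp at hc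
      simp at ht; subst ht
      have : w = z := by simpa using hw
      subst this
      refine ⟨rfl, rfl, ?_⟩
      rcases hc with h | h | h | h | h
      · exact h.1
      all_goals omega
  · exfalso
    obtain ⟨w, hw, hc⟩ := T.gap hx (show InMark p q V (z + b.len p q) true from hc)
      (by omega) (by omega) hno
    rcases hb with rfl | rfl <;> simp at hc <;> omega
  · simp
  · simp
  · simp

theorem before_mix (T : Triple p q V₁ V V₂) (hr : 3 * p < 2 * q) {z : ℤ} {b : Block}
    (hz : V z .mix) (hb : V (z - b.len p q) b) : b = .inS ∨ b = .inL := by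
  have h := T.mirror.not_in_after_mix hr (z := -z - 2 * p) (c := b.flip)
    ((mirror_iff (by simp) rfl).2 hz) ((mirror_iff (by simp) (by simp)).2 hb)
  cases b <;> simp [Block.flip] at h ⊢

/-- The distance of consecutive output marks. -/
theorem out_dist (T : Triple p q V₁ V V₂) {x x' : ℤ} {t t' : Bool} (hx : OutMark p q V x t)
    (hx' : OutMark p q V x' t') (hxx : x < x') (hg : x' < x + 3 * q)
    (hno : ∀ y t, x < y → y < x' → ¬ OutMark p q V y t) :
    ∃ d, (d = 0 ∨ d = p) ∧ (x' = x + d + q ∨ x' = x + d + (p + q) ∨ x' = x + d + (2 * q - p) ∨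
      x' = x + d + 2 * q ∨ x' = x + d + (p + 2 * q) ∨ x' = x + d + (3 * q - p) ∨
      x' = x + d + (2 * p + 2 * q) ∨ x' = x + d + 3 * q) := by
  obtain ⟨w, hw, h⟩ := T.mirror.gap (x := -x') (x' := -x) (t := t') (t' := t)
    (by rw [inMark_mirror, neg_neg]; exact hx') (by rw [inMark_mirror, neg_neg]; exact hx)
    (by omega) (by omega) (by
      intro y t h1 h2 h3
      rw [inMark_mirror] at h3
      exact hno _ _ (by omega) (by omega) h3)
  exact ⟨w + x', by omega, by omega⟩

/-- A block `mix` cannot occur in the middle path. -/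
theorem noMix (T : Triple p q V₁ V V₂) (hr : 3 * p < 2 * q) (hr' : 3 * q < 5 * p) : NoMix V := by
  have hp := T.hp; have hpq := T.hpq; have hq := T.hq
  intro z hz
  have hmix : OutMark p q V (z + (3 * p - q)) false := Or.inr (by simpa using hz)
  have hzmix : ∀ y t, z < y → y < z + (3 * p - q) → ¬ OutMark p q V y t := by
    intro y t h1 h2 h3
    rcases OutMark.of_mem T.h hp hpq hq hz h1 (by simp; omega) h3 with h | h | h
    · simp at h
    · simp at h
    · omega
  have noin : ∀ {s b}, V s b → b = .inS ∨ b = .inL → ∀ y t, s < y → y ≤ s + b.len p q →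
      ¬ OutMark p q V y t := by
    intro s b hs hb y t h1 h2 h3
    rcases OutMark.of_mem T.h hp hpq hq hs h1 h2 h3 with h | h | h <;> rcases hb with rfl | rfl <;>
      simp at h
  -- Here `s` is the end of the last block with an output mark before the `mix`. The distance from
  -- `s` to the output mark of the `mix` is `4 * p - q`, `3 * p` or `4 * p`, and none of these is in
  -- the list of `out_dist` when the ratio `q / p` lies strictly between 3/2 and 5/3.
  have final : ∀ s b, V (s - b.len p q) b → b = .outS ∨ b = .outL → s = z - p ∨ s = z - q ∨
      s = z - p - q → ¬ ∀ y t, s < y → y < z + (3 * p - q) → ¬ OutMark p q V y t := by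
    intro s b hs hb hd hno
    obtain ⟨t, ht⟩ : ∃ t, OutMark p q V s t := by
      rcases hb with rfl | rfl
      · exact ⟨false, Or.inl hs⟩
      · exact ⟨true, hs⟩
    obtain ⟨d, hd', h⟩ := T.out_dist ht hmix (by omega) (by omega) hno
    clear hno ht hs hb hmix hzmix noin
    rcases hd with rfl | rfl | rfl <;> rcases hd' with rfl | rfl <;> omega
  have combine : ∀ {s b}, V s b → b = .inS ∨ b = .inL → 
      (∀ y t, s + b.len p q < y → y < z + (3 * p - q) → ¬ OutMark p q V y t) → 
      ∀ y t, s < y → y < z + (3 * p - q) → ¬ OutMark p q V y t := by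
    intro s b hs hb h y t h1 h2
    rcases le_or_gt y (s + b.len p q) with h3 | h3
    · exact noin hs hb y t h1 h3
    · exact h y t h3 h2
  obtain ⟨b₁, h₁⟩ := T.h.pred hz
  have e₁ := T.before_mix hr hz h₁
  obtain ⟨b₀, h₀⟩ := T.h.pred h₁
  have hno₁ := combine h₁ e₁ (by simpa using hzmix)
  have ne₀ : b₀ ≠ .mix := by
    rintro rfl
    have := T.not_in_after_mix hr h₀ (c := b₁) (by simpa using h₁)
    rcases e₁ with rfl | rfl <;> simp at this
  have ii₀ : b₀ = .inS ∨ b₀ = .inL → b₀ = .inL ∧ b₁ = .inS := by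
    intro hb
    have := T.in_in hb h₀ (c := b₁) (by simpa using h₁)
    rcases e₁ with rfl | rfl <;> simp at this <;> tauto
  by_cases hin : b₀ = .inS ∨ b₀ = .inL
  · obtain ⟨rfl, rfl⟩ := ii₀ hin
    obtain ⟨b, hb⟩ := T.h.pred h₀
    refine final _ b hb ?_ (by simp) (combine h₀ (by simp) (by simpa using hno₁))
    have nem : b ≠ .mix := by
      rintro rfl
      have := T.not_in_after_mix hr hb (c := .inL) (by simpa using h₀)
      simp at this
    by_contra hcon
    have := T.in_in (b := b) (by clear hb; cases b <;> simp at hcon nem ⊢) hb (c := .inL) (by simpa using h₀)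
    simp at this
  · refine final _ b₀ h₀ ?_ (by rcases e₁ with rfl | rfl <;> simp) hno₁
    clear h₀ ii₀
    cases b₀ <;> simp at hin ne₀ ⊢

end Triple

namespace Triple

variable {p q : ℤ} {V₁ V V₂ : ℤ → Block → Prop}

/-- Adjacent blocks with output marks. -/
theorem out_out (T : Triple p q V₁ V V₂) {z : ℤ} {b c : Block}
    (hb : b = .outS ∨ b = .outL) (hc' : c = .outS ∨ c = .outL)
    (hz : V z b) (hc : V (z + b.len p q) c) : b = .outS ∧ c = .outL ∧ V₂ (z + p) .inS := by
  have h := T.mirror.in_in (z := -z - b.len p q - c.len p q) (b := c.flip) (c := b.flip)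
    (by rcases hc' with rfl | rfl <;> simp [Block.flip])
    ((mirror_iff (by simp; ring) (by simp)).2 hc) ((mirror_iff (by simp; try ring) (by simp)).2 hz)
  rcases hb with rfl | rfl <;> rcases hc' with rfl | rfl <;> simp [Block.flip] at h
  refine ⟨rfl, rfl, ?_⟩
  rwa [mirror_iff (y := z + p) (c := .inS) (by simp; ring) rfl] at h

theorem no_in_within (T : Triple p q V₁ V V₂) (hn : NoMix V) {z : ℤ} {b : Block} (hz : V z b)
    {y : ℤ} {t : Bool} (h1 : z ≤ y) (h2 : y < z + b.len p q) (hb : z < y ∨ b = .outS ∨ b = .outL) :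
    ¬ InMark p q V y t := by
  intro h
  rcases InMark.of_mem T.h T.hp T.hpq T.hq hz h1 h2 h with h | h | h
  · rcases hb with hb | rfl | rfl
    · omega
    · simp at h
    · simp at h
  · rcases hb with hb | rfl | rfl
    · omega
    · simp at h
    · simp at h
  · exact hn z (h.1 ▸ hz)

theorem no_in_two (T : Triple p q V₁ V V₂) (hn : NoMix V) {z : ℤ} {b c : Block} (hz : V z b)
    (hc : V (z + b.len p q) c) (hc' : c = .outS ∨ c = .outL) :
    ∀ y t, z < y → y < z + b.len p q + c.len p q → ¬ InMark p q V y t := by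
  intro y t h1 h2
  rcases lt_or_ge y (z + b.len p q) with h | h
  · exact T.no_in_within hn hz h1.le h (Or.inl h1)
  · exact T.no_in_within hn hc h h2 (Or.inr hc')

theorem no_in_three (T : Triple p q V₁ V V₂) (hn : NoMix V) {z : ℤ} {b c d : Block} (hz : V z b)
    (hc : V (z + b.len p q) c) (hc' : c = .outS ∨ c = .outL)
    (hd : V (z + b.len p q + c.len p q) d) (hd' : d = .outS ∨ d = .outL) :
    ∀ y t, z < y → y < z + b.len p q + c.len p q + d.len p q → ¬ InMark p q V y t := by
  intro y t h1 h2
  rcases lt_or_ge y (z + b.len p q + c.len p q) with h | h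
  · exact T.no_in_two hn hz hc hc' y t h1 h
  · exact T.no_in_within hn hd h h2 (Or.inr hd')

theorem inMark_of (hV : V z b) (hb : b = .inS ∨ b = .inL) :
    ∃ t, InMark p q V z t ∧ (t = true ↔ b = .inL) := by
  rcases hb with rfl | rfl
  · exact ⟨false, Or.inl hV, by simp⟩
  · exact ⟨true, hV, by simp⟩

/-- A `mix` of `V₁` writes a short mark, which `V` reads with a block `inS`. Seen from `V₁`, the gap
before this mark has to end with the `mix`. Seen from `V`, it consists of a block with an input mark
and at most two blocks with output marks. The two lists of lengths are disjoint. -/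
theorem noMix_left (T : Triple p q V₁ V V₂) (hn : NoMix V) (hr : 3 * p < 2 * q) : NoMix V₁ := by
  have hp := T.hp; have hpq := T.hpq; have hq := T.hq
  intro w₀ hw₀
  obtain ⟨x', hx'⟩ : ∃ x', x' = w₀ + (2 * q - p) := ⟨_, rfl⟩
  have hm : InMark p q V x' false := (T.m₁ _ _).1 (Or.inr (by
    rw [show x' - (3 * q - (p + q)) = w₀ by omega]; exact hw₀))
  have hV : V x' .inS := hm.resolve_right (hn _)
  have h1 : ∀ w, x' = w + q → ¬ V₁ w .outS := by
    intro w hw h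
    have := T.h₁.le_of_lt hw₀ h (by omega)
    simp at this; omega
  have final : ∀ x b, V x b → b = .inS ∨ b = .inL →
      (b = .inL ∧ (x' = x + q ∨ x' = x + 2 * q ∨ x' = x + (p + q) ∨ x' = x + (p + 2 * q))) ∨
      (x' = x + (p + q) ∨ x' = x + 2 * p ∨ x' = x + (2 * p + q)) → 
      ¬ ∀ y t, x < y → y < x' → ¬ InMark p q V y t := by
    intro x b hx hb hd hno
    obtain ⟨t, ht, htb⟩ := inMark_of (p := p) (q := q) hx hb
    obtain ⟨w, hw, h⟩ := T.gap ht hm (by omega) (by omega) hno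
    have h2 : w = x ∨ (w = x + p ∧ ¬ b = .inL) := by
      rcases hw with h | ⟨h, h', -⟩
      · exact Or.inl h
      · exact Or.inr ⟨h, by rw [← htb]; simp [h']⟩
    have h3 : x' = w + (2 * q - p) ∨ x' = w + q + (2 * q - p) ∨ x' = w + (p + q) + (2 * q - p) := by
      rcases h with h | h | h | h | h | h | h | h | h
      · exact absurd h.1 (h1 _ h.2.1)
      · simp at h
      · exact Or.inl h.2.1
      · exact absurd h.2.1 (h1 _ h.2.2.1)
      · simp at h
      · exact Or.inr (Or.inl h.2.2.1)
      · exact absurd h.2.1 (h1 _ h.2.2.1)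
      · simp at h
      · exact Or.inr (Or.inr h.2.2.1)
    clear h h1 hno hw htb ht
    rcases hd with ⟨hbl, hd⟩ | hd
    · have : w = x := by simpa [hbl] using h2
      omega
    · rcases hd with rfl | rfl | rfl <;> omega
  obtain ⟨b₁, h₁⟩ := T.h.pred hV
  have nm : ∀ {x b}, V x b → b ≠ .mix := by rintro x b h rfl; exact hn _ h
  have s₁ : x' - b₁.len p q + b₁.len p q = x' := by ring
  by_cases e₁ : b₁ = .inS ∨ b₁ = .inL
  · have := T.in_in e₁ h₁ (c := .inS) (by rw [s₁]; exact hV)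
    simp at this
    obtain ⟨rfl, -⟩ := this
    exact final _ _ h₁ (by simp) (by simp) (fun y t h1 h2 =>
      T.no_in_within hn h₁ h1.le (by simpa using h2) (Or.inl h1))
  have e₁' : b₁ = .outS ∨ b₁ = .outL := by
    have := nm h₁; clear h₁; cases b₁ <;> simp at e₁ this ⊢
  obtain ⟨b₂, h₂⟩ := T.h.pred h₁
  have s₂ : x' - b₁.len p q - b₂.len p q + b₂.len p q = x' - b₁.len p q := by ring
  by_cases e₂ : b₂ = .inS ∨ b₂ = .inL
  · refine final _ _ h₂ e₂ ?_ (fun y t h1 h2 =>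
      T.no_in_two hn h₂ (c := b₁) (by rw [s₂]; exact h₁) e₁' _ _ h1 (by rw [s₂, s₁]; exact h2))
    rcases e₁' with rfl | rfl <;> rcases e₂ with rfl | rfl <;> simp <;> omega
  have e₂' : b₂ = .outS ∨ b₂ = .outL := by
    have := nm h₂; clear h₂; cases b₂ <;> simp at e₂ this ⊢
  obtain ⟨rfl, rfl, -⟩ := T.out_out e₂' e₁' h₂ (by rw [s₂]; exact h₁)
  obtain ⟨b₃, h₃⟩ := T.h.pred h₂
  have e₃ : b₃ = .inS ∨ b₃ = .inL := by
    by_contra e₃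
    have e₃' : b₃ = .outS ∨ b₃ = .outL := by
      have := nm h₃; clear h₃; cases b₃ <;> simp at e₃ this ⊢
    have := T.out_out e₃' e₂' h₃ (by simpa using h₂)
    simp at this
  refine final _ _ h₃ e₃ ?_ (fun y t h1 h2 =>
    T.no_in_three hn h₃ (c := .outS) (d := .outL) (by simpa using h₂) (by simp)
      (by simpa using h₁) (by simp) _ _ h1 (by simp at h2 ⊢; omega))
  rcases e₃ with rfl | rfl <;> simp <;> omega

theorem noMix_right (T : Triple p q V₁ V V₂) (hn : NoMix V) (hr : 3 * p < 2 * q) : NoMix V₂ := by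
  have := (T.mirror.noMix_left hn.mirror hr).mirror (p := q) (q := p + q)
  rwa [mirror_mirror] at this

end Triple

/-! ### Pure triples: the admissible gaps of the middle path -/

/-- A triple of block paths without blocks `mix`. -/
structure PureTriple (p q : ℤ) (V₁ V V₂ : ℤ → Block → Prop) : Prop extends Triple p q V₁ V V₂ where
  n₁ : NoMix V₁
  n : NoMix V
  n₂ : NoMix V₂

namespace PureTriple

variable {p q : ℤ} {V₁ V V₂ : ℤ → Block → Prop}

theorem mirror (T : PureTriple p q V₁ V V₂) :
    PureTriple p q (mirror q (p + q) V₂) (mirror p q V) (mirror q (p + q) V₁) :=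
  ⟨T.toTriple.mirror, T.n₂.mirror, T.n.mirror, T.n₁.mirror⟩

theorem gap (T : PureTriple p q V₁ V V₂) {x x' : ℤ} {t t' : Bool} (hx : InMark p q V x t)
    (hx' : InMark p q V x' t') (hxx : x < x') (hg : x' < x + 3 * q)
    (hno : ∀ y t, x < y → y < x' → ¬ InMark p q V y t) :
    ((V₁ x .outS ∧ x' = x + q ∧ t' = false) ∨ (V₁ x .outL ∧ x' = x + (p + q) ∧ t' = true) ∨
        (V₁ x .inS ∧ V₁ (x + q) .outS ∧ x' = x + q + q ∧ t' = false) ∨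
        (V₁ x .inS ∧ V₁ (x + q) .outL ∧ x' = x + q + (p + q) ∧ t' = true) ∨
        (V₁ x .inL ∧ V₁ (x + (p + q)) .outS ∧ x' = x + (p + q) + q ∧ t' = false) ∨
        (V₁ x .inL ∧ V₁ (x + (p + q)) .outL ∧ x' = x + (p + q) + (p + q) ∧ t' = true)) := by
  obtain ⟨w, hw, h⟩ := T.toTriple.gap hx hx' hxx hg hno
  have hw : w = x := hw.resolve_right (fun h => T.n₁ _ h.2.2)
  subst hw
  rcases h with h | h | h | h | h | h | h | h | h
  · exact Or.inl h
  · exact Or.inr (Or.inl h)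
  · exact absurd h.1 (T.n₁ _)
  · exact Or.inr (Or.inr (Or.inl h))
  · exact Or.inr (Or.inr (Or.inr (Or.inl h)))
  · exact absurd h.2.1 (T.n₁ _)
  · exact Or.inr (Or.inr (Or.inr (Or.inr (Or.inl h))))
  · exact Or.inr (Or.inr (Or.inr (Or.inr (Or.inr h))))
  · exact absurd h.2.1 (T.n₁ _)

theorem inL_next_in (T : PureTriple p q V₁ V V₂) {z : ℤ} {b c : Block} (hb : b = .inS ∨ b = .inL)
    (hc' : c = .inS ∨ c = .inL) (hz : V z b) (hc : V (z + b.len p q) c) :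
    b = .inL ∧ c = .inS ∧ V₁ z .outS := by
  rcases T.in_in hb hz hc with h | h | h | h
  · exact h
  all_goals rcases hc' with rfl | rfl <;> simp at h

/-- In this lemma and the next two, the blocks of `V` between two input marks give the length of the
gap, and `V₁` realises only `q`, `p + q`, `2 * q`, `p + 2 * q` and `2 * p + 2 * q`. For `outL` the
possible lengths are `p + q` and `2 * q`. For `outS` and for `outS`, `outL` the gap has to start
with `inL`, since `2 * p` and `2 * p + q` are not realised. -/
theorem gap_outL (T : PureTriple p q V₁ V V₂) {z : ℤ} {b c : Block} (hb : b = .inS ∨ b = .inL)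
    (hc' : c = .inS ∨ c = .inL) (hz : V z b) (ho : V (z + b.len p q) .outL)
    (hc : V (z + b.len p q + q) c) :
    (b = .inL ∧ c = .inS ∧ V₁ z .inS ∧ V₁ (z + q) .outS) ∨ (b = .inS ∧ c = .inL ∧ V₁ z .outL) := by
  have hp := T.hp; have hpq := T.hpq; have hq := T.hq
  obtain ⟨t, ht, htb⟩ := Triple.inMark_of (p := p) (q := q) hz hb
  obtain ⟨t', ht', htc⟩ := Triple.inMark_of (p := p) (q := q) hc hc'
  have hno := T.no_in_two T.n hz ho (by simp)
  have := T.gap ht ht' (by rcases hb with rfl | rfl <;> simp <;> omega)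
    (by rcases hb with rfl | rfl <;> simp <;> omega) hno
  rcases hb with rfl | rfl
  · right
    simp only [Block.len_inS] at this
    rcases this with h | h | h | h | h | h
    · omega
    · exact ⟨rfl, htc.1 h.2.2, h.1⟩
    all_goals omega
  · left
    simp only [Block.len_inL] at this
    rcases this with h | h | h | h | h | h
    · omega
    · omega
    · refine ⟨rfl, ?_, h.1, h.2.1⟩
      rcases hc' with h' | h'
      · exact h'
      · rw [htc.2 h'] at h; simp at h
    all_goals omega

theorem gap_outS (T : PureTriple p q V₁ V V₂) {z : ℤ} {b c : Block} (hb : b = .inS ∨ b = .inL)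
    (hc' : c = .inS ∨ c = .inL) (hz : V z b) (ho : V (z + b.len p q) .outS)
    (hc : V (z + b.len p q + p) c) : b = .inL ∧ c = .inL ∧ V₁ z .outL := by
  have hp := T.hp; have hpq := T.hpq; have hq := T.hq
  obtain ⟨t, ht, htb⟩ := Triple.inMark_of (p := p) (q := q) hz hb
  obtain ⟨t', ht', htc⟩ := Triple.inMark_of (p := p) (q := q) hc hc'
  have hno := T.no_in_two T.n hz ho (by simp)
  have := T.gap ht ht' (by rcases hb with rfl | rfl <;> simp <;> omega)
    (by rcases hb with rfl | rfl <;> simp <;> omega) hno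
  rcases hb with rfl | rfl
  · simp only [Block.len_inS] at this
    omega
  · simp only [Block.len_inL] at this
    rcases this with h | h | h | h | h | h
    · omega
    · exact ⟨rfl, htc.1 h.2.2, h.1⟩
    all_goals omega

theorem gap_outSL (T : PureTriple p q V₁ V V₂) {z : ℤ} {b c : Block} (hb : b = .inS ∨ b = .inL)
    (hc' : c = .inS ∨ c = .inL) (hz : V z b) (ho : V (z + b.len p q) .outS)
    (ho' : V (z + b.len p q + p) .outL) (hc : V (z + b.len p q + p + q) c) :
    b = .inL ∧ ((c = .inS ∧ V₁ z .inL ∧ V₁ (z + (p + q)) .outS) ∨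
      (c = .inL ∧ V₁ z .inS ∧ V₁ (z + q) .outL)) := by
  have hp := T.hp; have hpq := T.hpq; have hq := T.hq
  obtain ⟨t, ht, htb⟩ := Triple.inMark_of (p := p) (q := q) hz hb
  obtain ⟨t', ht', htc⟩ := Triple.inMark_of (p := p) (q := q) hc hc'
  have hno := T.no_in_three T.n hz ho (by simp) ho' (by simp)
  have := T.gap ht ht' (by rcases hb with rfl | rfl <;> simp <;> omega)
    (by rcases hb with rfl | rfl <;> simp <;> omega) hno
  rcases hb with rfl | rfl
  · simp only [Block.len_inS] at this
    omega
  · simp only [Block.len_inL] at this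
    refine ⟨rfl, ?_⟩
    rcases this with h | h | h | h | h | h
    · omega
    · omega
    · omega
    · exact Or.inr ⟨htc.1 h.2.2.2, h.1, h.2.1⟩
    · refine Or.inl ⟨?_, h.1, h.2.1⟩
      rcases hc' with h' | h'
      · exact h'
      · rw [htc.2 h'] at h; simp at h
    · omega

end PureTriple

/-- Every position lies in a block. -/
theorem IsPath.cover {p q : ℤ} {V : ℤ → Block → Prop} (hV : IsPath p q V) (hp : 0 < p)
    (hpq : p < q) (x : ℤ) : ∃ z b, V z b ∧ z ≤ x ∧ x < z + b.len p q := by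
  have up : ∀ n : ℕ, ∀ z b, V z b → z ≤ x → x < z + n → ∃ z b, V z b ∧ z ≤ x ∧ x < z + b.len p q := by
    intro n
    induction n with
    | zero => intro z b _ h1 h2; simp at h2; omega
    | succ n ih =>
      intro z b hz h1 h2
      rcases lt_or_ge x (z + b.len p q) with h | h
      · exact ⟨z, b, hz, h1, h⟩
      · obtain ⟨c, hc⟩ := hV.succ hz
        have := b.len_ge hp hpq
        exact ih _ c hc h (by push_cast at h2; omega)
  have down : ∀ n : ℕ, ∀ z b, V z b → z ≤ x + n → ∃ z b, V z b ∧ z ≤ x := by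
    intro n
    induction n with
    | zero => intro z b hz h1; exact ⟨z, b, hz, by simpa using h1⟩
    | succ n ih =>
      intro z b hz h1
      obtain ⟨c, hc⟩ := hV.pred hz
      have := c.len_ge hp hpq
      exact ih _ c hc (by push_cast at h1; omega)
  obtain ⟨z, b, hz⟩ := hV.ne
  obtain ⟨z, b, hz, h⟩ := down (z - x).toNat z b hz (by omega)
  exact up ((x - z).toNat + 1) z b hz h (by push_cast; omega)

/-! ### Composition of a pure triple -/

/-- The block path composed from a triple of block paths. Its blocks extend between the positions
where a block `inL` follows a block `outL` in the middle path. -/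
def compose (p q : ℤ) (V : ℤ → Block → Prop) (x : ℤ) : Block → Prop
  | .outS => (V (x - q) .outL ∧ V x .inL) ∧ V (x + q) .inS ∧
      V (x + q + p) .outL ∧ V (x + q + p + q) .inL
  | .inS => (V (x - q) .outL ∧ V x .inL) ∧ V (x + q) .outS ∧
      V (x + q + p) .outL ∧ V (x + q + p + q) .inL
  | .inL => (V (x - q) .outL ∧ V x .inL) ∧ V (x + q) .outS ∧ V (x + q + p) .outL ∧
      V (x + q + p + q) .inS ∧ V (x + q + p + q + p) .outL ∧ V (x + q + p + q + p + q) .inL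
  | .outL => (V (x - q) .outL ∧ V x .inL) ∧ V (x + q) .outS ∧ V (x + q + p) .inL ∧
      V (x + q + p + q) .inS ∧ V (x + q + p + q + p) .outL ∧ V (x + q + p + q + p + q) .inL
  | .mix => (V (x - q) .outL ∧ V x .inL) ∧ V (x + q) .outS ∧ V (x + q + p) .inL ∧
      V (x + q + p + q) .outL ∧ V (x + q + p + q + q) .inS ∧ V (x + q + p + q + q + p) .outL ∧
      V (x + q + p + q + q + p + q) .inL

theorem compose_mirror (p q : ℤ) (V : ℤ → Block → Prop) :
    compose p q (mirror p q V) = mirror (p + 2 * q) (2 * p + 3 * q) (compose p q V) := by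
  have h : ∀ {x y : ℤ} {b : Block}, y = -x - b.len p q →
      (mirror p q V x b ↔ V y b.flip) := fun hy => mirror_iff hy rfl
  funext x b
  apply propext
  cases b
  · simp only [compose, mirror, Block.flip, Block.len]
    ring_nf
    tauto
  all_goals
    simp only [compose, mirror, Block.flip, Block.len]
    ring_nf
    tauto

namespace PureTriple

variable {p q : ℤ} {V₁ V V₂ : ℤ → Block → Prop}

theorem inL_outL (T : PureTriple p q V₁ V V₂) {z : ℤ} (hz : V z .inL) (ho : V (z + q) .outL) :
    V (z + q + q) .inS ∧ V₁ z .inS ∧ V₁ (z + q) .outS := by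
  obtain ⟨c, hc⟩ := T.h.succ ho
  have hc' : c = .inS ∨ c = .inL := by
    by_contra h
    have := T.out_out (c := c) (by simp) (by
      have := T.n _ |> mt (fun h' : c = .mix => h' ▸ hc)
      cases c <;> simp_all) ho hc
    simp at this
  rcases T.gap_outL (by simp) hc' hz ho hc with ⟨-, rfl, h⟩ | h
  · exact ⟨hc, h⟩
  · simp at h

theorem cases_block (T : PureTriple p q V₁ V V₂) {z : ℤ} {b : Block} (hz : V z b) :
    (b = .inS ∨ b = .inL) ∨ (b = .outS ∨ b = .outL) := by
  have : b ≠ .mix := fun h => T.n z (h ▸ hz)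
  clear hz; cases b <;> simp at this ⊢

theorem outL_next (T : PureTriple p q V₁ V V₂) {z : ℤ} (hz : V z .outL) :
    V (z + q) .inS ∨ V (z + q) .inL := by
  obtain ⟨c, hc⟩ := T.h.succ hz
  rcases T.cases_block hc with (rfl | rfl) | h
  · exact Or.inl hc
  · exact Or.inr hc
  · have := T.out_out (by simp) h hz hc
    simp at this

/-- Any gap of input marks that contains an `outS` starts with `inL`, and no block with an output
mark can precede `outS`. By reflection this and the following facts become rules for what follows
`inS`. -/
theorem outS_prev (T : PureTriple p q V₁ V V₂) {z : ℤ} (hz : V z .outS) : V (z - q) .inL := by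
  obtain ⟨b, hb⟩ := T.h.pred hz
  obtain ⟨c, hc⟩ := T.h.succ hz
  have e : z - b.len p q + b.len p q = z := by ring
  rcases T.cases_block hb with hb' | hb'
  · rcases T.cases_block hc with hc' | hc'
    · obtain ⟨rfl, -⟩ := T.gap_outS hb' hc' hb (by rw [e]; exact hz) (by rw [e]; exact hc)
      exact hb
    · obtain ⟨-, rfl, -⟩ := T.out_out (by simp) hc' hz hc
      obtain ⟨d, hd⟩ := T.h.succ hc
      rcases T.outL_next hc with h | h
      · obtain ⟨rfl, -⟩ := T.gap_outSL hb' (c := .inS) (by simp) hb (by rw [e]; exact hz)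
          (by rw [e]; exact hc) (by rw [e]; exact h)
        exact hb
      · obtain ⟨rfl, -⟩ := T.gap_outSL hb' (c := .inL) (by simp) hb (by rw [e]; exact hz)
          (by rw [e]; exact hc) (by rw [e]; exact h)
        exact hb
  · have := T.out_out hb' (by simp) hb (c := .outS) (by rw [e]; exact hz)
    simp at this

theorem inS_next (T : PureTriple p q V₁ V V₂) {z : ℤ} (hz : V z .inS) : V (z + p) .outL :=
  (mirror_iff (by simp; ring) rfl).1
    (T.mirror.outS_prev (z := -z - p) ((mirror_iff (by simp) rfl).2 hz))

theorem inS_next_next (T : PureTriple p q V₁ V V₂) {z : ℤ} (hz : V z .inS) :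
    V (z + p + q) .inL ∧ V₁ z .outL := by
  have h1 := T.inS_next hz
  rcases T.outL_next h1 with h | h
  · have := T.gap_outL (z := z) (b := .inS) (c := .inS) (by simp) (by simp) hz h1 h
    simp at this
  · have := T.gap_outL (z := z) (b := .inS) (c := .inL) (by simp) (by simp) hz h1 h
    simp at this
    exact ⟨h, this⟩

theorem outS_prev_prev (T : PureTriple p q V₁ V V₂) {z : ℤ} (hz : V z .outS) :
    V (z - q - q) .outL := 
  (mirror_iff (by simp; ring) rfl).1
    (T.mirror.inS_next_next (z := -z - p) ((mirror_iff (by simp) rfl).2 hz)).1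

theorem inL_outL_prev (T : PureTriple p q V₁ V V₂) {z : ℤ} (hz : V z .inL)
    (ho : V (z + q) .outL) : V (z - p) .outS :=
  (mirror_iff (by simp) rfl).1
    (T.mirror.inL_outL (z := -z - q - q) ((mirror_iff (by simp; ring) rfl).2 ho)
      ((mirror_iff (by simp) rfl).2 hz)).1

theorem inL_next (T : PureTriple p q V₁ V V₂) {z : ℤ} (hz : V z .inL) :
    (V (z + q) .inS ∧ V₁ z .outS) ∨ V (z + q) .outS ∨ V (z + q) .outL := by
  obtain ⟨c, hc⟩ := T.h.succ hz
  rcases T.cases_block hc with h | rfl | rfl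
  · obtain ⟨-, rfl, h'⟩ := T.inL_next_in (by simp) h hz hc
    exact Or.inl ⟨hc, h'⟩
  · exact Or.inr (Or.inl hc)
  · exact Or.inr (Or.inr hc)

/-- The blocks after `inL`, `outS`. -/
theorem inL_outS (T : PureTriple p q V₁ V V₂) {z : ℤ} (hz : V z .inL) (ho : V (z + q) .outS) :
    (V (z + q + p) .inL ∧ V₁ z .outL) ∨ (V (z + q + p) .outL ∧
      ((V (z + q + p + q) .inS ∧ V₁ z .inL ∧ V₁ (z + (p + q)) .outS) ∨
      (V (z + q + p + q) .inL ∧ V₁ z .inS ∧ V₁ (z + q) .outL))) := by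
  obtain ⟨c, hc⟩ := T.h.succ ho
  rcases T.cases_block hc with h | h
  · obtain ⟨-, rfl, h'⟩ := T.gap_outS (by simp) h hz ho hc
    exact Or.inl ⟨hc, h'⟩
  · obtain ⟨-, rfl, -⟩ := T.out_out (by simp) h ho hc
    refine Or.inr ⟨hc, ?_⟩
    rcases T.outL_next hc with h | h
    · have := T.gap_outSL (by simp) (c := .inS) (by simp) hz ho hc h
      simp at this
      exact Or.inl ⟨h, this⟩
    · have := T.gap_outSL (by simp) (c := .inL) (by simp) hz ho hc h
      simp at this
      exact Or.inr ⟨h, this⟩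

/-- Reading on from a seam, where `inL` follows `outL`, the local rules leave exactly five
continuations up to the next seam, one for each kind of composed block. -/
theorem exists_compose (T : PureTriple p q V₁ V V₂) {x : ℤ} (ho : V (x - q) .outL)
    (hx : V x .inL) : ∃ b, compose p q V x b := by
  rcases T.inL_next hx with ⟨h, -⟩ | h | h
  · exact ⟨.outS, ⟨ho, hx⟩, h, T.inS_next h, (T.inS_next_next h).1⟩
  · rcases T.inL_outS hx h with ⟨h1, -⟩ | ⟨h1, ⟨h2, -⟩ | ⟨h2, -⟩⟩
    · rcases T.inL_next h1 with ⟨h2, -⟩ | h2 | h2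
      · exact ⟨.outL, ⟨ho, hx⟩, h, h1, h2, T.inS_next h2, (T.inS_next_next h2).1⟩
      -- The second `outS` would need an `outL` just before the `inL` that precedes it, and this
      -- `outL` would overlap the `inL` at `x`.
      · have hp := T.hp
        have hpq := T.hpq
        have := T.h.le_of_lt hx (T.outS_prev_prev h2) (by omega)
        simp at this; omega
      · have h3 := (T.inL_outL h1 h2).1
        exact ⟨.mix, ⟨ho, hx⟩, h, h1, h2, h3, T.inS_next h3, (T.inS_next_next h3).1⟩
    · exact ⟨.inL, ⟨ho, hx⟩, h, h1, h2, T.inS_next h2, (T.inS_next_next h2).1⟩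
    · exact ⟨.inS, ⟨ho, hx⟩, h, h1, h2⟩
  · have h1 := T.inL_outL_prev hx h
    have hp := T.hp
    have := T.h.le_of_lt ho h1 (by have := T.hpq; omega)
    simp at this; omega

theorem exists_compose_prev (T : PureTriple p q V₁ V V₂) {x : ℤ} (ho : V (x - q) .outL)
    (hx : V x .inL) : ∃ b, compose p q V (x - b.len (p + 2 * q) (2 * p + 3 * q)) b := by
  obtain ⟨b, hb⟩ := T.mirror.exists_compose (x := -x) ((mirror_iff (by simp) rfl).2 hx)
    ((mirror_iff (by simp) rfl).2 ho)
  refine ⟨b.flip, ?_⟩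
  rw [compose_mirror] at hb
  exact (mirror_iff (by simp) rfl).1 hb

theorem compose_start {x : ℤ} {b : Block} (h : compose p q V x b) :
    V (x - q) .outL ∧ V x .inL := by
  cases b <;> exact h.1

theorem compose_end {x : ℤ} {b : Block} (h : compose p q V x b) :
    V (x + b.len (p + 2 * q) (2 * p + 3 * q) - q) .outL ∧
      V (x + b.len (p + 2 * q) (2 * p + 3 * q)) .inL := by
  cases b <;> simp only [compose, Block.len] at h ⊢ <;> ring_nf at h ⊢ <;> tauto

theorem compose_isPath (T : PureTriple p q V₁ V V₂) :
    IsPath (p + 2 * q) (2 * p + 3 * q) (compose p q V) := by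
  have hp := T.hp; have hpq := T.hpq
  have e : ∀ {x b c}, V x b → V x c → b = c := fun h h' => T.h.eq hp hpq h h'
  refine ⟨?_, ?_, ?_, ?_⟩
  · have key : ∃ x, V (x - q) .outL ∧ V x .inL := by
      have hi : ∀ z, V z .inS → ∃ x, V (x - q) .outL ∧ V x .inL := fun z h =>
        ⟨_, by simpa using T.inS_next h, (T.inS_next_next h).1⟩
      have ho : ∀ z, V z .outS → ∃ x, V (x - q) .outL ∧ V x .inL := fun z h =>
        ⟨_, T.outS_prev_prev h, T.outS_prev h⟩
      have hI : ∀ z, V z .inL → ∃ x, V (x - q) .outL ∧ V x .inL := by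
        intro z h
        rcases T.inL_next h with ⟨h1, -⟩ | h1 | h1
        · exact hi _ h1
        · exact ho _ h1
        · exact hi _ (T.inL_outL h h1).1
      obtain ⟨x, b, hb⟩ := T.h.ne
      rcases T.cases_block hb with (rfl | rfl) | rfl | rfl
      · exact hi _ hb
      · exact hI _ hb
      · exact ho _ hb
      · rcases T.outL_next hb with h | h
        · exact hi _ h
        · exact hI _ h
    obtain ⟨x, h1, h2⟩ := key
    exact ⟨x, T.exists_compose h1 h2⟩
  · intro x b h
    exact T.exists_compose (compose_end h).1 (compose_end h).2
  · intro x b h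
    exact T.exists_compose_prev (compose_start h).1 (compose_start h).2
  · intro x b y c hb hc hxy
    rcases hxy.eq_or_lt with rfl | hlt
    · left
      refine ⟨rfl, ?_⟩
      clear hxy
      cases b <;> cases c <;> simp only [compose] at hb hc <;> grind
    · right
      obtain ⟨h1, h2⟩ := compose_start hc
      -- A composed block that starts at `y` cannot start inside an earlier one: `y` is a boundary
      -- of the middle path with `inL` after it and `outL` before it, and no boundary inside a
      -- composed block is of this kind. The facts `s` and `s'` express this for `omega`.
      have s : ∀ {z b}, V z b → (y ≤ z ∨ z + b.len p q ≤ y) ∧ (y = z → b = .inL) := by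
        intro z b hz
        refine ⟨(lt_or_ge z y).symm.imp id (fun h => T.h.le_of_lt hz h2 h), ?_⟩
        rintro rfl
        exact e hz h2
      have s' : y - q < x ∨ x + q ≤ y - q := by
        rcases lt_or_ge (y - q) x with h | h
        · exact Or.inl h
        · rcases T.h.sep (compose_start hb).2 h1 h with h | h
          · simp at h
          · exact Or.inr h
      have s'' := (s (compose_start hb).2).1
      cases b <;> simp only [compose] at hb
      · have a1 := s hb.2.1
        have a2 := s hb.2.2.1
        simp only [Block.len, reduceCtorEq, imp_false] at *
        omega
      · have a1 := s hb.2.1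
        have a2 := s hb.2.2.1
        have a3 := s hb.2.2.2.1
        have a4 := s hb.2.2.2.2.1
        simp only [Block.len, reduceCtorEq, imp_false] at *
        omega
      · have a1 := s hb.2.1
        have a2 := s hb.2.2.1
        simp only [Block.len, reduceCtorEq, imp_false] at *
        omega
      · have a1 := s hb.2.1
        have a2 := s hb.2.2.1
        have a3 := s hb.2.2.2.1
        have a4 := s hb.2.2.2.2.1
        simp only [Block.len, reduceCtorEq, imp_false] at *
        omega
      · have a1 := s hb.2.1
        have a2 := s hb.2.2.1
        have a3 := s hb.2.2.2.1
        have a4 := s hb.2.2.2.2.1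
        have a5 := s hb.2.2.2.2.2.1
        simp only [Block.len, reduceCtorEq, imp_false] at *
        omega

/-- The gap of input marks of the middle path around a given position. -/
theorem exists_gap (T : PureTriple p q V₁ V V₂) (x : ℤ) : ∃ z ≤ x,
    (V₁ z .outS ∧ x < z + q) ∨ (V₁ z .outL ∧ x < z + (p + q)) ∨
    (V z .inL ∧ V (z + q) .outL ∧ V₁ z .inS ∧ V₁ (z + q) .outS ∧ x < z + q + q) ∨
    (V z .inL ∧ V (z + q) .outS ∧ V (z + q + p) .outL ∧ V (z + q + p + q) .inS ∧
      V₁ z .inL ∧ V₁ (z + (p + q)) .outS ∧ x < z + (p + q) + q) ∨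
    (V z .inL ∧ V (z + q) .outS ∧ V (z + q + p) .outL ∧ V (z + q + p + q) .inL ∧
      V₁ z .inS ∧ V₁ (z + q) .outL ∧ x < z + q + (p + q)) := by
  have hp := T.hp; have hpq := T.hpq; have hq := T.hq
  have hS : ∀ z, V z .inS → z ≤ x → x < z + p + q → ∃ z ≤ x,
    (V₁ z .outS ∧ x < z + q) ∨ (V₁ z .outL ∧ x < z + (p + q)) ∨
    (V z .inL ∧ V (z + q) .outL ∧ V₁ z .inS ∧ V₁ (z + q) .outS ∧ x < z + q + q) ∨
    (V z .inL ∧ V (z + q) .outS ∧ V (z + q + p) .outL ∧ V (z + q + p + q) .inS ∧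
      V₁ z .inL ∧ V₁ (z + (p + q)) .outS ∧ x < z + (p + q) + q) ∨
    (V z .inL ∧ V (z + q) .outS ∧ V (z + q + p) .outL ∧ V (z + q + p + q) .inL ∧
      V₁ z .inS ∧ V₁ (z + q) .outL ∧ x < z + q + (p + q)) := by
    intro z hz h1 h2
    exact ⟨z, h1, Or.inr (Or.inl ⟨(T.inS_next_next hz).2, by omega⟩)⟩
  have hL : ∀ z, V z .inL → z ≤ x → (x < z + q ∨ (V (z + q) .outS ∧ x < z + q + p) ∨
      (V (z + q) .outL ∧ x < z + q + q) ∨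
      (V (z + q) .outS ∧ V (z + q + p) .outL ∧ x < z + q + p + q)) → ∃ z ≤ x,
    (V₁ z .outS ∧ x < z + q) ∨ (V₁ z .outL ∧ x < z + (p + q)) ∨
    (V z .inL ∧ V (z + q) .outL ∧ V₁ z .inS ∧ V₁ (z + q) .outS ∧ x < z + q + q) ∨
    (V z .inL ∧ V (z + q) .outS ∧ V (z + q + p) .outL ∧ V (z + q + p + q) .inS ∧
      V₁ z .inL ∧ V₁ (z + (p + q)) .outS ∧ x < z + (p + q) + q) ∨
    (V z .inL ∧ V (z + q) .outS ∧ V (z + q + p) .outL ∧ V (z + q + p + q) .inL ∧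
      V₁ z .inS ∧ V₁ (z + q) .outL ∧ x < z + q + (p + q)) := by
    intro z hz h1 h2
    have e : ∀ {x b c}, V x b → V x c → b = c := fun h h' => T.h.eq hp hpq h h'
    refine ⟨z, h1, ?_⟩
    rcases T.inL_next hz with h | h | h
    · have h3 : x < z + q := by
        rcases h2 with h2 | ⟨h2, -⟩ | ⟨h2, -⟩ | ⟨h2, -⟩
        · exact h2
        all_goals have := e h2 h.1; simp at this
      exact Or.inl ⟨h.2, h3⟩
    · have h3 : x < z + q + p ∨ (V (z + q + p) .outL ∧ x < z + q + p + q) := by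
        rcases h2 with h2 | ⟨-, h2⟩ | ⟨h2, -⟩ | ⟨-, h2⟩
        · left; omega
        · left; omega
        · have := e h2 h; simp at this
        · exact Or.inr h2
      rcases T.inL_outS hz h with ⟨h4, h5⟩ | ⟨h4, h5⟩
      · have : x < z + q + p := h3.resolve_right (fun h => by have := e h.1 h4; simp at this)
        exact Or.inr (Or.inl ⟨h5, by omega⟩)
      · rcases h5 with ⟨h5, h6, h7⟩ | ⟨h5, h6, h7⟩
        · exact Or.inr (Or.inr (Or.inr (Or.inl ⟨hz, h, h4, h5, h6, h7, by omega⟩)))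
        · exact Or.inr (Or.inr (Or.inr (Or.inr ⟨hz, h, h4, h5, h6, h7, by omega⟩)))
    · have h3 : x < z + q + q := by
        rcases h2 with h2 | ⟨h2, -⟩ | ⟨h2, h2'⟩ | ⟨h2, -⟩
        · omega
        · have := e h2 h; simp at this
        · exact h2'
        · have := e h2 h; simp at this
      obtain ⟨-, h4, h5⟩ := T.inL_outL hz h
      exact Or.inr (Or.inr (Or.inl ⟨hz, h, h4, h5, h3⟩))
  obtain ⟨z, b, hb, h1, h2⟩ := T.h.cover hp hpq x
  rcases T.cases_block hb with (rfl | rfl) | rfl | rfl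
  · exact hS _ hb h1 (by simp at h2; omega)
  · exact hL _ hb h1 (Or.inl h2)
  · exact hL _ (T.outS_prev hb) (by omega) (Or.inr (Or.inl ⟨by simpa using hb, by simpa using h2⟩))
  · obtain ⟨c, hc⟩ := T.h.pred hb
    simp at h2
    rcases T.cases_block hc with (rfl | rfl) | hc'
    · simp at hc
      exact hS _ hc (by omega) (by omega)
    · simp at hc
      exact hL _ hc (by omega) (Or.inr (Or.inr (Or.inl ⟨by simpa using hb, by omega⟩)))
    · obtain ⟨rfl, -, -⟩ := T.out_out hc' (by simp) hc (c := .outL) (by simpa using hb)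
      simp at hc
      exact hL _ (T.outS_prev hc) (by omega) (Or.inr (Or.inr (Or.inr
        ⟨by simpa using hc, by simpa using hb, by omega⟩)))

/-- The gaps of `V` reveal the blocks of `V₁`. The gap `inL`, `outL` shows an `inS` of `V₁` and sits
inside a composed `mix`. The gap `inL`, `outS`, `outL` shows an `inS` or an `inL` of `V₁`, according
to whether `inL` or `inS` closes it, and opens a composed block with this mark. All other gaps are
single blocks of `V₁` with an output mark. -/
theorem compose_inMark (T : PureTriple p q V₁ V V₂) (x : ℤ) (t : Bool) :
    InMark (p + 2 * q) (2 * p + 3 * q) (compose p q V) x t ↔ InMark q (p + q) V₁ x t := by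
  have hp := T.hp; have hpq := T.hpq; have hq := T.hq
  have e : ∀ {z b c}, V₁ x c → V₁ z b → z ≤ x → x < z + b.len q (p + q) → z = x ∧ b = c := by
    intro z b c hc hb h1 h2
    rcases T.h₁.sep hb hc h1 with h | h
    · exact h
    · omega
  cases t
  · simp only [InMark]
    constructor
    · rintro (h | h)
      · obtain ⟨⟨-, h1⟩, h2, h3, h4⟩ := h
        rcases T.inL_outS h1 h2 with ⟨h5, -⟩ | ⟨-, ⟨h5, -⟩ | ⟨h5, h6, -⟩⟩
        · have := T.h.eq hp hpq h3 h5; simp at this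
        · have := T.h.eq hp hpq h4 h5; simp at this
        · exact Or.inl h6
      · obtain ⟨-, h1, h2, h3, h4, -⟩ := h
        have e : x - (2 * p + 3 * q - (p + 2 * q)) + q + p = x := by ring
        rw [e] at h2 h3
        exact Or.inl (T.inL_outL h2 h3).2.1
    · rintro (h | h)
      swap
      · exact absurd h (T.n₁ _)
      obtain ⟨z, hz, h1 | h1 | ⟨h1, h2, h3, h4, h5⟩ | ⟨h1, h2, h3, h4, h5, h6, h7⟩ |
        ⟨h1, h2, h3, h4, h5, h6, h7⟩⟩ := T.exists_gap x
      · have := (e h h1.1 hz h1.2).2; simp at this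
      · have := (e h h1.1 hz h1.2).2; simp at this
      · rcases lt_or_ge x (z + q) with h6 | h6
        · obtain ⟨rfl, -⟩ := e h h3 hz h6
          right
          have a1 := T.inL_outL_prev h1 h2
          have a2 := (T.inL_outL h1 h2).1
          refine ⟨⟨?_, ?_⟩, ?_, ?_, ?_, ?_, ?_, ?_⟩
          · have := T.outS_prev_prev a1; ring_nf at this ⊢; exact this
          · have := T.outS_prev a1; ring_nf at this ⊢; exact this
          · ring_nf at a1 ⊢; exact a1
          · convert h1 using 1; ring
          · ring_nf at h2 ⊢; exact h2
          · ring_nf at a2 ⊢; exact a2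
          · have := T.inS_next a2; ring_nf at this ⊢; exact this
          · have := (T.inS_next_next a2).1; ring_nf at this ⊢; exact this
        · have := (e h h4 h6 h5).2; simp at this
      · rcases lt_or_ge x (z + (p + q)) with h8 | h8
        · have := (e h h5 hz h8).2; simp at this
        · have := (e h h6 h8 h7).2; simp at this
      · rcases lt_or_ge x (z + q) with h8 | h8
        · obtain ⟨rfl, -⟩ := e h h5 hz h8
          left
          exact ⟨⟨by simpa using T.outS_prev_prev h2, h1⟩, h2, h3, h4⟩
        · have := (e h h6 h8 h7).2; simp at this
  · simp only [InMark]
    constructor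
    · rintro ⟨⟨-, h1⟩, h2, h3, h4, -⟩
      rcases T.inL_outS h1 h2 with ⟨h5, -⟩ | ⟨-, ⟨-, h6, -⟩ | ⟨h5, h6, -⟩⟩
      · have := T.h.eq hp hpq h3 h5; simp at this
      · exact h6
      · have := T.h.eq hp hpq h4 h5; simp at this
    · intro h
      obtain ⟨z, hz, h1 | h1 | ⟨h1, h2, h3, h4, h5⟩ | ⟨h1, h2, h3, h4, h5, h6, h7⟩ |
        ⟨h1, h2, h3, h4, h5, h6, h7⟩⟩ := T.exists_gap x
      · have := (e h h1.1 hz h1.2).2; simp at this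
      · have := (e h h1.1 hz h1.2).2; simp at this
      · rcases lt_or_ge x (z + q) with h6 | h6
        · have := (e h h3 hz h6).2; simp at this
        · have := (e h h4 h6 h5).2; simp at this
      · rcases lt_or_ge x (z + (p + q)) with h8 | h8
        · obtain ⟨rfl, -⟩ := e h h5 hz h8
          exact ⟨⟨by simpa using T.outS_prev_prev h2, h1⟩, h2, h3, h4, T.inS_next h4,
            (T.inS_next_next h4).1⟩
        · have := (e h h6 h8 h7).2; simp at this
      · rcases lt_or_ge x (z + q) with h8 | h8
        · have := (e h h5 hz h8).2; simp at this
        · have := (e h h6 h8 h7).2; simp at this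

theorem compose_outMark (T : PureTriple p q V₁ V V₂) (x : ℤ) (t : Bool) :
    OutMark (p + 2 * q) (2 * p + 3 * q) (compose p q V) x t ↔ OutMark q (p + q) V₂ x t := by
  have := T.mirror.compose_inMark (-x) t
  rwa [compose_mirror, inMark_mirror, inMark_mirror, neg_neg] at this

end PureTriple

/-! ### Two triples that share an outer path are impossible -/

namespace PureTriple

variable {p q : ℤ} {V₁ V V₂ V' V₃ : ℤ → Block → Prop}

/-- An `inL` of `V₁` opens the gap `inL`, `outS`, `outL` of `V` that is closed by `inS`. This gives
the `outS`, and over the closing `inS` the path `V₁` has an `outL`. -/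
theorem first_inL_next (T : PureTriple p q V₁ V V₂) {x : ℤ} (h : V₁ x .inL) :
    V₁ (x + (p + q)) .outS ∧ V₁ (x + (p + q) + q) .outL := by
  obtain ⟨⟨-, h1⟩, h2, h3, h4, -⟩ := (T.compose_inMark x true).2 h
  rcases T.inL_outS h1 h2 with ⟨h5, -⟩ | ⟨-, ⟨h5, h6, h7⟩ | ⟨h5, -⟩⟩
  · have := T.h.eq T.hp T.hpq h3 h5; simp at this
  · refine ⟨h7, ?_⟩
    rw [show x + (p + q) + q = x + q + p + q by ring]
    exact (T.inS_next_next h5).2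
  · have := T.h.eq T.hp T.hpq h4 h5; simp at this

/-- Two triples cannot be stacked. -/
theorem not_stacked (T : PureTriple p q V₁ V V₂) (T' : PureTriple p q V₂ V' V₃) : False := by
  have hp := T.hp; have hpq := T.hpq
  obtain ⟨x, b, hx⟩ := T'.compose_isPath.ne
  have h : V₂ (x - (p + q)) .outL := (T'.m₁ x true).2 (compose_start hx).2
  -- As last path of the first triple, `V₂` has `inL`, `inS` before each `outL`. As first path of
  -- the second triple, it has `outS` after each `inL`. An `outL` exists because `V'` has seams.
  obtain ⟨h1, h2⟩ := T.mirror.first_inL_next (x := -x) ((mirror_iff (by simp) rfl).2 h)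
  have h1 : V₂ (x - (p + q) - q) .inS := (mirror_iff (by simp; ring) rfl).1 h1
  have h2 : V₂ (x - (p + q) - q - (p + q)) .inL := (mirror_iff (by simp; ring) rfl).1 h2
  have h3 := (T'.first_inL_next h2).1
  rw [show x - (p + q) - q - (p + q) + (p + q) = x - (p + q) - q by ring] at h3
  have := T'.h₁.eq (by omega) (by omega) h1 h3
  simp at this

end PureTriple

/-! ### Substitutions that undo the composition -/

/-- The blocks of a list, with their positions, when the list is laid down from `o` on. -/
def layDown (p q : ℤ) : ℤ → List Block → List (ℤ × Block)
  | _, [] => []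
  | o, b :: l => (o, b) :: layDown p q (o + b.len p q) l

/-- The length of a list of blocks. -/
def totalLen (p q : ℤ) (l : List Block) : ℤ := (l.map (Block.len p q)).sum

section layDown

variable {p q : ℤ}

@[simp] theorem totalLen_nil : totalLen p q [] = 0 := rfl

@[simp] theorem totalLen_cons (b : Block) (l : List Block) :
    totalLen p q (b :: l) = b.len p q + totalLen p q l := by simp [totalLen]

theorem totalLen_nonneg (hp : 0 < p) (hpq : p < q) (l : List Block) : 0 ≤ totalLen p q l := by
  induction l with
  | nil => simp
  | cons b l ih => have := b.len_ge hp hpq; simp; omega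

theorem layDown_le (hp : 0 < p) (hpq : p < q) {l : List Block} {o x : ℤ} {b : Block}
    (h : (x, b) ∈ layDown p q o l) : o ≤ x ∧ x + b.len p q ≤ o + totalLen p q l := by
  induction l generalizing o with
  | nil => simp [layDown] at h
  | cons c l ih =>
    have h1 := totalLen_nonneg hp hpq l
    have h2 := c.len_ge hp hpq
    simp only [layDown, List.mem_cons, Prod.mk.injEq] at h
    rcases h with ⟨rfl, rfl⟩ | h
    · simp; omega
    · have := ih h
      simp; omega

theorem layDown_succ {l : List Block} {o x : ℤ} {b : Block} (h : (x, b) ∈ layDown p q o l) :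
    (∃ c, (x + b.len p q, c) ∈ layDown p q o l) ∨ x + b.len p q = o + totalLen p q l := by
  induction l generalizing o with
  | nil => simp [layDown] at h
  | cons c l ih =>
    simp only [layDown, List.mem_cons, Prod.mk.injEq] at h
    rcases h with ⟨rfl, rfl⟩ | h
    · cases l with
      | nil => right; simp
      | cons d l => left; exact ⟨d, by simp [layDown]⟩
    · rcases ih h with ⟨d, hd⟩ | hd
      · left; exact ⟨d, by simp [layDown, hd]⟩
      · right; simp; omega

theorem layDown_pred {l : List Block} {o x : ℤ} {b : Block} (h : (x, b) ∈ layDown p q o l) :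
    (∃ c, (x - c.len p q, c) ∈ layDown p q o l) ∨ x = o := by
  induction l generalizing o with
  | nil => simp [layDown] at h
  | cons c l ih =>
    simp only [layDown, List.mem_cons, Prod.mk.injEq] at h
    rcases h with ⟨rfl, rfl⟩ | h
    · right; rfl
    · rcases ih h with ⟨d, hd⟩ | hd
      · left; exact ⟨d, by simp [layDown, hd]⟩
      · left; exact ⟨c, by simp [layDown]; left; omega⟩

theorem layDown_sep (hp : 0 < p) (hpq : p < q) {l : List Block} {o x y : ℤ} {b c : Block}
    (hb : (x, b) ∈ layDown p q o l) (hc : (y, c) ∈ layDown p q o l) (hxy : x ≤ y) :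
    (x = y ∧ b = c) ∨ x + b.len p q ≤ y := by
  induction l generalizing o with
  | nil => simp [layDown] at hb
  | cons d l ih =>
    simp only [layDown, List.mem_cons, Prod.mk.injEq] at hb hc
    have := d.len_ge hp hpq
    rcases hb with ⟨rfl, rfl⟩ | hb
    · rcases hc with ⟨rfl, rfl⟩ | hc
      · left; exact ⟨rfl, rfl⟩
      · right; exact (layDown_le hp hpq hc).1
    · rcases hc with ⟨rfl, rfl⟩ | hc
      · have := (layDown_le hp hpq hb).1
        omega
      · exact ih hb hc

theorem layDown_last {l : List Block} (hl : l ≠ []) (o : ℤ) :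
    ∃ c, (o + totalLen p q l - c.len p q, c) ∈ layDown p q o l := by
  induction l generalizing o with
  | nil => simp at hl
  | cons b l ih =>
    cases l with
    | nil => exact ⟨b, by simp [layDown]⟩
    | cons d l =>
      obtain ⟨c, hc⟩ := ih (by simp) (o + b.len p q)
      refine ⟨c, ?_⟩
      rw [layDown]
      apply List.mem_cons_of_mem
      convert hc using 2
      simp; ring

/-- The image of a block path under a substitution. -/
def substitute (p q : ℤ) (s : Block → List Block) (W : ℤ → Block → Prop) (x : ℤ) (b : Block) :
    Prop := ∃ y c, W y c ∧ (x, b) ∈ layDown p q y (s c)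

theorem IsPath.substitute {P Q : ℤ} {W : ℤ → Block → Prop} (hW : IsPath P Q W) (hn : NoMix W)
    (hp : 0 < p) (hpq : p < q) {s : Block → List Block} 
    (hs : ∀ c, c ≠ .mix → totalLen p q (s c) = c.len P Q) (hs' : ∀ c, c ≠ .mix → s c ≠ []) :
    IsPath p q (substitute p q s W) := by
  have nm : ∀ {x c}, W x c → c ≠ .mix := by rintro x c h rfl; exact hn _ h
  have first : ∀ {y c}, W y c → ∃ d, (y, d) ∈ layDown p q y (s c) := by
    intro y c h
    obtain ⟨d, l, hl⟩ := List.exists_cons_of_ne_nil (hs' c (nm h))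
    exact ⟨d, by simp [hl, layDown]⟩
  refine ⟨?_, ?_, ?_, ?_⟩
  · obtain ⟨y, c, h⟩ := hW.ne
    obtain ⟨d, hd⟩ := first h
    exact ⟨y, d, y, c, h, hd⟩
  · rintro x b ⟨y, c, h, hb⟩
    rcases layDown_succ hb with ⟨d, hd⟩ | hd
    · exact ⟨d, y, c, h, hd⟩
    · obtain ⟨c', hc'⟩ := hW.succ h
      obtain ⟨d, hd'⟩ := first hc'
      rw [hd, hs c (nm h)]
      exact ⟨d, _, c', hc', hd'⟩
  · rintro x b ⟨y, c, h, hb⟩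
    rcases layDown_pred hb with ⟨d, hd⟩ | rfl
    · exact ⟨d, y, c, h, hd⟩
    · obtain ⟨c', hc'⟩ := hW.pred h
      obtain ⟨d, hd'⟩ := layDown_last (p := p) (q := q) (hs' c' (nm hc')) (x - c'.len P Q)
      refine ⟨d, _, c', hc', ?_⟩
      rw [hs c' (nm hc')] at hd'
      simpa using hd'
  · rintro x b x' b' ⟨y, c, h, hb⟩ ⟨y', c', h', hb'⟩ hxx
    have l1 := layDown_le hp hpq hb
    have l2 := layDown_le hp hpq hb'
    rw [hs c (nm h)] at l1
    rw [hs c' (nm h')] at l2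
    have := b.len_ge hp hpq
    have := b'.len_ge hp hpq
    rcases le_total y y' with hy | hy
    · rcases hW.sep h h' hy with ⟨rfl, rfl⟩ | hle
      · exact layDown_sep hp hpq hb hb' hxx
      · right; omega
    · rcases hW.sep h' h hy with ⟨rfl, rfl⟩ | hle
      · exact layDown_sep hp hpq hb hb' hxx
      · omega

theorem noMix_substitute {W : ℤ → Block → Prop} {s : Block → List Block} 
    (hs : ∀ c, .mix ∉ s c) : NoMix (substitute p q s W) := by
  rintro x ⟨y, c, h, hb⟩
  have key : ∀ (l : List Block) o, (x, Block.mix) ∈ layDown p q o l → .mix ∈ l := by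
    intro l
    induction l with
    | nil => simp [layDown]
    | cons b l ih =>
      intro o h
      simp only [layDown, List.mem_cons, Prod.mk.injEq] at h ⊢
      exact h.imp And.right (ih _)
  exact hs _ (key _ _ hb)

end layDown

/-- The substitution giving the first path of a triple from its composition. -/
def substFirst : Block → List Block
  | .outS => [.outS, .outL]
  | .inS => [.inS, .outL]
  | .inL => [.inL, .outS, .outL]
  | .outL => [.outL, .outS, .outL]
  | .mix => []

/-- The substitution giving the middle path of a triple from its composition. -/
def substMiddle : Block → List Block
  | .outS => [.inL, .inS, .outL]
  | .inS => [.inL, .outS, .outL]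
  | .inL => [.inL, .outS, .outL, .inS, .outL]
  | .outL => [.inL, .outS, .inL, .inS, .outL]
  | .mix => []

/-- The substitution giving the last path of a triple from its composition. -/
def substLast : Block → List Block
  | .outS => [.inL, .outS]
  | .inS => [.inL, .inS]
  | .inL => [.inL, .inS, .inL]
  | .outL => [.inL, .inS, .outL]
  | .mix => []

section converse

variable {p q : ℤ} {W : ℤ → Block → Prop}

theorem substFirst_isPath (hW : IsPath (p + 2 * q) (2 * p + 3 * q) W) (hn : NoMix W) (hp : 0 < p)
    (hpq : p < q) : IsPath q (p + q) (substitute q (p + q) substFirst W) := by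
  refine hW.substitute hn (by omega) (by omega) ?_ ?_ <;> intro c hc <;> cases c <;>
    simp [substFirst] at hc ⊢ <;> ring

theorem substMiddle_isPath (hW : IsPath (p + 2 * q) (2 * p + 3 * q) W) (hn : NoMix W) (hp : 0 < p)
    (hpq : p < q) : IsPath p q (substitute p q substMiddle W) := by
  refine hW.substitute hn (by omega) (by omega) ?_ ?_ <;> intro c hc <;> cases c <;>
    simp [substMiddle] at hc ⊢ <;> ring

theorem substLast_isPath (hW : IsPath (p + 2 * q) (2 * p + 3 * q) W) (hn : NoMix W) (hp : 0 < p)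
    (hpq : p < q) : IsPath q (p + q) (substitute q (p + q) substLast W) := by
  refine hW.substitute hn (by omega) (by omega) ?_ ?_ <;> intro c hc <;> cases c <;>
    simp [substLast] at hc ⊢ <;> ring

theorem noMix_substFirst : NoMix (substitute q (p + q) substFirst W) :=
  noMix_substitute (by rintro ⟨⟩ <;> simp [substFirst])

theorem noMix_substMiddle : NoMix (substitute p q substMiddle W) :=
  noMix_substitute (by rintro ⟨⟩ <;> simp [substMiddle])

theorem noMix_substLast : NoMix (substitute q (p + q) substLast W) :=
  noMix_substitute (by rintro ⟨⟩ <;> simp [substLast])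

theorem mem_substitute {s : Block → List Block} {x y : ℤ} {b c : Block} (h : W y c)
    (hb : (x, b) ∈ layDown p q y (s c)) : substitute p q s W x b := ⟨y, c, h, hb⟩

theorem substFirst_inMark (hn : NoMix W) (x : ℤ) (t : Bool) :
    InMark q (p + q) (substitute q (p + q) substFirst W) x t ↔
      InMark (p + 2 * q) (2 * p + 3 * q) W x t := by
  cases t
  · simp only [InMark, iff_false_intro (noMix_substFirst _), iff_false_intro (hn _), or_false]
    constructor
    · rintro ⟨y, c, hc, h⟩
      cases c <;> simp [substFirst, layDown] at h
      subst h; exact hc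
    · exact fun h => mem_substitute h (by simp [substFirst, layDown])
  · simp only [InMark]
    constructor
    · rintro ⟨y, c, hc, h⟩
      cases c <;> simp [substFirst, layDown] at h
      subst h; exact hc
    · exact fun h => mem_substitute h (by simp [substFirst, layDown])

theorem substLast_outMark (hn : NoMix W) (x : ℤ) (t : Bool) :
    OutMark q (p + q) (substitute q (p + q) substLast W) x t ↔
      OutMark (p + 2 * q) (2 * p + 3 * q) W x t := by
  cases t
  · simp only [OutMark, iff_false_intro (noMix_substLast _), iff_false_intro (hn _), or_false]
    constructor
    · rintro ⟨y, c, hc, h⟩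
      cases c <;> simp [substLast, layDown] at h
      convert hc using 1; omega
    · exact fun h => mem_substitute h (by simp [substLast, layDown]; ring)
  · simp only [OutMark]
    constructor
    · rintro ⟨y, c, hc, h⟩
      cases c <;> simp [substLast, layDown] at h
      convert hc using 1; omega
    · exact fun h => mem_substitute h (by simp [substLast, layDown]; ring)

theorem substFirst_outMark (hW : IsPath (p + 2 * q) (2 * p + 3 * q) W) (hn : NoMix W)
    (x : ℤ) (t : Bool) : OutMark q (p + q) (substitute q (p + q) substFirst W) x t ↔
      InMark p q (substitute p q substMiddle W) x t := by
  cases t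
  · simp only [InMark, OutMark, iff_false_intro (noMix_substFirst _),
      iff_false_intro (noMix_substMiddle _), or_false]
    constructor
    · rintro ⟨y, c, hc, h⟩
      refine mem_substitute hc ?_
      cases c <;> simp [substFirst, substMiddle, layDown] at h ⊢ <;> omega
    · rintro ⟨y, c, hc, h⟩
      refine mem_substitute hc ?_
      cases c <;> simp [substFirst, substMiddle, layDown] at h ⊢ <;> omega
  · simp only [InMark, OutMark]
    constructor
    · rintro ⟨y, c, hc, h⟩
      -- A long output mark at the very end of an image is read at a seam, by the initial `inL` of
      -- the image of the next block.
      by_cases hy : x = y + c.len (p + 2 * q) (2 * p + 3 * q)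
      · obtain ⟨d, hd⟩ := hW.succ hc
        rw [← hy] at hd
        refine mem_substitute hd ?_
        cases d <;> simp [substMiddle, layDown]
        exact hn _ hd
      · refine mem_substitute hc ?_
        cases c <;> simp [substFirst, substMiddle, layDown] at h hy ⊢ <;> omega
    · rintro ⟨y, c, hc, h⟩
      by_cases hy : x = y
      · subst hy
        obtain ⟨d, hd⟩ := hW.pred hc
        refine mem_substitute hd ?_
        cases d <;> simp [substFirst, layDown] <;> try omega
        exact hn _ hd
      · refine mem_substitute hc ?_
        cases c <;> simp [substFirst, substMiddle, layDown, hy] at h hy ⊢ <;> omega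

theorem substMiddle_outMark (hW : IsPath (p + 2 * q) (2 * p + 3 * q) W) (hn : NoMix W)
    (x : ℤ) (t : Bool) : OutMark p q (substitute p q substMiddle W) x t ↔
      InMark q (p + q) (substitute q (p + q) substLast W) x t := by
  cases t
  · simp only [InMark, OutMark, iff_false_intro (noMix_substLast _),
      iff_false_intro (noMix_substMiddle _), or_false]
    constructor
    · rintro ⟨y, c, hc, h⟩
      refine mem_substitute hc ?_
      cases c <;> simp [substLast, substMiddle, layDown] at h ⊢ <;> omega
    · rintro ⟨y, c, hc, h⟩
      refine mem_substitute hc ?_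
      cases c <;> simp [substLast, substMiddle, layDown] at h ⊢ <;> omega
  · simp only [InMark, OutMark]
    constructor
    · rintro ⟨y, c, hc, h⟩
      by_cases hy : x = y + c.len (p + 2 * q) (2 * p + 3 * q)
      · obtain ⟨d, hd⟩ := hW.succ hc
        rw [← hy] at hd
        refine mem_substitute hd ?_
        cases d <;> simp [substLast, layDown]
        exact hn _ hd
      · refine mem_substitute hc ?_
        cases c <;> simp [substLast, substMiddle, layDown] at h hy ⊢ <;> omega
    · rintro ⟨y, c, hc, h⟩
      by_cases hy : x = y
      · subst hy
        obtain ⟨d, hd⟩ := hW.pred hc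
        refine mem_substitute hd ?_
        cases d <;> simp [substMiddle, layDown] <;> try omega
        exact hn _ hd
      · refine mem_substitute hc ?_
        cases c <;> simp [substLast, substMiddle, layDown, hy] at h hy ⊢ <;> omega

end converse

/-! ### Marks and rows of digits -/

section marks

variable {p q : ℤ} {V : ℤ → Block → Prop}

theorem InMark.exists_block {x : ℤ} {t : Bool} (h : InMark p q V x t) :
    ∃ z b, V z b ∧ ((b = .inS ∧ x = z ∧ t = false) ∨ (b = .inL ∧ x = z ∧ t = true) ∨
      (b = .mix ∧ x = z + (q - p) ∧ t = false)) := by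
  cases t
  · rcases h with h | h
    · exact ⟨_, _, h, Or.inl ⟨rfl, rfl, rfl⟩⟩
    · exact ⟨_, _, h, Or.inr (Or.inr ⟨rfl, by ring, rfl⟩)⟩
  · exact ⟨_, _, h, Or.inr (Or.inl ⟨rfl, rfl, rfl⟩)⟩

/-- Marks are at distance at least `g`, and a position carries at most one mark. -/
def Separated (g : ℤ) (M : ℤ → Bool → Prop) : Prop :=
  ∀ y t z u, M y t → M z u → y ≤ z → (y = z ∧ t = u) ∨ y + g ≤ z

theorem Separated.mono {g g' : ℤ} {M : ℤ → Bool → Prop} (h : Separated g M) (hg : g' ≤ g) :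
    Separated g' M := fun y t z u h1 h2 h3 => (h y t z u h1 h2 h3).imp_right (by omega)

theorem IsPath.separated_inMark (hV : IsPath p q V) (hp : 0 < p) (hpq : p < q) (hq : q < 2 * p) :
    Separated p (InMark p q V) := by
  intro y t z u h1 h2 hyz
  obtain ⟨s, b, hs, h1⟩ := h1.exists_block
  obtain ⟨s', b', hs', h2⟩ := h2.exists_block
  rcases lt_trichotomy s s' with h | rfl | h
  · have := hV.le_of_lt hs hs' h
    right
    rcases h1 with ⟨rfl, h1, -⟩ | ⟨rfl, h1, -⟩ | ⟨rfl, h1, -⟩ <;> simp at this <;> omega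
  · obtain rfl := hV.eq hp hpq hs hs'
    left
    rcases h1 with ⟨rfl, h1, h3⟩ | ⟨rfl, h1, h3⟩ | ⟨rfl, h1, h3⟩ <;> simp at h2 <;>
      exact ⟨by omega, by rw [h3, h2.2]⟩
  · have := hV.le_of_lt hs' hs h
    rcases h1 with ⟨rfl, h1, -⟩ | ⟨rfl, h1, -⟩ | ⟨rfl, h1, -⟩ <;>
    rcases h2 with ⟨rfl, h2, -⟩ | ⟨rfl, h2, -⟩ | ⟨rfl, h2, -⟩ <;> simp at this <;> omega

theorem IsPath.separated_outMark (hV : IsPath p q V) (hp : 0 < p) (hpq : p < q) (hq : q < 2 * p) :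
    Separated p (OutMark p q V) := by
  intro y t z u h1 h2 hyz
  have := (hV.mirror hp hpq).separated_inMark hp hpq hq (-z) u (-y) t
    (by rw [inMark_mirror, neg_neg]; exact h2) (by rw [inMark_mirror, neg_neg]; exact h1) (by omega)
  rcases this with ⟨h, rfl⟩ | h
  · left; exact ⟨by omega, rfl⟩
  · right; omega

end marks

/-- The cells covered by a mark at `y`: the cells `y`, `y + 1` for a short mark, and one more cell
for a long mark, on the right for marks of digits `1` and on the left for marks of digits `0`. -/
def Covers (c : Bool) (y : ℤ) (t : Bool) (x : ℤ) : Prop :=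
  y - (if c = false ∧ t = true then 1 else 0) ≤ x ∧
    x ≤ y + 1 + (if c = true ∧ t = true then 1 else 0)

/-- The digits of the row `d` equal to `c` are those covered by the marks `M`. -/
def IsRow (c : Bool) (M : ℤ → Bool → Prop) (d : ℤ → Bool) : Prop :=
  ∀ x, d x = c ↔ ∃ y t, M y t ∧ Covers c y t x

theorem IsRow.shift {c : Bool} {M : ℤ → Bool → Prop} {d : ℤ → Bool} (h : IsRow c M d) (a : ℤ) :
    IsRow c (fun x => M (x + a)) (fun x => d (x + a)) := by
  intro x
  rw [h (x + a)]
  constructor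
  · rintro ⟨y, t, h1, h2⟩
    refine ⟨y - a, t, by simpa using h1, ?_⟩
    simp only [Covers] at h2 ⊢; omega
  · rintro ⟨y, t, h1, h2⟩
    refine ⟨y + a, t, h1, ?_⟩
    simp only [Covers] at h2 ⊢; omega

theorem IsRow.congr {c : Bool} {M M' : ℤ → Bool → Prop} {d : ℤ → Bool}
    (h : IsRow c M d) (hM : ∀ x t, M x t ↔ M' x t) : IsRow c M' d := by
  intro x; rw [h x]; simp only [hM]

/-- Marks at distance at least 5 cover isolated runs of two or three digits, with other digits
around, so the row shows each run entirely. Marks at distance at least 3 cannot split a run of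
length three into two, nor cover one of length two otherwise. -/
theorem IsRow.unique {c : Bool} {M M' : ℤ → Bool → Prop} {d : ℤ → Bool} (h : IsRow c M d)
    (h' : IsRow c M' d) (hM : Separated 5 M) (hM' : Separated 3 M') (x : ℤ) (t : Bool) :
    M x t ↔ M' x t := by
  have fwd : ∀ x t, M x t → M' x t := by
    intro x t hx
    have unc : ∀ y, x - 2 ≤ y → y ≤ x + 3 → (d y = c ↔ Covers c x t y) := by
      intro y h1 h2
      rw [h y]
      constructor
      · rintro ⟨z, u, hz, hc⟩
        rcases le_total x z with h3 | h3
        · rcases hM _ _ _ _ hx hz h3 with ⟨rfl, rfl⟩ | h4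
          · exact hc
          · simp only [Covers] at hc; split_ifs at hc <;> omega
        · rcases hM _ _ _ _ hz hx h3 with ⟨rfl, rfl⟩ | h4
          · exact hc
          · simp only [Covers] at hc; split_ifs at hc <;> omega
      · exact fun hc => ⟨x, t, hx, hc⟩
    have cov : ∀ z u y, M' z u → Covers c z u y → x - 2 ≤ y → y ≤ x + 3 → Covers c x t y :=
      fun z u y h1 h2 h3 h4 => (unc y h3 h4).1 ((h' y).2 ⟨z, u, h1, h2⟩)
    have sep : ∀ z u z' u', M' z u → M' z' u' →
        (z = z' ∧ u = u') ∨ z + 3 ≤ z' ∨ z' + 3 ≤ z := by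
      intro z u z' u' h1 h2
      rcases le_total z z' with h3 | h3
      · exact (hM' _ _ _ _ h1 h2 h3).imp_right Or.inl
      · rcases hM' _ _ _ _ h2 h1 h3 with ⟨rfl, rfl⟩ | h4
        · exact Or.inl ⟨rfl, rfl⟩
        · exact Or.inr (Or.inr h4)
    have ex : ∀ y, Covers c x t y → ∃ z u, M' z u ∧ Covers c z u y := fun y hy =>
      (h' y).1 ((unc y (by simp only [Covers] at hy; split_ifs at hy <;> omega)
        (by simp only [Covers] at hy; split_ifs at hy <;> omega)).2 hy)
    cases c
    · obtain ⟨z, u, hz, hzc⟩ := ex (x + 1) (by simp [Covers]; split_ifs <;> omega)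
      have c1 := cov z u (z + 1) hz (by simp [Covers]; split_ifs <;> omega)
      obtain rfl : z = x := by
        simp [Covers] at hzc c1; split_ifs at hzc c1 <;> omega
      have c2 := cov z u (z - 1) hz
      cases t <;> cases u
      · exact hz
      · simp [Covers] at c2; omega
      · obtain ⟨z', u', h1, h2⟩ := ex (z - 1) (by simp [Covers] <;> omega)
        rcases sep _ _ _ _ hz h1 with ⟨rfl, rfl⟩ | h3
        · simp [Covers] at h2
        · cases u' <;> simp [Covers] at h2 <;> omega
      · exact hz
    · obtain ⟨z, u, hz, hzc⟩ := ex x (by simp [Covers]; split_ifs <;> omega)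
      have c1 := cov z u z hz (by simp [Covers]; split_ifs <;> omega)
      obtain rfl : z = x := by
        simp [Covers] at hzc c1; split_ifs at hzc c1 <;> omega
      have c2 := cov z u (z + 2) hz
      cases t <;> cases u
      · exact hz
      · simp [Covers] at c2; omega
      · obtain ⟨z', u', h1, h2⟩ := ex (z + 2) (by simp [Covers] <;> omega)
        rcases sep _ _ _ _ hz h1 with ⟨rfl, rfl⟩ | h3
        · simp [Covers] at h2
        · cases u' <;> simp [Covers] at h2 <;> omega
      · exact hz
  refine ⟨fwd x t, fun hx => ?_⟩
  obtain ⟨z, u, hz, hc⟩ := (h x).1 ((h' x).2 ⟨x, t, hx, by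
    simp only [Covers]; split_ifs <;> omega⟩)
  have hz' := fwd _ _ hz
  rcases le_total x z with h3 | h3
  · rcases hM' _ _ _ _ hx hz' h3 with ⟨rfl, rfl⟩ | h4
    · exact hz
    · simp only [Covers] at hc; split_ifs at hc <;> omega
  · rcases hM' _ _ _ _ hz' hx h3 with ⟨rfl, rfl⟩ | h4
    · exact hz
    · simp only [Covers] at hc; split_ifs at hc <;> omega

/-! ### Levels, with Fibonacci block lengths -/

/-- The block lengths: the Fibonacci numbers from `2`, `3` on. -/
def lenSeq : ℕ → ℤ
  | 0 => 2
  | 1 => 3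
  | k + 2 => lenSeq k + lenSeq (k + 1)

/-- The digit marked in the input rows at a level. -/
def polarity : ℕ → Bool
  | 0 => true
  | k + 1 => !polarity k

/-- The block path `V` relates the row `d` to the row `d'`, at level `k`. -/
structure LevelPath (k : ℕ) (V : ℤ → Block → Prop) (d d' : ℤ → Bool) : Prop where
  path : IsPath (lenSeq k) (lenSeq (k + 1)) V
  inRow : IsRow (polarity k) (InMark (lenSeq k) (lenSeq (k + 1)) V) d
  outRow : IsRow (!polarity k) (OutMark (lenSeq k) (lenSeq (k + 1)) V) d'
  noMix : k ≤ 1 → NoMix V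

/-- The row `d` is related to a translate of the row `d'`, at level `k`. -/
def LevelRel (k : ℕ) (d d' : ℤ → Bool) : Prop :=
  ∃ V s, LevelPath k V d (fun x => d' (x + s))

theorem lenSeq_ineq (k : ℕ) : 0 < lenSeq k ∧ lenSeq k < lenSeq (k + 1) ∧
    lenSeq (k + 1) < 2 * lenSeq k := by
  induction k with
  | zero => simp [lenSeq]
  | succ k ih => rw [lenSeq]; omega

/-- These are the bounds that `Triple.noMix` needs, from the lengths 5, 8 on. The lengths 3, 5
violate the strict upper bound 5/3, so at the lowest levels the absence of `mix` has to be part of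
`LevelPath`. -/
theorem lenSeq_ratio (k : ℕ) : 3 * lenSeq (k + 2) < 2 * lenSeq (k + 3) ∧
    3 * lenSeq (k + 3) < 5 * lenSeq (k + 2) := by
  induction k with
  | zero => simp [lenSeq]
  | succ k ih =>
    have h : lenSeq (k + 4) = lenSeq (k + 2) + lenSeq (k + 3) := rfl
    show 3 * lenSeq (k + 3) < 2 * lenSeq (k + 4) ∧ 3 * lenSeq (k + 4) < 5 * lenSeq (k + 3)
    omega

theorem lenSeq_mono {k l : ℕ} (h : k ≤ l) : lenSeq k ≤ lenSeq l :=
  monotone_nat_of_le_succ (fun k => (lenSeq_ineq k).2.1.le) h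

theorem lenSeq_add_two (k : ℕ) : lenSeq (k + 2) = lenSeq k + lenSeq (k + 1) := rfl

theorem lenSeq_add_three (k : ℕ) : lenSeq (k + 3) = lenSeq k + 2 * lenSeq (k + 1) := by
  rw [show k + 3 = k + 1 + 2 by ring, lenSeq_add_two, lenSeq_add_two]; ring

theorem lenSeq_add_four (k : ℕ) : lenSeq (k + 4) = 2 * lenSeq k + 3 * lenSeq (k + 1) := by
  rw [show k + 4 = k + 2 + 2 by ring, lenSeq_add_two, lenSeq_add_three, lenSeq_add_two]; ring

theorem IsPath.shift {p q : ℤ} {V : ℤ → Block → Prop} (hV : IsPath p q V) (a : ℤ) :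
    IsPath p q (fun x => V (x + a)) := by
  refine ⟨?_, ?_, ?_, ?_⟩
  · obtain ⟨x, b, h⟩ := hV.ne
    exact ⟨x - a, b, by simpa using h⟩
  · intro x b h
    obtain ⟨c, hc⟩ := hV.succ h
    exact ⟨c, by rwa [add_right_comm] at hc⟩
  · intro x b h
    obtain ⟨c, hc⟩ := hV.pred h
    exact ⟨c, by rwa [show x + a - c.len p q = x - c.len p q + a by ring] at hc⟩
  · intro x b y c h h' hxy
    rcases hV.sep h h' (by omega) with h | h
    · left; exact ⟨by omega, h.2⟩
    · right; omega

theorem inMark_shift {p q : ℤ} {V : ℤ → Block → Prop} (a x : ℤ) (t : Bool) :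
    InMark p q (fun x => V (x + a)) x t ↔ InMark p q V (x + a) t := by
  cases t <;> simp only [InMark]
  rw [show x - (q - p) + a = x + a - (q - p) by ring]

theorem outMark_shift {p q : ℤ} {V : ℤ → Block → Prop} (a x : ℤ) (t : Bool) :
    OutMark p q (fun x => V (x + a)) x t ↔ OutMark p q V (x + a) t := by
  cases t <;> simp only [OutMark]
  · rw [show x - (3 * p - q) + a = x + a - (3 * p - q) by ring, show x - p + a = x + a - p by ring]
  · rw [show x - q + a = x + a - q by ring]

namespace LevelPath

variable {k : ℕ} {V V₁ V₂ : ℤ → Block → Prop} {d d' d₀ d₁ d₂ d₃ : ℤ → Bool}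

theorem shift (h : LevelPath k V d d') (a : ℤ) :
    LevelPath k (fun x => V (x + a)) (fun x => d (x + a)) (fun x => d' (x + a)) where
  path := h.path.shift a
  inRow := (h.inRow.shift a).congr (fun x t => (inMark_shift a x t).symm)
  outRow := (h.outRow.shift a).congr (fun x t => (outMark_shift a x t).symm)
  noMix hk x := h.noMix hk _

/-- The rows shared by the paths determine the marks: those of the outer paths are at least 5 apart,
those of the middle path at least 3, so `IsRow.unique` turns equality of rows into equality of
marks. -/
theorem pureTriple (h₁ : LevelPath (k + 2) V₁ d₀ d₁) (h : LevelPath (k + 1) V d₁ d₂)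
    (h₂ : LevelPath (k + 2) V₂ d₂ d₃) :
    PureTriple (lenSeq (k + 1)) (lenSeq (k + 2)) V₁ V V₂ := by
  have i1 := lenSeq_ineq (k + 1)
  have i2 := lenSeq_ineq (k + 2)
  have g3 : 3 ≤ lenSeq (k + 1) := lenSeq_mono (show 1 ≤ k + 1 by omega)
  have g5 : 5 ≤ lenSeq (k + 2) := lenSeq_mono (show 2 ≤ k + 2 by omega)
  have T : Triple (lenSeq (k + 1)) (lenSeq (k + 2)) V₁ V V₂ :=
    { hp := i1.1
      hpq := i1.2.1
      hq := i1.2.2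
      h₁ := h₁.path
      h := h.path
      h₂ := h₂.path
      m₁ := by
        have e : IsRow (polarity (k + 1))
            (OutMark (lenSeq (k + 2)) (lenSeq (k + 2 + 1)) V₁) d₁ := by
          have := h₁.outRow; simpa only [polarity, Bool.not_not] using this
        exact e.unique h.inRow ((h₁.path.separated_outMark i2.1 i2.2.1 i2.2.2).mono g5)
          ((h.path.separated_inMark i1.1 i1.2.1 i1.2.2).mono g3)
      m₂ := by
        intro x t
        exact (h₂.inRow.unique h.outRow ((h₂.path.separated_inMark i2.1 i2.2.1 i2.2.2).mono g5)
          ((h.path.separated_outMark i1.1 i1.2.1 i1.2.2).mono g3) x t).symm }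
  have r : 3 * lenSeq (k + 1) < 2 * lenSeq (k + 2) := by
    cases k with
    | zero => simp [lenSeq]
    | succ k => exact (lenSeq_ratio k).1
  have n : NoMix V := by
    cases k with
    | zero => exact h.noMix le_rfl
    | succ k => exact T.noMix (lenSeq_ratio k).1 (lenSeq_ratio k).2
  exact ⟨T, T.noMix_left n r, n, T.noMix_right n r⟩

end LevelPath

/-! ### Level zero: a row cut into its runs -/

/-- The blocks covering the digits of a row with marks `M` of the digits `1` and marks `M'` of the
digits `0`. -/
def rowBlocks (M M' : ℤ → Bool → Prop) (z : ℤ) : Block → Prop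
  | .inS => M z false
  | .inL => M z true
  | .outS => M' z false
  | .outL => M' (z + 1) true
  | .mix => False

theorem rowBlocks_isPath {M M' : ℤ → Bool → Prop} {d : ℤ → Bool} (hM : Separated 3 M)
    (hM' : Separated 3 M') (h : IsRow true M d) (h' : IsRow false M' d) :
    IsPath 2 3 (rowBlocks M M') := by
  have cell : ∀ x, ∃ z b, rowBlocks M M' z b ∧ z ≤ x ∧ x < z + b.len 2 3 := by
    intro x
    cases hd : d x
    · obtain ⟨y, t, h1, h2⟩ := (h' x).1 hd
      cases t
      · exact ⟨y, .outS, h1, by simp [Covers] at h2 ⊢; omega⟩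
      · exact ⟨y - 1, .outL, by simpa [rowBlocks] using h1, by simp [Covers] at h2 ⊢; omega⟩
    · obtain ⟨y, t, h1, h2⟩ := (h x).1 hd
      cases t
      · exact ⟨y, .inS, h1, by simp [Covers] at h2 ⊢; omega⟩
      · exact ⟨y, .inL, h1, by simp [Covers] at h2 ⊢; omega⟩
  have digit : ∀ {z b x}, rowBlocks M M' z b → z ≤ x → x < z + b.len 2 3 →
      (d x = true ∧ ((b = .inS ∧ M z false) ∨ (b = .inL ∧ M z true))) ∨
      (d x = false ∧ ((b = .outS ∧ M' z false) ∨ (b = .outL ∧ M' (z + 1) true))) := by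
    intro z b x hb h1 h2
    cases b
    · exact Or.inl ⟨(h x).2 ⟨z, _, hb, by simp [Covers] at h2 ⊢; omega⟩, Or.inl ⟨rfl, hb⟩⟩
    · exact Or.inl ⟨(h x).2 ⟨z, _, hb, by simp [Covers] at h2 ⊢; omega⟩, Or.inr ⟨rfl, hb⟩⟩
    · exact Or.inr ⟨(h' x).2 ⟨z, _, hb, by simp [Covers] at h2 ⊢; omega⟩, Or.inl ⟨rfl, hb⟩⟩
    · exact Or.inr ⟨(h' x).2 ⟨z + 1, _, hb, by simp [Covers] at h2 ⊢; omega⟩, Or.inr ⟨rfl, hb⟩⟩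
    · exact hb.elim
  have uniq : ∀ {z b w c}, rowBlocks M M' z b → rowBlocks M M' w c → z ≤ w →
      w < z + b.len 2 3 → z = w ∧ b = c := by
    intro z b w c hb hc hzw hwz
    have hl := c.len_ge (p := 2) (q := 3) (by norm_num) (by norm_num)
    rcases digit hb hzw hwz with ⟨d1, h1⟩ | ⟨d1, h1⟩ <;>
    rcases digit hc le_rfl (by omega) with ⟨d2, h2⟩ | ⟨d2, h2⟩
    · rcases h1 with ⟨rfl, h1⟩ | ⟨rfl, h1⟩ <;> rcases h2 with ⟨rfl, h2⟩ | ⟨rfl, h2⟩ <;>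
        rcases hM _ _ _ _ h1 h2 (by omega) with h3 | h3 <;> simp at h3 hwz ⊢ <;> omega
    · rw [d1] at d2; simp at d2
    · rw [d1] at d2; simp at d2
    · rcases h1 with ⟨rfl, h1⟩ | ⟨rfl, h1⟩ <;> rcases h2 with ⟨rfl, h2⟩ | ⟨rfl, h2⟩
      · rcases hM' _ _ _ _ h1 h2 (by omega) with h3 | h3 <;> simp at h3 hwz ⊢ <;> omega
      · rcases hM' _ _ _ _ h1 h2 (by omega) with h3 | h3 <;> simp at h3 hwz ⊢ <;> omega
      · simp at hwz
        rcases le_total (z + 1) w with h4 | h4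
        · rcases hM' _ _ _ _ h1 h2 h4 with h3 | h3 <;> simp at h3 ⊢ <;> omega
        · rcases hM' _ _ _ _ h2 h1 h4 with h3 | h3 <;> simp at h3 ⊢ <;> omega
      · rcases hM' _ _ _ _ h1 h2 (by omega) with h3 | h3 <;> simp at h3 hwz ⊢ <;> omega
  have len3 : ∀ {z b}, rowBlocks M M' z b → 2 ≤ b.len 2 3 ∧ b.len 2 3 ≤ 3 := by
    intro z b hb
    cases b <;> simp
    exact hb.elim
  refine ⟨?_, ?_, ?_, ?_⟩
  · obtain ⟨z, b, hb, -⟩ := cell 0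
    exact ⟨z, b, hb⟩
  · intro x b hb
    obtain ⟨z, c, hc, h1, h2⟩ := cell (x + b.len 2 3)
    have hz : x + b.len 2 3 = z := by
      by_contra hne
      have l := len3 hb
      rcases le_or_gt x z with h3 | h3
      · obtain ⟨rfl, rfl⟩ := uniq hb hc h3 (by omega); omega
      · obtain ⟨rfl, rfl⟩ := uniq hc hb h3.le (by omega); omega
    exact ⟨c, hz ▸ hc⟩
  · intro x b hb
    obtain ⟨z, c, hc, h1, h2⟩ := cell (x - 1)
    have hz : x - c.len 2 3 = z := by
      by_contra hne
      have l := len3 hc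
      obtain ⟨rfl, rfl⟩ := uniq hc hb (by omega) (by omega); omega
    exact ⟨c, hz ▸ hc⟩
  · intro x b y c hb hc hxy
    rcases lt_or_ge y (x + b.len 2 3) with h1 | h1
    · exact Or.inl (uniq hb hc hxy h1)
    · exact Or.inr h1

namespace LevelPath

variable {k : ℕ} {V V₁ V₂ : ℤ → Block → Prop} {d d' d₀ d₁ d₂ d₃ : ℤ → Bool}

/-- The path between two paths of level `1`. -/
theorem exists_pureTriple (h₁ : LevelPath 1 V₁ d₀ d₁) (h₂ : LevelPath 1 V₂ d₁ d₂) :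
    ∃ V, PureTriple (lenSeq 0) (lenSeq 1) V₁ V (fun x => V₂ (x + -2)) := by
  have i := lenSeq_ineq 1
  have hV := rowBlocks_isPath (h₁.path.separated_outMark i.1 i.2.1 i.2.2)
    (h₂.path.separated_inMark i.1 i.2.1 i.2.2) h₁.outRow h₂.inRow
  -- The path of level 0 carries its output marks at the ends of blocks. A run of two zeros at `z`
  -- has its mark at `z` in `V₂` and at `z + 2` in `V`. A run of three has it at `z + 1` and `z +
  -- 3`. Hence the translation by `-2`.
  refine ⟨_, ⟨by simp [lenSeq], by simp [lenSeq], by simp [lenSeq], h₁.path, hV, h₂.path.shift _,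
    ?_, ?_⟩, h₁.noMix le_rfl, fun _ h => h, fun _ => h₂.noMix le_rfl _⟩
  · intro x t
    cases t
    · exact (or_iff_left (id : False → False)).symm
    · exact Iff.rfl
  · intro x t
    refine Iff.trans ?_ (inMark_shift (-2) x t).symm
    cases t
    · exact or_iff_left (id : False → False)
    · simp only [OutMark, rowBlocks, lenSeq]
      rw [show x - 3 + 1 = x + -2 by ring]

theorem compose (T : PureTriple (lenSeq k) (lenSeq (k + 1)) V₁ V V₂)
    (h₁ : IsRow (polarity (k + 1)) (InMark (lenSeq (k + 1)) (lenSeq (k + 2)) V₁) d₀)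
    (h₂ : IsRow (!polarity (k + 1)) (OutMark (lenSeq (k + 1)) (lenSeq (k + 2)) V₂) d₃) :
    LevelPath (k + 3) (_root_.compose (lenSeq k) (lenSeq (k + 1)) V) d₀ d₃ where
  path := by rw [lenSeq_add_four, lenSeq_add_three]; exact T.compose_isPath
  inRow := by
    rw [lenSeq_add_four, lenSeq_add_three]
    simp only [polarity, Bool.not_not] at h₁ ⊢
    exact h₁.congr fun x t => (T.compose_inMark x t).symm
  outRow := by
    rw [lenSeq_add_four, lenSeq_add_three]
    simp only [polarity, Bool.not_not] at h₂ ⊢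
    exact h₂.congr fun x t => (T.compose_outMark x t).symm
  noMix h := by omega

end LevelPath

namespace LevelRel

variable {k : ℕ} {d d₀ d₁ d₂ d₃ d₄ d₅ : ℤ → Bool}

theorem exists_path (h : LevelRel k d₀ d₁) (a : ℤ) :
    ∃ V s, LevelPath k V (fun x => d₀ (x + a)) (fun x => d₁ (x + s)) := by
  obtain ⟨V, s, h⟩ := h
  refine ⟨fun x => V (x + a), s + a, ?_⟩
  convert h.shift a using 3
  ring

theorem comp_zero (h₁ : LevelRel 1 d₀ d₁) (h₂ : LevelRel 1 d₁ d₂) : LevelRel 3 d₀ d₂ := by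
  obtain ⟨V₁, s, h₁⟩ := h₁
  obtain ⟨V₂, s', h₂⟩ := h₂.exists_path s
  obtain ⟨V, T⟩ := h₁.exists_pureTriple h₂
  refine ⟨_, s' + -2, LevelPath.compose T h₁.inRow ?_⟩
  have := (h₂.shift (-2)).outRow
  convert this using 3
  ring

theorem comp (h₁ : LevelRel (k + 2) d₀ d₁) (h : LevelRel (k + 1) d₁ d₂)
    (h₂ : LevelRel (k + 2) d₂ d₃) : LevelRel (k + 4) d₀ d₃ := by
  obtain ⟨V₁, s₁, h₁⟩ := h₁
  obtain ⟨V, s, h⟩ := h.exists_path s₁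
  obtain ⟨V₂, s₂, h₂⟩ := h₂.exists_path s
  exact ⟨_, s₂, LevelPath.compose (h₁.pureTriple h h₂) h₁.inRow h₂.outRow⟩

theorem not_stacked_zero (h₁ : LevelRel 1 d₀ d₁) (h₂ : LevelRel 1 d₁ d₂) (h₃ : LevelRel 1 d₂ d₃) :
    False := by
  obtain ⟨V₁, s₁, h₁⟩ := h₁
  obtain ⟨V₂, s₂, h₂⟩ := h₂.exists_path s₁
  obtain ⟨V₃, s₃, h₃⟩ := h₃.exists_path s₂
  obtain ⟨V, T⟩ := h₁.exists_pureTriple h₂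
  obtain ⟨V', T'⟩ := (h₂.shift (-2)).exists_pureTriple (h₃.shift (-2))
  exact T.not_stacked T'

theorem not_stacked (h₁ : LevelRel (k + 2) d₀ d₁) (h : LevelRel (k + 1) d₁ d₂)
    (h₂ : LevelRel (k + 2) d₂ d₃) (h' : LevelRel (k + 1) d₃ d₄) (h₃ : LevelRel (k + 2) d₄ d₅) :
    False := by
  obtain ⟨V₁, s₁, h₁⟩ := h₁
  obtain ⟨V, s, h⟩ := h.exists_path s₁
  obtain ⟨V₂, s₂, h₂⟩ := h₂.exists_path s
  obtain ⟨V', s', h'⟩ := h'.exists_path s₂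
  obtain ⟨V₃, s₃, h₃⟩ := h₃.exists_path s'
  exact (h₁.pureTriple h h₂).not_stacked (h₂.pureTriple h' h₃)

end LevelRel

/-! ### Transducers, and the excluded words -/

/-- A transition of a transducer: source, target, digit read, digit written. -/
abbrev Edge := ℕ × ℕ × ℕ × ℕ

/-- The transducer with transitions `E` relates the row `r` to the row `r'`. -/
def Run (E : List Edge) (r r' : ℤ → ℕ) : Prop :=
  ∃ h : ℤ → ℕ, ∀ x, (h x, h (x + 1), r x, r' x) ∈ E

/-- The composition of two transducers, the states of the second one being less than `4`. -/
def compEdges (E E' : List Edge) : List Edge :=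
  E.flatMap fun a => (E'.filter fun b => a.2.2.2 == b.2.2.1).map fun b =>
    (4 * a.1 + b.1, 4 * a.2.1 + b.2.1, a.2.2.1, b.2.2.2)

/-- The transitions that are preceded and followed by a transition. -/
def trimEdges (E : List Edge) : List Edge :=
  E.filter fun a => (E.any fun b => b.2.1 == a.1) && E.any fun b => b.1 == a.2.1

/-- The composition of two transducers, trimmed several times. -/
def stackEdges (E E' : List Edge) : List Edge := trimEdges^[8] (compEdges E E')

theorem Run.trim {E : List Edge} {r r' : ℤ → ℕ} (h : Run E r r') : Run (trimEdges E) r r' := by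
  obtain ⟨h, H⟩ := h
  refine ⟨h, fun x => ?_⟩
  simp only [trimEdges, List.mem_filter, Bool.and_eq_true, List.any_eq_true, beq_iff_eq]
  exact ⟨H x, ⟨_, H (x - 1), by simp⟩, ⟨_, H (x + 1), rfl⟩⟩

theorem Run.stack {E E' : List Edge} {r r' r'' : ℤ → ℕ} (h : Run E r r') (h' : Run E' r' r'') :
    Run (stackEdges E E') r r'' := by
  have key : ∀ n (F : List Edge), Run F r r'' → Run (trimEdges^[n] F) r r'' := by
    intro n
    induction n with
    | zero => exact fun F hF => hF
    | succ n ih => exact fun F hF => ih _ hF.trim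
  apply key
  obtain ⟨h, H⟩ := h
  obtain ⟨h', H'⟩ := h'
  refine ⟨fun x => 4 * h x + h' x, fun x => ?_⟩
  simp only [compEdges, List.mem_flatMap, List.mem_map, List.mem_filter, beq_iff_eq]
  exact ⟨_, H x, _, ⟨H' x, rfl⟩, rfl⟩

theorem Run.mono {E E' : List Edge} {r r' : ℤ → ℕ} (h : Run E r r')
    (hE : ∀ e ∈ E, e.2.2.2 ≤ 1 → e ∈ E') (hr : ∀ x, r' x ≤ 1) : Run E' r r' := by
  obtain ⟨h, H⟩ := h
  exact ⟨h, fun x => hE _ (H x) (hr x)⟩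

theorem Run.ne_nil {E : List Edge} {r r' : ℤ → ℕ} (h : Run E r r') : E ≠ [] := by
  rintro rfl
  obtain ⟨h, H⟩ := h
  simpa using H 0

/-- The transitions of the two components of the Wang set. -/
def tileEdges (c : Fin 2) : List Edge :=
  if c = 0 then [(0, 0, 1, 0), (0, 3, 2, 1), (1, 0, 2, 2), (1, 1, 4, 2), (1, 3, 2, 3),
    (3, 0, 1, 1), (3, 1, 1, 1), (3, 1, 2, 2), (3, 3, 3, 1)]
  else [(2, 2, 1, 4), (2, 2, 0, 2)]

theorem mem_tileEdges {c : Fin 2} {t : WangTile (Fin 4) (Fin 5)} :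
    t ∈ wangComponent c ↔ ((t.w : ℕ), (t.e : ℕ), (t.s : ℕ), (t.n : ℕ)) ∈ tileEdges c := by
  obtain ⟨w, e, s, n⟩ := t
  rcases (show c = 0 ∨ c = 1 by omega) with rfl | rfl
  · rw [wangComponent, if_pos rfl, tileEdges, if_pos rfl]
    simp only [wangT0, Set.mem_insert_iff, Set.mem_singleton_iff, WangTile.mk.injEq,
      List.mem_cons, Prod.mk.injEq, List.not_mem_nil, or_false, Fin.ext_iff]
    rfl
  · rw [wangComponent, if_neg (by decide), tileEdges, if_neg (by decide)]
    simp only [wangT1, Set.mem_insert_iff, Set.mem_singleton_iff, WangTile.mk.injEq,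
      List.mem_cons, Prod.mk.injEq, List.not_mem_nil, or_false, Fin.ext_iff]
    rfl

/-- The code of a stack of states. -/
def code (l : List ℕ) : ℕ := l.foldl (fun n s => 4 * n + s) 0

/-- The transitions of the composition of the components `1`, `0`, `0`, `0`, `0` that can be
followed by the component `1`. -/
def edgesA : List Edge :=
  [(code [2,0,3,3,0], code [2,3,1,0,0], 0, 0), (code [2,1,0,3,0], code [2,1,3,0,0], 1, 0),
   (code [2,1,0,3,0], code [2,1,3,1,0], 1, 0), (code [2,1,0,3,3], code [2,1,3,0,0], 1, 1),
   (code [2,1,0,3,3], code [2,1,3,1,0], 1, 1), (code [2,1,1,0,3], code [2,1,0,3,0], 1, 1),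
   (code [2,1,1,1,3], code [2,1,0,3,3], 1, 1), (code [2,1,1,3,0], code [2,0,3,3,0], 0, 0),
   (code [2,1,1,3,0], code [2,1,3,3,0], 1, 0), (code [2,1,3,0,0], code [2,1,1,3,0], 1, 0),
   (code [2,1,3,1,0], code [2,1,1,0,3], 1, 1), (code [2,1,3,3,0], code [2,1,1,1,3], 1, 1),
   (code [2,1,3,3,0], code [2,3,3,0,0], 0, 0), (code [2,1,3,3,0], code [2,3,3,1,0], 0, 0),
   (code [2,3,1,0,0], code [2,1,0,3,0], 0, 0), (code [2,3,3,0,0], code [2,1,1,3,0], 0, 0),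
   (code [2,3,3,1,0], code [2,1,1,0,3], 0, 1)]

/-- The identity on the rows without the digits `c`, `1 - c`, `c` in a row; a state consists of two
digits. -/
def filterEdges (c : ℕ) : List Edge :=
  ([(0, 0, 0, 0), (0, 1, 1, 1), (1, 2, 0, 0), (1, 3, 1, 1), (2, 0, 0, 0), (2, 1, 1, 1),
    (3, 2, 0, 0), (3, 3, 1, 1)] : List Edge).filter fun e => e.1 != 1 + c || e.2.2.1 != c

/-- The transitions of the composition of the components `1`, `0`, `0`, `0`, with neither
`0`, `1`, `0` in the rows read nor `1`, `0`, `1` in the rows written. -/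
def edgesB : List Edge :=
  [(563, 706, 0, 0), (575, 707, 0, 1), (575, 723, 0, 1), (591, 563, 0, 1), (591, 1651, 1, 1),
   (605, 575, 0, 1), (607, 575, 0, 1), (624, 752, 0, 0), (624, 1629, 1, 1), (626, 752, 0, 0),
   (706, 624, 0, 0), (707, 626, 0, 0), (723, 591, 0, 1), (752, 605, 0, 1), (1629, 3711, 1, 1),
   (1651, 3679, 1, 1), (2623, 707, 0, 1), (2623, 723, 0, 1), (2803, 607, 0, 1),
   (3679, 2623, 0, 1), (3679, 3711, 1, 1), (3711, 2803, 0, 1)]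

theorem Run.filter {r : ℤ → ℕ} {c : ℕ} (hr : ∀ x, r x ≤ 1) (hc : c ≤ 1)
    (h : ∀ x, ¬ (r x = c ∧ r (x + 1) ≠ c ∧ r (x + 2) = c)) : Run (filterEdges c) r r := by
  refine ⟨fun x => 2 * r (x - 2) + r (x - 1), fun x => ?_⟩
  have h1 := hr (x - 2)
  have h2 := hr (x - 1)
  have h3 := hr x
  have h4 := h (x - 2)
  rw [show x - 2 + 1 = x - 1 by ring, show x - 2 + 2 = x by ring] at h4
  simp only [show x + 1 - 2 = x - 1 by ring, show x + 1 - 1 = x by ring]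
  generalize r (x - 2) = a at *
  generalize r (x - 1) = b at *
  generalize r x = d at *
  interval_cases c <;> interval_cases a <;> interval_cases b <;> interval_cases d <;>
    simp [filterEdges] at h4 ⊢

section words

variable {r₀ r₁ r₂ r₃ r₄ r₅ r₆ r₇ r₈ : ℤ → ℕ}

/-- A bi-infinite run only uses transitions that survive trimming. For this word and the following
ones, evaluation shows that none survives. -/
theorem not_run_11 (h₀ : Run (tileEdges 1) r₀ r₁) (h₁ : Run (tileEdges 1) r₁ r₂) : False :=
  (h₀.stack h₁).ne_nil (by decide +kernel)

theorem not_run_101 (h₀ : Run (tileEdges 1) r₀ r₁) (h₁ : Run (tileEdges 0) r₁ r₂)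
    (h₂ : Run (tileEdges 1) r₂ r₃) : False :=
  ((h₀.stack h₁).stack h₂).ne_nil (by decide +kernel)

theorem not_run_1001 (h₀ : Run (tileEdges 1) r₀ r₁) (h₁ : Run (tileEdges 0) r₁ r₂)
    (h₂ : Run (tileEdges 0) r₂ r₃) (h₃ : Run (tileEdges 1) r₃ r₄) : False :=
  (((h₀.stack h₁).stack h₂).stack h₃).ne_nil (by decide +kernel)

theorem not_run_00000 (h₀ : Run (tileEdges 0) r₀ r₁) (h₁ : Run (tileEdges 0) r₁ r₂)
    (h₂ : Run (tileEdges 0) r₂ r₃) (h₃ : Run (tileEdges 0) r₃ r₄) (h₄ : Run (tileEdges 0) r₄ r₅) :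
    False :=
  ((((h₀.stack h₁).stack h₂).stack h₃).stack h₄).ne_nil (by decide +kernel)

theorem not_run_10001000 (h₀ : Run (tileEdges 1) r₀ r₁) (h₁ : Run (tileEdges 0) r₁ r₂)
    (h₂ : Run (tileEdges 0) r₂ r₃) (h₃ : Run (tileEdges 0) r₃ r₄) (h₄ : Run (tileEdges 1) r₄ r₅)
    (h₅ : Run (tileEdges 0) r₅ r₆) (h₆ : Run (tileEdges 0) r₆ r₇) (h₇ : Run (tileEdges 0) r₇ r₈)
    (h : ∀ x, r₈ x ≤ 1) : False := by
  have H := ((((((h₀.stack h₁).stack h₂).stack h₃).stack h₄).stack h₅).stack h₆).stack h₇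
  -- The identity on the digits 0 and 1 encodes the condition that the last row can be read by the
  -- component 1, which the exclusion of this word requires.
  have H' : Run [(0, 0, 0, 0), (0, 0, 1, 1)] r₈ r₈ := ⟨fun _ => 0, fun x => by
    have := h x
    interval_cases r₈ x <;> simp⟩
  exact (H.stack H').ne_nil (by decide +kernel)

theorem run_edgesA (h₀ : Run (tileEdges 1) r₀ r₁) (h₁ : Run (tileEdges 0) r₁ r₂)
    (h₂ : Run (tileEdges 0) r₂ r₃) (h₃ : Run (tileEdges 0) r₃ r₄) (h₄ : Run (tileEdges 0) r₄ r₅)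
    (h : ∀ x, r₅ x ≤ 1) : Run edgesA r₀ r₅ :=
  -- Deleting the transitions that write a digit above 1 creates new dead ends, which the two
  -- further trimmings remove.
  (((((h₀.stack h₁).stack h₂).stack h₃).stack h₄).mono (E' := (stackEdges (stackEdges (stackEdges
    (stackEdges (tileEdges 1) (tileEdges 0)) (tileEdges 0)) (tileEdges 0)) (tileEdges 0)).filter
    fun e => e.2.2.2 ≤ 1) (by simp +contextual) h).trim.trim.mono (by decide +kernel) h

theorem run_edgesB (h₀ : Run (tileEdges 1) r₀ r₁) (h₁ : Run (tileEdges 0) r₁ r₂)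
    (h₂ : Run (tileEdges 0) r₂ r₃) (h₃ : Run (tileEdges 0) r₃ r₄) (h : ∀ x, r₀ x ≤ 1)
    (h' : ∀ x, r₄ x ≤ 1) (hf : ∀ x, ¬ (r₀ x = 0 ∧ r₀ (x + 1) ≠ 0 ∧ r₀ (x + 2) = 0))
    (hf' : ∀ x, ¬ (r₄ x = 1 ∧ r₄ (x + 1) ≠ 1 ∧ r₄ (x + 2) = 1)) : Run edgesB r₀ r₄ :=
  ((((((Run.filter h (by omega) hf).stack h₀).stack h₁).stack h₂).stack h₃).stack
    (Run.filter h' le_rfl hf')).mono (by decide +kernel) h'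

end words

/-! ### Verification of block paths on finite windows -/

/-- The walks with a given number of transitions. -/
def walks (E : List Edge) : ℕ → List (List Edge)
  | 0 => [[]]
  | n + 1 => E.flatMap fun a =>
      ((walks E n).filter fun w => w.head?.all fun b => b.1 == a.2.1).map (a :: ·)

/-- The window of length `n` at `x`. -/
def window (e : ℤ → Edge) (x : ℤ) : ℕ → List Edge
  | 0 => []
  | n + 1 => e x :: window e (x + 1) n

theorem window_mem {E : List Edge} {e : ℤ → Edge} (he : ∀ x, e x ∈ E)
    (he' : ∀ x, (e (x + 1)).1 = (e x).2.1) (x : ℤ) (n : ℕ) : window e x n ∈ walks E n := by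
  induction n generalizing x with
  | zero => simp [window, walks]
  | succ n ih =>
    simp only [window, walks, List.mem_flatMap, List.mem_map, List.mem_filter]
    refine ⟨_, he x, _, ⟨ih _, ?_⟩, rfl⟩
    cases n
    · simp [window]
    · simp [window, he']

/-- A list starts with letters that fit a pattern. -/
def fits : List (Edge → Bool) → List Edge → Bool
  | [], _ => true
  | _ :: _, [] => false
  | f :: P, a :: w => f a && fits P w

theorem fits_window {e : ℤ → Edge} (P : List (Edge → Bool)) (x : ℤ) {n : ℕ} (hn : P.length ≤ n) :
    fits P (window e x n) = fits P (window e x P.length) := by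
  induction P generalizing x n with
  | nil => simp [fits]
  | cons f P ih =>
    cases n with
    | zero => simp at hn
    | succ n => simp [fits, window, ih (x + 1) (by simpa using hn)]

theorem drop_window {e : ℤ → Edge} (x : ℤ) (n i : ℕ) :
    (window e x n).drop i = window e (x + i) (n - i) := by
  induction i generalizing x n with
  | zero => simp
  | succ i ih =>
    cases n with
    | zero => simp [window]
    | succ n => simp [window, ih]; congr 1; ring

/-- A pattern for each of the blocks. -/
abbrev Pattern := Block → List (Edge → Bool)

/-- The block `b` starts at `x`. -/
def Fits (P : Pattern) (e : ℤ → Edge) (x : ℤ) (b : Block) : Prop :=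
  fits (P b) (window e x (P b).length) = true

theorem fits_drop {P : Pattern} {e : ℤ → Edge} {x : ℤ} {n i : ℕ} {b : Block}
    (h : i + (P b).length ≤ n) : fits (P b) ((window e x n).drop i) = true ↔ Fits P e (x + i) b := by
  rw [drop_window, fits_window _ _ (by omega)]; rfl

/-- All blocks. -/
def allBlocks : List Block := [.inS, .inL, .outS, .outL, .mix]

theorem mem_allBlocks (b : Block) : b ∈ allBlocks := by cases b <;> simp [allBlocks]

/-- The length of a block, as a natural number. -/
def blockLen (p q : ℕ) : Block → ℕ
  | .inS => p
  | .inL => q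
  | .outS => p
  | .outL => q
  | .mix => 2 * p

theorem len_eq (p q : ℕ) (b : Block) : b.len p q = blockLen p q b := by cases b <;> simp [blockLen]

instance : DecidableEq Block := fun a b => by
  cases a <;> cases b <;> first | exact isTrue rfl | exact isFalse (by simp)

/-- The conditions for the blocks fitting a pattern to form a block path, in a window. -/
def pathCheck (p q m : ℕ) (P : Pattern) (w : List Edge) : Bool :=
  ((List.range (m + 1)).any fun i => allBlocks.any fun b => fits (P b) (w.drop i)) &&
  (allBlocks.all fun b => !fits (P b) w ||
    allBlocks.any fun c => fits (P c) (w.drop (blockLen p q b))) &&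
  (allBlocks.all fun b => !fits (P b) (w.drop m) ||
    allBlocks.any fun c => fits (P c) (w.drop (m - blockLen p q c))) &&
  allBlocks.all fun b => !fits (P b) w || allBlocks.all fun c =>
    (List.range (blockLen p q b)).all fun j => !fits (P c) (w.drop j) || (j == 0 && b == c)

/-- Being a block path is a local property: existence, successor, predecessor and absence of
overlaps only involve windows of length `m + n`, where `m` bounds the blocks and `n` the patterns.
Finitely many walks therefore decide it. -/
theorem isPath_of_pathCheck {p q m n : ℕ} {P : Pattern} {E : List Edge} {e : ℤ → Edge}
    (he : ∀ x, e x ∈ E) (he' : ∀ x, (e (x + 1)).1 = (e x).2.1)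
    (hm : ∀ b, blockLen p q b ≤ m ∧ (P b).length ≤ n)
    (h : ∀ w ∈ walks E (m + n), pathCheck p q m P w = true) : IsPath p q (Fits P e) := by
  have H := fun x => h _ (window_mem he he' x _)
  simp only [pathCheck, Bool.and_eq_true, List.any_eq_true, List.all_eq_true, Bool.or_eq_true,
    Bool.not_eq_true', mem_allBlocks, true_and, forall_const, List.mem_range, ← Bool.not_eq_true,
    beq_iff_eq] at H
  have f0 : ∀ x b, fits (P b) (window e x (m + n)) = true ↔ Fits P e x b := by
    intro x b
    have := fits_drop (P := P) (e := e) (x := x) (n := m + n) (i := 0) (b := b) (by have := hm b; omega)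
    simpa using this
  have f : ∀ x i b, i ≤ m → (fits (P b) ((window e x (m + n)).drop i) = true ↔
      Fits P e (x + i) b) := fun x i b hi => fits_drop (by have := hm b; omega)
  refine ⟨?_, ?_, ?_, ?_⟩
  · obtain ⟨⟨⟨⟨i, hi, b, hb⟩, -⟩, -⟩, -⟩ := H 0
    exact ⟨_, b, (f _ _ _ (by omega)).1 hb⟩
  · intro x b hb
    obtain ⟨⟨⟨-, h1⟩, -⟩, -⟩ := H x
    obtain ⟨c, hc⟩ := (h1 b).resolve_left (not_not.2 ((f0 x b).2 hb))
    rw [f _ _ _ (hm b).1] at hc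
    exact ⟨c, by rwa [len_eq]⟩
  · intro x b hb
    obtain ⟨⟨-, h1⟩, -⟩ := H (x - m)
    obtain ⟨c, hc⟩ := (h1 b).resolve_left (not_not.2 ((f _ _ _ le_rfl).2 (by simpa using hb)))
    rw [f _ _ _ (by omega)] at hc
    refine ⟨c, ?_⟩
    rw [len_eq]
    convert hc using 1
    have := (hm c).1
    push_cast [this]; ring
  · intro x b y c hb hc hxy
    obtain ⟨-, h1⟩ := H x
    rw [len_eq]
    rcases lt_or_ge y (x + blockLen p q b) with h2 | h2
    · left
      have h3 := ((h1 b).resolve_left (not_not.2 ((f0 x b).2 hb)) c (y - x).toNat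
        (by omega)).resolve_left (by
          rw [not_not, f _ _ _ (by have := hm b; omega)]
          convert hc using 1; omega)
      exact ⟨by omega, h3.2⟩
    · right; exact h2

/-- The digits selected by `sel` are those at given offsets in given blocks, in a window. -/
def rowCheck (m : ℕ) (P : Pattern) (sel : Edge → Bool) (C : List (ℕ × Block)) (w : List Edge) :
    Bool :=
  (w.drop m).head?.any sel == C.any fun c => fits (P c.2) (w.drop (m - c.1))

theorem row_of_rowCheck {m n : ℕ} {P : Pattern} {E : List Edge} {e : ℤ → Edge}
    {sel : Edge → Bool} {C : List (ℕ × Block)} (he : ∀ x, e x ∈ E)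
    (he' : ∀ x, (e (x + 1)).1 = (e x).2.1)
    (hm : ∀ b, (P b).length ≤ n) (hC : ∀ c ∈ C, c.1 ≤ m) (hn : 0 < n)
    (h : ∀ w ∈ walks E (m + n), rowCheck m P sel C w = true) (x : ℤ) :
    sel (e x) = true ↔ ∃ c ∈ C, Fits P e (x - c.1) c.2 := by
  have H := h _ (window_mem he he' (x - m) _)
  have f : ∀ i b, i ≤ m → (fits (P b) ((window e (x - m) (m + n)).drop (m - i)) = true ↔
      Fits P e (x - i) b) := by
    intro i b hi
    rw [fits_drop (by have := hm b; omega)]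
    push_cast [hi]
    rw [show x - m + (m - i) = x - i by ring]
  have h0 : ((window e (x - m) (m + n)).drop m).head? = some (e x) := by
    rw [drop_window, Nat.add_sub_cancel_left]
    obtain ⟨k, rfl⟩ := Nat.exists_eq_succ_of_ne_zero hn.ne'
    simp [window]
  rw [rowCheck, h0, beq_iff_eq, Option.any_some] at H
  rw [H, List.any_eq_true]
  exact exists_congr fun c => and_congr_right fun hc => f c.1 c.2 (hC c hc)

/-! ### The strips 10000 and 1000 as paths of levels one and two -/

/-- The blocks of the walks along `edgesA`. -/
def patternA : Pattern
  | .inS => [fun a => a.2.1 == code [2,1,1,3,0], fun a => a.2.1 == code [2,1,3,3,0],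
      fun a => a.2.1 == code [2,3,3,0,0] || a.2.1 == code [2,3,3,1,0]]
  | .inL => [fun a => a.2.1 == code [2,1,1,3,0], fun a => a.2.1 == code [2,0,3,3,0],
      fun a => a.2.1 == code [2,3,1,0,0], fun a => a.2.1 == code [2,1,0,3,0],
      fun a => a.2.1 == code [2,1,3,0,0] || a.2.1 == code [2,1,3,1,0]]
  | .outS => [fun a => a.2.1 == code [2,1,1,0,3], fun a => a.2.1 == code [2,1,0,3,0],
      fun a => a.2.1 == code [2,1,3,0,0] || a.2.1 == code [2,1,3,1,0]]
  | .outL => [fun a => a.2.1 == code [2,1,1,3,0], fun a => a.2.1 == code [2,1,3,3,0],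
      fun a => a.2.1 == code [2,1,1,1,3], fun a => a.2.1 == code [2,1,0,3,3],
      fun a => a.2.1 == code [2,1,3,0,0] || a.2.1 == code [2,1,3,1,0]]
  | .mix => [fun _ => false]

/-- The transitions with given digits. -/
def digitPattern (l l' : List ℕ) : List (Edge → Bool) :=
  List.zipWith (fun i j a => a.2.2.1.beq i && a.2.2.2.beq j) l l'

/-- The blocks of the walks along `edgesB`. -/
def patternB : Pattern
  | .inS => digitPattern [0,0,1,1,0] [1,1,1,1,1]
  | .inL => digitPattern [0,0,1,1,1] [1,1,1,1,1]
  | .outS => digitPattern [0,0,0,0] [1,0,0,1]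
  | .outL => digitPattern [0,0,0,0,0,0] [1,1,1,0,0,0]
  | .mix => digitPattern [0,0,0,0,0,1] [1,1,1,0,0,1]

/-- The digits of a row. -/
def digits (r : ℤ → ℕ) (x : ℤ) : Bool := r x == 1

theorem covered_true {M : ℤ → Bool → Prop} (x : ℤ) : (∃ y t, M y t ∧ Covers true y t x) ↔
    M x false ∨ M (x - 1) false ∨ M x true ∨ M (x - 1) true ∨ M (x - 2) true := by
  constructor
  · rintro ⟨y, t, h, hc⟩
    cases t
    · rcases (show y = x ∨ y = x - 1 by simp [Covers] at hc; omega) with rfl | rfl <;> tauto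
    · rcases (show y = x ∨ y = x - 1 ∨ y = x - 2 by simp [Covers] at hc; omega) with
        rfl | rfl | rfl <;> tauto
  · rintro (h | h | h | h | h) <;> exact ⟨_, _, h, by simp [Covers] <;> omega⟩

theorem covered_false {M : ℤ → Bool → Prop} (x : ℤ) : (∃ y t, M y t ∧ Covers false y t x) ↔
    M x false ∨ M (x - 1) false ∨ M (x + 1) true ∨ M x true ∨ M (x - 1) true := by
  constructor
  · rintro ⟨y, t, h, hc⟩
    cases t
    · rcases (show y = x ∨ y = x - 1 by simp [Covers] at hc; omega) with rfl | rfl <;> tauto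
    · rcases (show y = x + 1 ∨ y = x ∨ y = x - 1 by simp [Covers] at hc; omega) with
        rfl | rfl | rfl <;> tauto
  · rintro (h | h | h | h | h) <;> exact ⟨_, _, h, by simp [Covers] <;> omega⟩

/-- The translations normalise the positions of the marks. In the walks, the run read by `inS` is at
the offset 2 instead of the start of the block, and the run written by `outS` is at the offset 0
instead of the end 3. In `levelPath_two` the corresponding corrections are 2 and 4. -/
theorem levelPath_one {V : ℤ → Block → Prop} {d d' : ℤ → Bool} (hV : IsPath 3 5 V) (hn : NoMix V)
    (h : ∀ x, d x = false ↔ V (x - 2) .inS ∨ V (x - 3) .inS ∨ V (x - 1) .inL ∨ V (x - 2) .inL ∨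
      V (x - 3) .inL)
    (h' : ∀ x, d' x = true ↔ V x .outS ∨ V (x - 1) .outS ∨ V (x - 2) .outL ∨ V (x - 3) .outL ∨
      V (x - 4) .outL) :
    LevelPath 1 V (fun x => d (x + 2)) (fun x => d' (x + -3)) := by
  refine ⟨hV, fun x => ?_, fun x => ?_, fun _ => hn⟩
  · refine (h _).trans (Iff.trans ?_ (covered_false x).symm)
    simp only [InMark, iff_false_intro (hn _), or_false]
    ring_nf
  · refine (h' _).trans (Iff.trans ?_ (covered_true x).symm)
    simp only [OutMark, iff_false_intro (hn _), or_false, lenSeq]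
    ring_nf

theorem levelPath_two {V : ℤ → Block → Prop} {d d' : ℤ → Bool} (hV : IsPath 5 8 V)
    (h : ∀ x, d x = true ↔ V (x - 2) .inS ∨ V (x - 3) .inS ∨ V (x - 2) .inL ∨ V (x - 3) .inL ∨
      V (x - 4) .inL ∨ V (x - 5) .mix ∨ V (x - 6) .mix)
    (h' : ∀ x, d' x = false ↔ V (x - 1) .outS ∨ V (x - 2) .outS ∨ V (x - 3) .outL ∨
      V (x - 4) .outL ∨ V (x - 5) .outL ∨ V (x - 3) .mix ∨ V (x - 4) .mix) :
    LevelPath 2 V (fun x => d (x + 2)) (fun x => d' (x + -4)) := by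
  refine ⟨hV, fun x => ?_, fun x => ?_, fun h => by omega⟩
  · refine (h _).trans (Iff.trans ?_ (covered_true x).symm)
    simp only [InMark, lenSeq]
    ring_nf; tauto
  · refine (h' _).trans (Iff.trans ?_ (covered_false x).symm)
    simp only [OutMark, lenSeq]
    ring_nf; tauto

theorem checkA : (walks edgesA (6 + 5)).all (fun w => pathCheck 3 5 6 patternA w &&
      rowCheck 6 patternA (fun a => a.2.2.1 == 0)
        [(2, .inS), (3, .inS), (1, .inL), (2, .inL), (3, .inL)] w &&
      rowCheck 6 patternA (fun a => a.2.2.2 == 1)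
        [(0, .outS), (1, .outS), (2, .outL), (3, .outL), (4, .outL)] w) = true := by
  decide +kernel

theorem checkB : (walks edgesB (10 + 6)).all (fun w => pathCheck 5 8 10 patternB w &&
      rowCheck 10 patternB (fun a => a.2.2.1 == 1)
        [(2, .inS), (3, .inS), (2, .inL), (3, .inL), (4, .inL), (5, .mix), (6, .mix)] w &&
      rowCheck 10 patternB (fun a => a.2.2.2 == 0)
        [(1, .outS), (2, .outS), (3, .outL), (4, .outL), (5, .outL), (3, .mix), (4, .mix)] w) =
          true := by
  decide +kernel

theorem digits_false {r : ℤ → ℕ} {x : ℤ} (h : r x ≤ 1) : digits r x = false ↔ (r x == 0) = true := by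
  simp only [digits, beq_iff_eq, beq_eq_false_iff_ne]
  omega

theorem Run.levelRel_one {r r' : ℤ → ℕ} (h : Run edgesA r r') (hr : ∀ x, r x ≤ 1) :
    LevelRel 1 (digits r) (digits r') := by
  obtain ⟨h, H⟩ := h
  have hm : ∀ b, blockLen 3 5 b ≤ 6 ∧ (patternA b).length ≤ 5 := by
    rintro ⟨⟩ <;> simp [blockLen, patternA]
  have hW := checkA
  simp only [List.all_eq_true, Bool.and_eq_true] at hW
  have nm : NoMix (Fits patternA (fun x => (h x, h (x + 1), r x, r' x))) := by
    intro x hx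
    simp [Fits, patternA, fits, window] at hx
  have hp := isPath_of_pathCheck (e := fun x => (h x, h (x + 1), r x, r' x)) H (fun _ => rfl) hm
    fun w hw => (hW w hw).1.1
  have h1 := row_of_rowCheck (e := fun x => (h x, h (x + 1), r x, r' x)) H (fun _ => rfl)
    (fun b => (hm b).2) (by simp) (by norm_num) fun w hw => (hW w hw).1.2
  have h2 := row_of_rowCheck (e := fun x => (h x, h (x + 1), r x, r' x)) H (fun _ => rfl)
    (fun b => (hm b).2) (by simp) (by norm_num) fun w hw => (hW w hw).2
  clear hW hm H
  have L := levelPath_one (d := digits r) (d' := digits r') hp nm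
    (fun x => by rw [digits_false (hr x), h1 x]; simp) (fun x => by rw [digits, h2 x]; simp)
  have := L.shift (-2)
  simp only [add_assoc] at this
  norm_num at this
  exact ⟨_, -5, this⟩

theorem Run.levelRel_two {r r' : ℤ → ℕ} (h : Run edgesB r r') (hr' : ∀ x, r' x ≤ 1) :
    LevelRel 2 (digits r) (digits r') := by
  obtain ⟨h, H⟩ := h
  have hm : ∀ b, blockLen 5 8 b ≤ 10 ∧ (patternB b).length ≤ 6 := by
    rintro ⟨⟩ <;> simp [blockLen, patternB, digitPattern]
  have hW := checkB
  simp only [List.all_eq_true, Bool.and_eq_true] at hW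
  have hp := isPath_of_pathCheck (e := fun x => (h x, h (x + 1), r x, r' x)) H (fun _ => rfl) hm
    fun w hw => (hW w hw).1.1
  have h1 := row_of_rowCheck (e := fun x => (h x, h (x + 1), r x, r' x)) H (fun _ => rfl)
    (fun b => (hm b).2) (by simp) (by norm_num) fun w hw => (hW w hw).1.2
  have h2 := row_of_rowCheck (e := fun x => (h x, h (x + 1), r x, r' x)) H (fun _ => rfl)
    (fun b => (hm b).2) (by simp) (by norm_num) fun w hw => (hW w hw).2
  clear hW hm H
  have L := levelPath_two (d := digits r) (d' := digits r') hp
    (fun x => by rw [digits, h1 x]; simp) (fun x => by rw [digits_false (hr' x), h2 x]; simp)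
  have := L.shift (-2)
  simp only [add_assoc] at this
  norm_num at this
  exact ⟨_, -6, this⟩

/-! ### The hierarchy of level blocks -/

/-- The words of the transducers of the levels. -/
def levelWord : ℕ → List (Fin 2)
  | 0 => []
  | 1 => [1, 0, 0, 0, 0]
  | 2 => [1, 0, 0, 0]
  | k + 3 => levelWord (k + 1) ++ levelWord k ++ levelWord (k + 1)

/-- The word `w` occurs in `u` at `y`. -/
def Occurs (u : ℤ → Fin 2) : ℤ → List (Fin 2) → Prop
  | _, [] => True
  | y, c :: w => u y = c ∧ Occurs u (y + 1) w

theorem occurs_append {u : ℤ → Fin 2} {y : ℤ} {w w' : List (Fin 2)} :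
    Occurs u y (w ++ w') ↔ Occurs u y w ∧ Occurs u (y + w.length) w' := by
  induction w generalizing y with
  | nil => simp [Occurs]
  | cons c w ih => simp [Occurs, ih, and_assoc, add_assoc, add_comm (1 : ℤ)]

/-- The digits `r y` of row `y` are read, and those of row `y + 1` written, by the component
`u y`. -/
structure RowSeq (u : ℤ → Fin 2) (r : ℤ → ℤ → ℕ) : Prop where
  run : ∀ y, Run (tileEdges (u y)) (r y) (r (y + 1))

/-- The block of level `k` occurs at row `y`. -/
structure LevelBlock (u : ℤ → Fin 2) (r : ℤ → ℤ → ℕ) (k : ℕ) (y : ℤ) : Prop where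
  occurs : Occurs u y (levelWord k)
  rel : 0 < k → LevelRel k (digits (r y)) (digits (r (y + (levelWord k).length)))

/-- The rows `y` with `N y` start blocks of level `k + 1`, which alternate with blocks of level `k`
or `k + 2`. -/
structure Hierarchy (u : ℤ → Fin 2) (r : ℤ → ℤ → ℕ) (k : ℕ) (N : ℤ → Prop) : Prop where
  ne : ∃ y, N y
  block : ∀ y, N y → LevelBlock u r (k + 1) y
  next : ∀ y, N y → ∃ j, (j = k ∨ j = k + 2) ∧ LevelBlock u r j (y + (levelWord (k + 1)).length) ∧
    N (y + (levelWord (k + 1)).length + (levelWord j).length)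
  prev : ∀ y, N y → ∃ j, (j = k ∨ j = k + 2) ∧ LevelBlock u r j (y - (levelWord j).length) ∧
    N (y - (levelWord j).length - (levelWord (k + 1)).length)

theorem length_levelWord_add_three (k : ℕ) : ((levelWord (k + 3)).length : ℤ) =
    (levelWord (k + 1)).length + (levelWord k).length + (levelWord (k + 1)).length := by
  simp [levelWord]; ring

section

variable {u : ℤ → Fin 2} {r : ℤ → ℤ → ℕ} {k : ℕ} {y : ℤ}

theorem LevelBlock.comp (h₁ : LevelBlock u r (k + 1) y)
    (h : LevelBlock u r k (y + (levelWord (k + 1)).length))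
    (h₂ : LevelBlock u r (k + 1) (y + (levelWord (k + 1)).length + (levelWord k).length)) :
    LevelBlock u r (k + 3) y := by
  constructor
  · rw [levelWord, occurs_append, occurs_append]
    refine ⟨⟨h₁.occurs, h.occurs⟩, ?_⟩
    have := h₂.occurs
    simpa [add_assoc] using this
  · intro _
    rw [length_levelWord_add_three, ← add_assoc, ← add_assoc]
    cases k with
    | zero =>
      have a := h₂.rel (by omega)
      have b := h₁.rel (by omega)
      refine LevelRel.comp_zero b ?_
      simpa [levelWord] using a
    | succ k => exact LevelRel.comp (h₁.rel (by omega)) (h.rel (by omega)) (h₂.rel (by omega))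

theorem LevelBlock.not_stacked {y₁ y₂ y₃ y₄ : ℤ} (h₁ : LevelBlock u r (k + 1) y)
    (e₁ : y₁ = y + (levelWord (k + 1)).length)
    (h : LevelBlock u r k y₁) (e₂ : y₂ = y₁ + (levelWord k).length)
    (h₂ : LevelBlock u r (k + 1) y₂) (e₃ : y₃ = y₂ + (levelWord (k + 1)).length)
    (h' : LevelBlock u r k y₃) (e₄ : y₄ = y₃ + (levelWord k).length)
    (h₃ : LevelBlock u r (k + 1) y₄) : False := by
  have a₁ := h₁.rel (by omega)
  have a₂ := h₂.rel (by omega)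
  have a₃ := h₃.rel (by omega)
  have b := h.rel
  have b' := h'.rel
  rw [← e₁] at a₁
  rw [← e₃] at a₂
  rw [← e₂] at b
  rw [← e₄] at b'
  cases k with
  | zero =>
    simp [levelWord] at e₂ e₄
    subst e₂ e₄
    exact LevelRel.not_stacked_zero a₁ a₂ a₃
  | succ k => exact LevelRel.not_stacked a₁ (b (by omega)) a₂ (b' (by omega)) a₃

/-- By `LevelBlock.not_stacked` two successive separators cannot both be of level `k`. Between
successive separators of level `k + 2` there is therefore a single block of level `k + 1`, or `k +
1`, `k`, `k + 1`, which compose to level `k + 3`. So the blocks of level `k + 2` take over the role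
of those of level `k + 1`. -/
theorem Hierarchy.step {N : ℤ → Prop} (H : Hierarchy u r k N) : Hierarchy u r (k + 1)
    (fun y => LevelBlock u r (k + 2) y ∧ N (y - (levelWord (k + 1)).length) ∧
      N (y + (levelWord (k + 2)).length)) := by
  have l3 := length_levelWord_add_three k
  refine ⟨?_, fun y h => h.1, ?_, ?_⟩
  · obtain ⟨y, hy⟩ := H.ne
    obtain ⟨j, rfl | rfl, h1, h2⟩ := H.next y hy
    · obtain ⟨j', rfl | rfl, h3, h4⟩ := H.next _ h2
      · exact (LevelBlock.not_stacked (H.block _ hy) rfl h1 rfl (H.block _ h2) rfl h3 rfl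
          (H.block _ h4)).elim
      · exact ⟨_, h3, by simpa using h2, h4⟩
    · exact ⟨_, h1, by simpa using hy, h2⟩
  · rintro y ⟨h0, h1, h2⟩
    obtain ⟨j, rfl | rfl, h3, h4⟩ := H.next _ h2
    · obtain ⟨j', rfl | rfl, h5, h6⟩ := H.next _ h4
      · exact (LevelBlock.not_stacked (H.block _ h2) rfl h3 rfl (H.block _ h4) rfl h5 rfl
          (H.block _ h6)).elim
      · refine ⟨j + 3, by omega, (H.block _ h2).comp h3 (H.block _ h4), ?_⟩
        rw [l3, ← add_assoc, ← add_assoc]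
        exact ⟨h5, by simpa using h4, h6⟩
    · exact ⟨k + 1, by omega, H.block _ h2, h3, by simpa using h2, h4⟩
  · rintro y ⟨h0, h1, h2⟩
    obtain ⟨j, rfl | rfl, h3, h4⟩ := H.prev _ h1
    · obtain ⟨j', rfl | rfl, h5, h6⟩ := H.prev _ h4
      · exact (LevelBlock.not_stacked (H.block _ h6) (by ring) h5 (by ring) (H.block _ h4) (by ring)
          h3 (by ring) (H.block _ h1)).elim
      · refine ⟨j + 3, by omega, ?_, ?_⟩
        · have := (H.block _ h4).comp (by simpa using h3) (by simpa using H.block _ h1)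
          rw [l3]
          convert this using 1; ring
        · rw [l3]
          have e : y - ((levelWord (j + 1)).length + (levelWord j).length +
              (levelWord (j + 1)).length : ℤ) - (levelWord (j + 1 + 1)).length =
              y - (levelWord (j + 1)).length - (levelWord j).length -
              (levelWord (j + 1)).length - (levelWord (j + 2)).length := by
            rw [show j + 1 + 1 = j + 2 by ring]; ring
          rw [e]
          exact ⟨h5, h6, by simpa using h4⟩
    · exact ⟨k + 1, by omega, H.block _ h1, h3, h4, by simpa using h1⟩

theorem Hierarchy.exists_of_zero {N : ℤ → Prop} (H : Hierarchy u r 0 N) (k : ℕ) :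
    ∃ N, Hierarchy u r k N := by
  induction k with
  | zero => exact ⟨N, H⟩
  | succ k ih => obtain ⟨N, hN⟩ := ih; exact ⟨_, hN.step⟩

end

/-! ### The bottom of the hierarchy: blocks 10000 and 1000 -/

theorem IsRow.not_isolated {c : Bool} {M : ℤ → Bool → Prop} {d : ℤ → Bool} (h : IsRow c M d)
    (x : ℤ) (h0 : d x ≠ c) (h1 : d (x + 1) = c) (h2 : d (x + 2) ≠ c) : False := by
  obtain ⟨y, t, hM, hc⟩ := (h _).1 h1
  have a0 : ¬ Covers c y t x := fun h' => h0 ((h _).2 ⟨y, t, hM, h'⟩)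
  have a2 : ¬ Covers c y t (x + 2) := fun h' => h2 ((h _).2 ⟨y, t, hM, h'⟩)
  simp only [Covers] at a0 a2 hc
  split_ifs at a0 a2 hc <;> omega

namespace RowSeq

variable {u : ℤ → Fin 2} {r : ℤ → ℤ → ℕ}

theorem run' (R : RowSeq u r) {y y' : ℤ} {c : Fin 2} (h : u y = c) (hy : y' = y + 1) :
    Run (tileEdges c) (r y) (r y') := by subst h hy; exact R.run y

theorem le_one (R : RowSeq u r) {y : ℤ} (h : u y = 1) (x : ℤ) : r y x ≤ 1 := by
  obtain ⟨g, hg⟩ := R.run' h rfl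
  have := hg x
  simp [tileEdges] at this
  omega

theorem eq_zero_or_one (c : Fin 2) : c = 0 ∨ c = 1 := by omega

theorem zero_of_one (R : RowSeq u r) {y : ℤ} (h : u y = 1) :
    u (y + 1) = 0 ∧ u (y + 2) = 0 ∧ u (y + 3) = 0 := by
  have h1 : u (y + 1) = 0 := (eq_zero_or_one _).resolve_right fun h1 =>
    not_run_11 (R.run' h rfl) (R.run' (y' := y + 2) h1 (by ring))
  have h2 : u (y + 2) = 0 := (eq_zero_or_one _).resolve_right fun h2 =>
    not_run_101 (R.run' h rfl) (R.run' (y' := y + 2) h1 (by ring))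
      (R.run' (y' := y + 3) h2 (by ring))
  exact ⟨h1, h2, (eq_zero_or_one _).resolve_right fun h3 =>
    not_run_1001 (R.run' h rfl) (R.run' (y' := y + 2) h1 (by ring))
      (R.run' (y' := y + 3) h2 (by ring)) (R.run' (y' := y + 4) h3 (by ring))⟩

theorem exists_one (R : RowSeq u r) (y : ℤ) : u y = 1 ∨ u (y + 1) = 1 ∨ u (y + 2) = 1 ∨
    u (y + 3) = 1 ∨ u (y + 4) = 1 := by
  by_contra! h
  have z : ∀ {y}, u y ≠ 1 → u y = 0 := fun h => (eq_zero_or_one _).resolve_right h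
  exact not_run_00000 (R.run' (z h.1) rfl) (R.run' (y' := y + 2) (z h.2.1) (by ring))
    (R.run' (y' := y + 3) (z h.2.2.1) (by ring)) (R.run' (y' := y + 4) (z h.2.2.2.1) (by ring))
    (R.run' (y' := y + 5) (z h.2.2.2.2) (by ring))

/-- The block `1`, `0`, `0`, `0`, `0` occurs at `y`, before a letter `1`. -/
def IsA (u : ℤ → Fin 2) (y : ℤ) : Prop :=
  u y = 1 ∧ u (y + 1) = 0 ∧ u (y + 2) = 0 ∧ u (y + 3) = 0 ∧ u (y + 4) = 0 ∧ u (y + 5) = 1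

/-- The block `1`, `0`, `0`, `0` occurs at `y`, before a letter `1`. -/
def IsB (u : ℤ → Fin 2) (y : ℤ) : Prop :=
  u y = 1 ∧ u (y + 1) = 0 ∧ u (y + 2) = 0 ∧ u (y + 3) = 0 ∧ u (y + 4) = 1

theorem isA_or_isB (R : RowSeq u r) {y : ℤ} (h : u y = 1) : IsA u y ∨ IsB u y := by
  obtain ⟨h1, h2, h3⟩ := R.zero_of_one h
  rcases eq_zero_or_one (u (y + 4)) with h4 | h4
  · left
    refine ⟨h, h1, h2, h3, h4, ?_⟩
    have := R.exists_one (y + 1)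
    simp only [add_assoc] at this
    norm_num [h1, h2, h3, h4] at this
    exact this
  · exact Or.inr ⟨h, h1, h2, h3, h4⟩

theorem isA_or_isB_prev (R : RowSeq u r) {y : ℤ} (h : u y = 1) : IsA u (y - 5) ∨ IsB u (y - 4) := by
  have e := R.exists_one (y - 5)
  have z := fun c => R.zero_of_one (y := y - c)
  have z5 := z 5
  have z4 := z 4
  have z3 := z 3
  have z2 := z 2
  have z1 := z 1
  simp only [IsA, IsB]
  ring_nf at e z5 z4 z3 z2 z1 ⊢
  rcases eq_zero_or_one (u (-4 + y)) with h4 | h4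
  · rcases eq_zero_or_one (u (-5 + y)) with h5 | h5
    · simp_all
    · simp_all
      exact (eq_zero_or_one _).resolve_right z1
  · simp_all

theorem not_isB_isB (R : RowSeq u r) {y : ℤ} (h : IsB u y) (h' : IsB u (y + 4)) : False := by
  obtain ⟨h0, h1, h2, h3, -⟩ := h
  obtain ⟨h4, h5, h6, h7, h8⟩ := h'
  simp only [add_assoc] at h5 h6 h7 h8
  norm_num at h5 h6 h7 h8
  exact not_run_10001000 (R.run' h0 rfl) (R.run' (y' := y + 2) h1 (by ring))
    (R.run' (y' := y + 3) h2 (by ring)) (R.run' (y' := y + 4) h3 (by ring))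
    (R.run' (y' := y + 5) h4 (by ring)) (R.run' (y' := y + 6) h5 (by ring))
    (R.run' (y' := y + 7) h6 (by ring)) (R.run' (y' := y + 8) h7 (by ring)) (R.le_one h8)

theorem levelBlock_one (R : RowSeq u r) {y : ℤ} (h : IsA u y) : LevelBlock u r 1 y := by
  obtain ⟨h0, h1, h2, h3, h4, h5⟩ := h
  constructor
  · simp only [levelWord, Occurs, add_assoc]
    norm_num
    exact ⟨h0, h1, h2, h3, h4⟩
  · intro _
    exact Run.levelRel_one (run_edgesA (R.run' h0 rfl) (R.run' (y' := y + 2) h1 (by ring))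
      (R.run' (y' := y + 3) h2 (by ring)) (R.run' (y' := y + 4) h3 (by ring))
      (R.run' (y' := y + 5) h4 (by ring)) (R.le_one h5)) (R.le_one h0)

/-- The neighbouring strips 10000 supply the conditions under which 1000 is rigid: the one below
writes its digits 1, and the one above reads its digits 0, in runs covered by marks, hence never
isolated. -/
theorem levelBlock_two (R : RowSeq u r) {y : ℤ} (h : IsB u y) (ha : IsA u (y - 5))
    (ha' : IsA u (y + 4)) : LevelBlock u r 2 y := by
  have l := (R.levelBlock_one ha).rel (by omega)
  have l' := (R.levelBlock_one ha').rel (by omega)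
  simp only [levelWord, List.length_cons, List.length_nil] at l l'
  norm_num at l l'
  obtain ⟨h0, h1, h2, h3, h4⟩ := h
  constructor
  · simp only [levelWord, Occurs, add_assoc]
    norm_num
    exact ⟨h0, h1, h2, h3⟩
  · intro _
    refine Run.levelRel_two (run_edgesB (R.run' h0 rfl) (R.run' (y' := y + 2) h1 (by ring))
      (R.run' (y' := y + 3) h2 (by ring)) (R.run' (y' := y + 4) h3 (by ring)) (R.le_one h0)
      (R.le_one h4) ?_ ?_) (R.le_one h4)
    · rintro x ⟨a0, a1, a2⟩
      obtain ⟨V, s, hV⟩ := l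
      have b1 := R.le_one h0 (x + 1)
      refine hV.outRow.not_isolated (x - s) ?_ ?_ ?_
      · simp [digits, polarity, a0]
      · simp [digits, polarity, show x - s + 1 + s = x + 1 by ring]; omega
      · simp [digits, polarity, show x - s + 2 + s = x + 2 by ring, a2]
    · change ∀ x, ¬ (r (y + 4) x = 1 ∧ r (y + 4) (x + 1) ≠ 1 ∧ r (y + 4) (x + 2) = 1)
      rintro x ⟨a0, a1, a2⟩
      obtain ⟨V, s, hV⟩ := l'
      refine hV.inRow.not_isolated x ?_ ?_ ?_
      · simp [digits, polarity, a0]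
      · simp [digits, polarity, a1]
      · simp [digits, polarity, a2]

theorem levelBlock_zero (y : ℤ) : LevelBlock u r 0 y := ⟨trivial, fun h => by omega⟩

theorem isA_after_isB (R : RowSeq u r) {y : ℤ} (h : IsB u y) : IsA u (y + 4) :=
  (R.isA_or_isB h.2.2.2.2).resolve_right (R.not_isB_isB h)

theorem isA_before_isB (R : RowSeq u r) {y : ℤ} (h : IsB u y) : IsA u (y - 5) :=
  (R.isA_or_isB_prev h.1).resolve_right fun h' => R.not_isB_isB h' (by simpa using h)

/-- Two adjacent blocks 10000 are regarded as separated by the empty word, of level 0. All other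
separators are single blocks 1000, of level 2, since two of those are never adjacent. -/
theorem hierarchy (R : RowSeq u r) : Hierarchy u r 0 (IsA u) := by
  refine ⟨?_, fun y h => R.levelBlock_one h, ?_, ?_⟩
  · have one : ∀ y, u y = 1 → ∃ y, IsA u y := fun y h =>
      (R.isA_or_isB h).elim (fun h => ⟨_, h⟩) fun h => ⟨_, R.isA_after_isB h⟩
    rcases R.exists_one 0 with h | h | h | h | h <;> exact one _ h
  · intro y h
    simp only [levelWord, List.length_cons, List.length_nil]
    rcases R.isA_or_isB h.2.2.2.2.2 with h1 | h1
    · exact ⟨0, Or.inl rfl, levelBlock_zero _, by simpa [levelWord] using h1⟩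
    · exact ⟨2, Or.inr rfl, R.levelBlock_two h1 (by simpa using h) (R.isA_after_isB h1), by
        simpa [levelWord] using R.isA_after_isB h1⟩
  · intro y h
    rcases R.isA_or_isB_prev h.1 with h1 | h1
    · exact ⟨0, Or.inl rfl, levelBlock_zero _, by simpa [levelWord] using h1⟩
    · exact ⟨2, Or.inr rfl, R.levelBlock_two h1 (R.isA_before_isB h1) (by simpa [levelWord] using h), by simpa [levelWord] using R.isA_before_isB h1⟩

end RowSeq

/-! ### Level words as codings of a rotation -/

/-- The word `w` codes the orbit of the phase `z` under the rotation by `α`. -/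
def Codes (α : ℝ) : ℝ → List (Fin 2) → Prop
  | z, [] => 0 ≤ z ∧ z < 1
  | z, c :: w => (0 ≤ z ∧ z < 1) ∧ Codes α (z + α - (c : ℕ)) w

/-- The phase after the word `w`. -/
def endPhase (α : ℝ) : ℝ → List (Fin 2) → ℝ
  | z, [] => z
  | z, c :: w => endPhase α (z + α - (c : ℕ)) w

section codes

variable {α : ℝ}

theorem endPhase_append (z : ℝ) (w w' : List (Fin 2)) :
    endPhase α z (w ++ w') = endPhase α (endPhase α z w) w' := by
  induction w generalizing z with
  | nil => rfl
  | cons c w ih => exact ih _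

theorem Codes.head {z : ℝ} {w : List (Fin 2)} (h : Codes α z w) : 0 ≤ z ∧ z < 1 := by
  cases w
  · exact h
  · exact h.1

theorem codes_append {z : ℝ} {w w' : List (Fin 2)} :
    Codes α z (w ++ w') ↔ Codes α z w ∧ Codes α (endPhase α z w) w' := by
  induction w generalizing z with
  | nil => exact ⟨fun h => ⟨h.head, h⟩, fun h => h.2⟩
  | cons c w ih => simp only [List.cons_append, Codes, ih, endPhase, and_assoc]

/-- The occurrences of the letter `1` in a word. -/
def wordSum (w : List (Fin 2)) : ℕ := (w.map fun c : Fin 2 => (c : ℕ)).sum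

theorem wordSum_append (w w' : List (Fin 2)) : wordSum (w ++ w') = wordSum w + wordSum w' := by
  simp [wordSum]

theorem endPhase_eq (z : ℝ) (w : List (Fin 2)) :
    endPhase α z w = z + w.length * α - wordSum w := by
  induction w generalizing z with
  | nil => simp [endPhase, wordSum]
  | cons c w ih =>
    simp only [endPhase, ih, List.length_cons, wordSum, List.map_cons, List.sum_cons]
    push_cast; ring

theorem Codes.last {z : ℝ} {w : List (Fin 2)} (h : Codes α z w) :
    0 ≤ z + w.length * α - wordSum w ∧ z + w.length * α - wordSum w < 1 := by
  have : Codes α z (w ++ []) := by simpa using h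
  rw [← endPhase_eq]
  exact (codes_append.1 this).2

/-- A coded word is determined by its phase. -/
theorem Codes.unique {z : ℝ} {w w' : List (Fin 2)} (h : Codes α z w)
    (h' : Codes α z w') (hl : w.length = w'.length) : w = w' := by
  induction w generalizing z w' with
  | nil => simpa using hl.symm
  | cons c w ih =>
    cases w' with
    | nil => simp at hl
    | cons c' w' =>
      have h1 := h.2.head
      have h2 := h'.2.head
      have : c = c' := by
        have a1 : ((c : ℕ) : ℝ) < (c' : ℕ) + 1 := by linarith
        have a2 : ((c' : ℕ) : ℝ) < (c : ℕ) + 1 := by linarith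
        norm_cast at a1 a2
        omega
      subst this
      rw [ih h.2 h'.2 (by simpa using hl)]

end codes


/-- The frequency of the letter `1`. -/
noncomputable def sturmSlope : ℝ := 1 / (Real.goldenRatio + 3)

/-- The lengths of the intervals of phases. -/
noncomputable def phaseLen (k : ℕ) : ℝ := sturmSlope * (Real.goldenRatio - 1) ^ k

theorem slope_mul : sturmSlope * (Real.goldenRatio + 3) = 1 := by
  have := Real.goldenRatio_pos
  rw [sturmSlope]; field_simp

theorem slope_pos : 0 < sturmSlope := by
  have := Real.goldenRatio_pos
  rw [sturmSlope]; positivity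

theorem inv_ratio : 0 < Real.goldenRatio - 1 ∧ Real.goldenRatio - 1 < 1 ∧
    (Real.goldenRatio - 1) ^ 2 = 1 - (Real.goldenRatio - 1) := by
  refine ⟨by linarith [Real.one_lt_goldenRatio], by linarith [Real.goldenRatio_lt_two], ?_⟩
  have := Real.goldenRatio_sq
  nlinarith

theorem phaseLen_add (k : ℕ) : phaseLen k = phaseLen (k + 1) + phaseLen (k + 2) := by
  simp only [phaseLen, pow_add, inv_ratio.2.2]
  ring

theorem phaseLen_pos (k : ℕ) : 0 < phaseLen k := mul_pos slope_pos (pow_pos inv_ratio.1 _)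

theorem phaseLen_zero : phaseLen 0 = sturmSlope := by simp [phaseLen]

theorem phaseLen_le (k : ℕ) : phaseLen k ≤ sturmSlope := by
  rw [← phaseLen_zero]
  exact antitone_nat_of_succ_le (fun k => by
    have := phaseLen_add k; have := phaseLen_pos (k + 2); linarith) (Nat.zero_le k)

/-- The left end of the interval of phases of a level. -/
noncomputable def phaseStart (k : ℕ) : ℝ :=
  if k % 2 = 1 then 1 - sturmSlope else 1 - phaseLen k

/-- The change of the phase over a block. -/
noncomputable def phaseShift (k : ℕ) : ℝ :=
  if k % 2 = 1 then sturmSlope - phaseLen k else -(sturmSlope - phaseLen k)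

theorem phaseStart_nonneg (k : ℕ) : 0 ≤ phaseStart k := by
  have h1 := phaseLen_le k
  have h2 : sturmSlope ≤ 1 := by
    have := slope_mul; have := slope_pos; nlinarith [Real.goldenRatio_pos]
  rw [phaseStart]; split_ifs <;> linarith

/-- Write L for `phaseLen k` and α for the slope. An odd level moves the interval [1 - α, 1 - α + L)
onto [1 - L, 1), and an even level moves the latter onto the former. By `phaseLen_add` the moves of
levels `k + 1`, `k`, `k + 1` can be performed one after the other exactly on the interval of level
`k + 3`. -/
theorem levelWord_codes (k : ℕ) : (∀ z, phaseStart k ≤ z → z < phaseStart k + phaseLen k →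
    Codes sturmSlope z (levelWord k)) ∧
    (levelWord k).length * sturmSlope - wordSum (levelWord k) = phaseShift k := by
  have hs := slope_mul
  have hpos := slope_pos
  induction k using Nat.strong_induction_on with
  | _ k ih =>
    match k with
    | 0 => 
      constructor
      · intro z h1 h2
        have := phaseStart_nonneg 0
        simp only [phaseStart, phaseLen_zero] at *
        exact ⟨by linarith, by norm_num at h2; linarith⟩
      · simp [levelWord, wordSum, phaseShift, phaseLen_zero]
    | 1 =>
      -- At both base levels the displacement is computed from `slope_mul`, the equation that
      -- defines the slope.
      have h5 : 5 * sturmSlope - 1 = sturmSlope - phaseLen 1 := by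
        rw [phaseLen, pow_one]; linarith
      constructor
      · intro z h1 h2
        simp only [phaseStart] at *
        norm_num at h1 h2
        have := phaseLen_pos 1
        have := phaseLen_le 1
        simp [levelWord, Codes]
        refine ⟨⟨?_, ?_⟩, ⟨?_, ?_⟩, ⟨?_, ?_⟩, ⟨?_, ?_⟩, ⟨?_, ?_⟩, ?_, ?_⟩ <;> linarith
      · simp [levelWord, wordSum, phaseShift]
        linarith
    | 2 =>
      have h5 : 4 * sturmSlope - 1 = -(sturmSlope - phaseLen 2) := by
        rw [phaseLen, inv_ratio.2.2]; linarith
      constructor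
      · intro z h1 h2
        simp only [phaseStart] at *
        norm_num at h1 h2
        have := phaseLen_pos 2
        have := phaseLen_le 2
        simp [levelWord, Codes]
        refine ⟨⟨?_, ?_⟩, ⟨?_, ?_⟩, ⟨?_, ?_⟩, ⟨?_, ?_⟩, ?_, ?_⟩ <;> linarith
      · simp [levelWord, wordSum, phaseShift]
        linarith
    | k + 3 =>
      obtain ⟨c1, s1⟩ := ih (k + 1) (by omega)
      obtain ⟨c0, s0⟩ := ih k (by omega)
      have e1 := phaseLen_add k
      have e2 : phaseLen (k + 1) = phaseLen (k + 2) + phaseLen (k + 3) := phaseLen_add (k + 1)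
      have p2 := phaseLen_pos (k + 2)
      have p3 := phaseLen_pos (k + 3)
      have hshift : phaseShift (k + 3) = phaseShift (k + 1) + phaseShift k + phaseShift (k + 1) := by
        simp only [phaseShift]
        rcases Nat.mod_two_eq_zero_or_one k with h | h
        · rw [if_pos (by omega), if_pos (by omega), if_neg (by omega)]; linarith
        · rw [if_neg (by omega), if_neg (by omega), if_pos (by omega)]; linarith
      constructor
      · intro z h1 h2
        rw [levelWord, codes_append, codes_append, endPhase_append, endPhase_eq, endPhase_eq,
          add_sub_assoc, s1, add_sub_assoc, s0]
        simp only [phaseStart, phaseShift] at *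
        rcases Nat.mod_two_eq_zero_or_one k with h | h
        · rw [if_pos (by omega)] at h1 h2
          rw [if_pos (by omega), if_neg (by omega)]
          rw [if_pos (by omega)] at c1
          rw [if_neg (by omega)] at c0
          refine ⟨⟨c1 _ ?_ ?_, c0 _ ?_ ?_⟩, c1 _ ?_ ?_⟩ <;> linarith
        · rw [if_neg (by omega)] at h1 h2
          rw [if_neg (by omega), if_pos (by omega)]
          rw [if_neg (by omega)] at c1
          rw [if_pos (by omega)] at c0
          refine ⟨⟨c1 _ ?_ ?_, c0 _ ?_ ?_⟩, c1 _ ?_ ?_⟩ <;> linarith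
      · rw [hshift, ← s1, ← s0, levelWord, wordSum_append, wordSum_append]
        simp; ring

/-! ### Balanced words are Sturmian -/

/-- The increments of `C` are the letters of `u`. -/
def IsCount (u : ℤ → Fin 2) (C : ℤ → ℤ) : Prop := ∀ y, C (y + 1) = C y + (u y : ℕ)

/-- Every factor of the word counted by `C` has nearly `α` times as many letters `1` as letters. -/
def BalancedCount (α : ℝ) (C : ℤ → ℤ) : Prop := ∀ (y : ℤ) (n : ℕ), |(C (y + n) : ℝ) - C y - n * α| < 1

theorem exists_isCount (u : ℤ → Fin 2) : ∃ C, IsCount u C := by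
  refine ⟨fun y => match y with
    | Int.ofNat n => ∑ i ∈ Finset.range n, ((u i : ℕ) : ℤ)
    | Int.negSucc n => -∑ i ∈ Finset.range (n + 1), ((u (-(i : ℤ) - 1) : ℕ) : ℤ), ?_⟩
  rintro (n | n)
  · exact Finset.sum_range_succ _ _
  · cases n with
    | zero => simp [Int.negSucc_eq]
    | succ n =>
      have e : Int.negSucc (n + 1) + 1 = Int.negSucc n := by simp only [Int.negSucc_eq]; push_cast; ring
      have e' : Int.negSucc (n + 1) = -((n + 1 : ℕ) : ℤ) - 1 := by simp only [Int.negSucc_eq]; push_cast; ring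
      rw [e]
      simp only
      rw [Finset.sum_range_succ _ (n + 1), e']
      ring

theorem IsCount.occurs {u : ℤ → Fin 2} {C : ℤ → ℤ} (hC : IsCount u C) {y : ℤ} {w : List (Fin 2)}
    (h : Occurs u y w) : C (y + w.length) = C y + wordSum w := by
  induction w generalizing y with
  | nil => simp [wordSum]
  | cons c w ih =>
    have := ih h.2
    rw [hC, h.1] at this
    simp only [List.length_cons, wordSum, List.map_cons, List.sum_cons] at this ⊢
    push_cast at this ⊢
    rw [show y + ((w.length : ℤ) + 1) = y + 1 + w.length by ring, this]
    ring

/-- The values of `C y - y * α` differ from each other by less than 1, and their supremum serves as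
`ρ`. If `ρ` is less than 1 above all of them, then `C` is a floor. Otherwise some value lies 1 below
`ρ`, so no value reaches `ρ`, and `C + 1` is a ceiling. -/
theorem isSturmian_of_balanced {α : ℝ} (hα : Irrational α) {u : ℤ → Fin 2} {C : ℤ → ℤ}
    (hC : IsCount u C) (hb : BalancedCount α C) : IsSturmian α u := by
  refine ⟨hα, ?_⟩
  have cast : ∀ n : ℤ, ((n + 1 : ℤ) : ℝ) = (n : ℝ) + 1 := fun n => by push_cast; ring
  have hu : ∀ n, ((u n : ℕ) : ℤ) = C (n + 1) - C n := fun n => by rw [hC]; ring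
  set g : ℤ → ℝ := fun y => C y - y * α with hg
  have hlt : ∀ y y', g y < g y' + 1 := by
    intro y y'
    rcases le_total y y' with h | h
    · obtain ⟨n, rfl⟩ := Int.le.dest h
      have := (abs_lt.1 (hb y n)).1
      simp only [hg]; push_cast; linarith
    · obtain ⟨n, rfl⟩ := Int.le.dest h
      have := (abs_lt.1 (hb y' n)).2
      simp only [hg]; push_cast; linarith
  have hbdd : BddAbove (Set.range g) := ⟨g 0 + 1, by rintro _ ⟨y, rfl⟩; exact (hlt _ _).le⟩
  have hle : ∀ y, g y ≤ ⨆ y, g y := le_ciSup hbdd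
  have hge : ∀ y, ⨆ y, g y ≤ g y + 1 := fun y => ciSup_le fun y' => (hlt _ _).le
  set ρ := ⨆ y, g y
  refine ⟨ρ, ?_⟩
  by_cases h : ∀ y, ρ < g y + 1
  · left
    have : ∀ y : ℤ, ⌊(y : ℝ) * α + ρ⌋ = C y := fun y => by
      rw [Int.floor_eq_iff]
      have h1 := hle y
      have h2 := h y
      simp only [hg] at h1 h2
      constructor <;> linarith
    intro n
    rw [← cast, this, this, hu]
  · right
    push Not at h
    obtain ⟨y0, h0⟩ := h
    have : ∀ y : ℤ, ⌈(y : ℝ) * α + ρ⌉ = C y + 1 := fun y => by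
      rw [Int.ceil_eq_iff]
      have h1 := hge y
      have h2 := hlt y y0
      simp only [hg] at h0 h1 h2
      push_cast
      constructor <;> linarith
    intro n
    rw [← cast, this, this, hu]
    ring

/-- The factors of a coded word are balanced. -/
theorem IsCount.abs_lt_one {α z : ℝ} {u : ℤ → Fin 2} {C : ℤ → ℤ} (hC : IsCount u C)
    {y₀ y : ℤ} {w : List (Fin 2)} {n : ℕ} (hw : Occurs u y₀ w) (hz : Codes α z w)
    (h : y₀ ≤ y) (h' : y + n ≤ y₀ + w.length) : |(C (y + n) : ℝ) - C y - n * α| < 1 := by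
  obtain ⟨i, rfl⟩ := Int.le.dest h
  have hi : i + n ≤ w.length := by omega
  have e : w = w.take i ++ ((w.drop i).take n ++ (w.drop i).drop n) := by simp
  have l1 : (w.take i).length = i := by simp; omega
  have l2 : ((w.drop i).take n).length = n := by simp; omega
  rw [e] at hw hz
  have o := (occurs_append.1 (occurs_append.1 hw).2).1
  have c := (codes_append.1 (codes_append.1 hz).2).1
  have s := hC.occurs o
  have a := c.head
  have b := c.last
  rw [l1, l2] at s
  rw [l2] at b
  rw [s, abs_lt]
  push_cast
  constructor <;> linarith

/-- The moved interval of one parity shares an end with the starting interval of the other: the left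
end `1 - sturmSlope` after an even level, the right end 1 after an odd one. The right end is not
attained, so there the witness ends up `min (phaseLen a) (phaseLen b)` to its left. -/
theorem exists_codes_append {a b : ℕ} (h : a % 2 ≠ b % 2) :
    ∃ z, Codes sturmSlope z (levelWord a ++ levelWord b) := by
  obtain ⟨ca, sa⟩ := levelWord_codes a
  obtain ⟨cb, -⟩ := levelWord_codes b
  have pa := phaseLen_pos a
  have pb := phaseLen_pos b
  simp only [codes_append, endPhase_eq, add_sub_assoc, sa]
  simp only [phaseStart, phaseShift] at *
  rcases Nat.mod_two_eq_zero_or_one a with h1 | h1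
  · rw [if_neg (by omega)] at ca ⊢
    rw [if_pos (by omega)] at cb
    refine ⟨1 - phaseLen a, ca _ ?_ ?_, cb _ ?_ ?_⟩ <;> linarith
  · rw [if_pos h1] at ca ⊢
    rw [if_neg (by omega)] at cb
    have m1 := min_le_left (phaseLen a) (phaseLen b)
    have m2 := min_le_right (phaseLen a) (phaseLen b)
    have m3 := lt_min pa pb
    refine ⟨1 - min (phaseLen a) (phaseLen b) - (sturmSlope - phaseLen a), ca _ ?_ ?_,
      cb _ ?_ ?_⟩ <;> linarith

theorem le_length_levelWord (k : ℕ) : k ≤ (levelWord k).length := by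
  induction k using Nat.strong_induction_on with
  | _ k ih =>
    match k with
    | 0 => simp
    | 1 => simp [levelWord]
    | 2 => simp [levelWord]
    | 3 => simp [levelWord]
    | k + 4 =>
      have h1 := ih (k + 2) (by omega)
      have h2 := ih (k + 1) (by omega)
      rw [show k + 4 = (k + 1) + 3 by ring]
      simp only [levelWord, List.length_append] at h1 h2 ⊢
      rw [show k + 1 + 1 = k + 2 by ring]
      omega

/-- Every row lies in some pair of consecutive blocks. -/
theorem Hierarchy.cover {u : ℤ → Fin 2} {r : ℤ → ℤ → ℕ} {k : ℕ} {N : ℤ → Prop}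
    (H : Hierarchy u r k N) (y : ℤ) : ∃ z j, N z ∧ z ≤ y ∧ (j = k ∨ j = k + 2) ∧
      LevelBlock u r j (z + (levelWord (k + 1)).length) ∧
      N (z + (levelWord (k + 1)).length + (levelWord j).length) ∧
      y < z + (levelWord (k + 1)).length + (levelWord j).length := by
  obtain ⟨y0, h0⟩ := H.ne
  have hl := le_length_levelWord (k + 1)
  have low : ∀ n : ℕ, ∃ z, N z ∧ z ≤ y0 - n := by
    intro n
    induction n with
    | zero => exact ⟨y0, h0, by simp⟩
    | succ n ih =>
      obtain ⟨z, hz, hle⟩ := ih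
      obtain ⟨j, -, -, hN⟩ := H.prev z hz
      exact ⟨_, hN, by omega⟩
  obtain ⟨z, ⟨hz, hzy⟩, hmax⟩ := Int.exists_greatest_of_bdd (P := fun z => N z ∧ z ≤ y)
    ⟨y, fun z h => h.2⟩ (by
      obtain ⟨z, hz, hle⟩ := low (y0 - y).toNat
      exact ⟨z, hz, by omega⟩)
  obtain ⟨j, hj, hb, hN⟩ := H.next z hz
  refine ⟨z, j, hz, hzy, hj, hb, hN, ?_⟩
  by_contra! hc
  have := hmax _ ⟨hN, hc⟩
  omega

/-- At level `n` of the hierarchy all blocks have length at least `n`, so a factor of length `n`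
that starts in some block ends in that block or the next. The two blocks have levels of different
parity, hence are coded together. -/
theorem RowSeq.balanced {u : ℤ → Fin 2} {r : ℤ → ℤ → ℕ} (R : RowSeq u r) {C : ℤ → ℤ}
    (hC : IsCount u C) : BalancedCount sturmSlope C := by
  intro y n
  obtain ⟨N, H⟩ := R.hierarchy.exists_of_zero n
  obtain ⟨z, j, hz, hzy, hj, hb, hN, hy⟩ := H.cover y
  have l1 := le_length_levelWord (n + 1)
  have l2 := le_length_levelWord j
  by_cases h : y < z + (levelWord (n + 1)).length
  · obtain ⟨t, ht⟩ := exists_codes_append (a := n + 1) (b := j) (by omega)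
    refine hC.abs_lt_one (y₀ := z) (occurs_append.2 ⟨(H.block z hz).occurs, hb.occurs⟩) ht hzy ?_
    simp only [List.length_append]
    push_cast
    omega
  · obtain ⟨t, ht⟩ := exists_codes_append (a := j) (b := n + 1) (by omega)
    refine hC.abs_lt_one (occurs_append.2 ⟨hb.occurs, (H.block _ hN).occurs⟩) ht (not_lt.1 h) ?_
    simp only [List.length_append]
    push_cast
    omega

theorem sturmSlope_irrational : Irrational sturmSlope := by
  have h : Irrational (Real.goldenRatio + (3 : ℕ)) := Real.goldenRatio_irrational.add_natCast 3
  rw [sturmSlope, one_div]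
  exact_mod_cast h.inv

theorem sturmSlope_eq : Real.goldenRatio ^ 2 / (5 * Real.goldenRatio ^ 2 - 1) = sturmSlope := by
  have h := Real.goldenRatio_sq
  have h' := Real.goldenRatio_pos
  rw [sturmSlope, div_eq_div_iff (by nlinarith) (by positivity)]
  nlinarith

theorem RowSeq.isSturmian {u : ℤ → Fin 2} {r : ℤ → ℤ → ℕ} (R : RowSeq u r) :
    IsSturmian sturmSlope u := by
  obtain ⟨C, hC⟩ := exists_isCount u
  exact isSturmian_of_balanced sturmSlope_irrational hC (R.balanced hC)

/-! ### From block paths back to runs of transducers -/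

/-- The row of digits of `d`. -/
def digitRow (d : ℤ → Bool) (x : ℤ) : ℕ := (d x).toNat

section pathRun

variable {p q : ℤ} {V : ℤ → Block → Prop}

/-- The start of a block whose end is known. -/
theorem IsPath.eq_of_end (hV : IsPath p q V) (hp : 0 < p) (hpq : p < q) {x y : ℤ} {b c : Block}
    (h : V x b) (h' : V y c) (e : x + b.len p q = y + c.len p q) : x = y ∧ b = c := by
  have l1 := b.len_ge hp hpq
  have l2 := c.len_ge hp hpq
  rcases le_total x y with h1 | h1
  · exact (hV.sep h h' h1).resolve_right (by omega)
  · exact ((hV.sep h' h h1).resolve_right (by omega)).imp Eq.symm Eq.symm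

/-- The blocks that meet a pair of consecutive blocks. -/
theorem IsPath.local_iff (hV : IsPath p q V) {y z : ℤ} {a b e : Block}
    (ha : V y a) (hb : V (y + a.len p q) b) (h1 : y < z + e.len p q)
    (h2 : z < y + a.len p q + b.len p q) :
    V z e ↔ (z = y ∧ e = a) ∨ (z = y + a.len p q ∧ e = b) := by
  constructor
  · intro h
    rcases le_total z y with h3 | h3
    · rcases hV.sep h ha h3 with h4 | h4
      · exact Or.inl h4
      · omega
    · rcases hV.sep ha h h3 with h4 | h4
      · exact Or.inl ⟨h4.1.symm, h4.2.symm⟩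
      · rcases hV.sep hb h h4 with h5 | h5
        · exact Or.inr ⟨h5.1.symm, h5.2.symm⟩
        · omega
  · rintro (⟨rfl, rfl⟩ | ⟨rfl, rfl⟩)
    · exact ha
    · exact hb

/-- A transducer reads and writes given digits on a block path, with states `S a b i` at the
cell `i` of the block `b` after the block `a`. -/
theorem IsPath.run (hV : IsPath p q V) (hn : NoMix V) (hp : 0 < p) (hpq : p < q) {E : List Edge}
    {S : Block → Block → ℕ → ℕ} {D D' : Block → Block → ℕ → Bool} {d d' : ℤ → Bool}
    (hE : ∀ a b c (i : ℕ), a ≠ .mix → b ≠ .mix → c ≠ .mix → (i : ℤ) < b.len p q →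
      (S a b i, if ((i + 1 : ℕ) : ℤ) < b.len p q then S a b (i + 1) else S b c 0,
        (D a b i).toNat, (D' a b i).toNat) ∈ E)
    (hd : ∀ y a b (i : ℕ), a ≠ .mix → b ≠ .mix → V y a → V (y + a.len p q) b → (i : ℤ) < b.len p q →
      d (y + a.len p q + i) = D a b i ∧ d' (y + a.len p q + i) = D' a b i) :
    Run E (digitRow d) (digitRow d') := by
  have nm : ∀ {y b}, V y b → b ≠ .mix := by rintro y b h rfl; exact hn _ h
  have ex : ∀ x, ∃ y a b, ∃ i : ℕ, V y a ∧ V (y + a.len p q) b ∧ (i : ℤ) < b.len p q ∧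
      x = y + a.len p q + i := by
    intro x
    obtain ⟨z, b, hb, h1, h2⟩ := hV.cover hp hpq x
    obtain ⟨a, ha⟩ := hV.pred hb
    obtain ⟨i, rfl⟩ := Int.le.dest h1
    exact ⟨_, a, b, i, ha, by simpa using hb, by omega, by ring⟩
  choose Y A B I hA hB hI hx using ex
  have uniq : ∀ x y a b (i : ℕ), V y a → V (y + a.len p q) b → (i : ℤ) < b.len p q →
      x = y + a.len p q + i → A x = a ∧ B x = b ∧ I x = i := by
    intro x y a b i ha hb hi e
    have e' := hx x
    have := (hV.local_iff ha hb (e := B x)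
      (by have := (B x).len_ge hp hpq; have := hI x; have := a.len_ge hp hpq; omega) (by omega)).1 (hB x)
    have la := a.len_ge hp hpq
    have hI' := hI x
    rcases this with ⟨h1, h2⟩ | ⟨h1, h2⟩
    · rw [h2] at hI'; omega
    · exact ⟨(hV.eq_of_end hp hpq (hA x) ha h1).2, h2, by omega⟩
  refine ⟨fun x => S (A x) (B x) (I x), fun x => ?_⟩
  have e := hd _ _ _ _ (nm (hA x)) (nm (hB x)) (hA x) (hB x) (hI x)
  rw [← hx x] at e
  have key : ∃ c, c ≠ .mix ∧ S (A (x + 1)) (B (x + 1)) (I (x + 1)) =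
      if ((I x + 1 : ℕ) : ℤ) < (B x).len p q then S (A x) (B x) (I x + 1) else S (B x) c 0 := by
    obtain ⟨c, hc⟩ := hV.succ (hB x)
    refine ⟨c, nm hc, ?_⟩
    have e' := hx x
    have lc := c.len_ge hp hpq
    have hI' := hI x
    split_ifs with h
    · obtain ⟨h1, h2, h3⟩ := uniq (x + 1) _ _ _ (I x + 1) (hA x) (hB x) h (by push_cast; omega)
      rw [h1, h2, h3]
    · obtain ⟨h1, h2, h3⟩ := uniq (x + 1) _ _ _ 0 (hB x) hc (by push_cast; omega)
        (by push_cast at h ⊢; omega)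
      rw [h1, h2, h3]
  obtain ⟨c, hc, hk⟩ := key
  simp only [digitRow, hk, e.1, e.2]
  exact hE _ _ _ _ (nm (hA x)) (nm (hB x)) hc (hI x)

end pathRun

/-- The states of the transitions `edgesA` along a block path. -/
def statesA (a : Block) : Block → ℕ → ℕ
  | b, 0 => match a, b with
    | .inS, .outS => code [2,3,3,1,0]
    | .inS, _ => code [2,3,3,0,0]
    | _, .outS => code [2,1,3,1,0]
    | _, _ => code [2,1,3,0,0]
  | .outS, i + 1 => [code [2,1,1,0,3], code [2,1,0,3,0]].getD i 0
  | .inS, i + 1 => [code [2,1,1,3,0], code [2,1,3,3,0]].getD i 0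
  | .inL, i + 1 => [code [2,1,1,3,0], code [2,0,3,3,0], code [2,3,1,0,0], code [2,1,0,3,0]].getD i 0
  | .outL, i + 1 => [code [2,1,1,3,0], code [2,1,3,3,0], code [2,1,1,1,3], code [2,1,0,3,3]].getD i 0
  | .mix, _ => 0

/-- The digits read by the transitions `edgesA` along a block path. -/
def readA : Block → Block → ℕ → Bool
  | .inS, .inS, i => i == 1
  | _, .inS, i => i ≤ 1
  | .inS, .inL, i => i == 4
  | _, .inL, i => i == 0 || i == 4
  | .inS, _, i => i ≠ 0
  | _, _, _ => true

/-- The digits written by the transitions `edgesA` along a block path. -/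
def writeA : Block → Block → ℕ → Bool
  | _, .outS, i => i ≤ 1
  | _, .outL, i => 2 ≤ i
  | _, _, _ => false

/-- The states of the composition of the components `1`, `0`, `0`, `0` along a block path. -/
def statesB : Block → ℕ → ℕ
  | _, 0 => code [2,0,3,3]
  | .outS, i + 1 => [code [2,3,0,0], code [2,1,3,0], code [2,3,3,0], code [2,1,1,3]].getD i 0
  | .outL, i + 1 => [code [2,3,1,0], code [2,1,0,3], code [2,0,3,0], code [2,3,0,0], code [2,1,3,0],
      code [2,3,3,0], code [2,1,1,3]].getD i 0
  | .inS, i + 1 => [code [2,3,1,0], code [2,1,0,3], code [2,1,3,0], code [2,1,1,3]].getD i 0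
  | .inL, i + 1 => [code [2,3,1,0], code [2,1,0,3], code [2,1,3,0], code [2,1,1,3], code [2,1,3,3],
      code [2,3,3,0], code [2,1,1,3]].getD i 0
  | .mix, _ => 0

/-- The digits read by the composition of the components `1`, `0`, `0`, `0` along a block path. -/
def readB : Block → ℕ → Bool
  | .inS, i => i == 2 || i == 3
  | .inL, i => 2 ≤ i && i ≤ 4
  | _, _ => false

/-- The digits written by the composition of the components `1`, `0`, `0`, `0` along a block
path. -/
def writeB : Block → ℕ → Bool
  | .outS, i => !(i == 1 || i == 2)
  | .outL, i => !(3 ≤ i && i ≤ 5)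
  | _, _ => true

/-- The transitions of the composition of the components `1`, `0`, `0`, `0` along block paths. -/
def edgesB' : List Edge :=
  [Block.inS, .inL, .outS, .outL].flatMap fun b => (List.range (blockLen 5 8 b)).map fun i =>
    (statesB b i, statesB b ((i + 1) % blockLen 5 8 b), (readB b i).toNat, (writeB b i).toNat)

theorem mem_blocks {b : Block} (h : b ≠ .mix) : b ∈ [Block.inS, .inL, .outS, .outL] := by
  cases b <;> simp at h ⊢

/-- The zeros read at an `inS` have offsets 2 and 3, so the second one falls into the next block.
This is why `statesA` and `readA` depend on the preceding block, while at level 2 all runs stay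
within their blocks and all blocks start in one state. -/
theorem IsPath.run_edgesA {V : ℤ → Block → Prop} {d d' : ℤ → Bool} (hV : IsPath 3 5 V)
    (hn : NoMix V) (h : IsRow false (InMark 3 5 V) d) (h' : IsRow true (OutMark 3 5 V) d') :
    Run edgesA (digitRow fun x => d (x - 2)) (digitRow fun x => d' (x + 3)) := by
  have hd : ∀ x, d (x - 2) = false ↔ V (x - 2) .inS ∨ V (x - 3) .inS ∨ V (x - 1) .inL ∨
      V (x - 2) .inL ∨ V (x - 3) .inL := fun x => by
    refine (h _).trans ((covered_false _).trans ?_)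
    simp only [InMark, iff_false_intro (hn _), or_false]
    ring_nf
  have hd' : ∀ x, d' (x + 3) = true ↔ V x .outS ∨ V (x - 1) .outS ∨ V (x - 2) .outL ∨
      V (x - 3) .outL ∨ V (x - 4) .outL := fun x => by
    refine (h' _).trans ((covered_true _).trans ?_)
    simp only [OutMark, iff_false_intro (hn _), or_false]
    ring_nf
  refine hV.run hn (by norm_num) (by norm_num) (S := statesA) (D := readA) (D' := writeA) ?_ ?_
  · have H : ∀ a ∈ [Block.inS, .inL, .outS, .outL], ∀ b ∈ [Block.inS, .inL, .outS, .outL],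
        ∀ c ∈ [Block.inS, .inL, .outS, .outL], ∀ i ∈ List.range 5, (i : ℤ) < b.len 3 5 →
        (statesA a b i, if ((i + 1 : ℕ) : ℤ) < b.len 3 5 then statesA a b (i + 1)
          else statesA b c 0, (readA a b i).toNat, (writeA a b i).toNat) ∈ edgesA := by
      decide +kernel
    intro a b c i ha hb hc hi
    refine H a (mem_blocks ha) b (mem_blocks hb) c (mem_blocks hc) i ?_ hi
    rw [List.mem_range]
    cases b <;> simp at hb hi <;> omega
  · intro y a b i na nb ha hb hi
    -- A digit in the block `b` depends only on `b` and its predecessor `a`. This turns the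
    -- description of the rows by `V` into a finite case check.
    have L : ∀ (j : ℤ) e, y < y + a.len 3 5 + i - j + e.len 3 5 → 0 ≤ j →
        (V (y + a.len 3 5 + i - j) e ↔ (i + a.len 3 5 - j = 0 ∧ e = a) ∨ ((i : ℤ) - j = 0 ∧ e = b)) :=
      fun j e h1 h2 => by
        rw [hV.local_iff ha hb h1 (by omega)]
        refine or_congr (and_congr_left' ?_) (and_congr_left' ?_) <;> omega
    have L0 := fun e h => (L 0 e h le_rfl)
    simp only [sub_zero] at L0
    have la := a.len_ge (p := 3) (q := 5) (by norm_num) (by norm_num)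
    constructor
    · rw [Bool.eq_iff_iff, ← not_iff_not, Bool.not_eq_true, Bool.not_eq_true, hd, L _ _ (by simp; omega) (by norm_num),
        L _ _ (by simp; omega) (by norm_num), L _ _ (by simp; omega) (by norm_num),
        L _ _ (by simp; omega) (by norm_num), L _ _ (by simp; omega) (by norm_num)]
      cases a <;> cases b <;> simp [readA] at na nb hi ⊢ <;> omega
    · rw [Bool.eq_iff_iff, hd', L0 _ (by simp; omega),
        L _ _ (by simp; omega) (by norm_num), L _ _ (by simp; omega) (by norm_num),
        L _ _ (by simp; omega) (by norm_num), L _ _ (by simp; omega) (by norm_num)]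
      cases a <;> cases b <;> simp [writeA] at na nb hi ⊢ <;> omega

theorem IsPath.run_edgesB {V : ℤ → Block → Prop} {d d' : ℤ → Bool} (hV : IsPath 5 8 V)
    (hn : NoMix V) (h : IsRow true (InMark 5 8 V) d) (h' : IsRow false (OutMark 5 8 V) d') :
    Run edgesB' (digitRow fun x => d (x - 2)) (digitRow fun x => d' (x + 4)) := by
  have hd : ∀ x, d (x - 2) = true ↔ V (x - 2) .inS ∨ V (x - 3) .inS ∨ V (x - 2) .inL ∨
      V (x - 3) .inL ∨ V (x - 4) .inL := fun x => by
    refine (h _).trans ((covered_true _).trans ?_)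
    simp only [InMark, iff_false_intro (hn _), or_false]
    ring_nf
  have hd' : ∀ x, d' (x + 4) = false ↔ V (x - 1) .outS ∨ V (x - 2) .outS ∨ V (x - 3) .outL ∨
      V (x - 4) .outL ∨ V (x - 5) .outL := fun x => by
    refine (h' _).trans ((covered_false _).trans ?_)
    simp only [OutMark, iff_false_intro (hn _), or_false]
    ring_nf
  refine hV.run hn (by norm_num) (by norm_num) (S := fun _ => statesB) (D := fun _ => readB)
    (D' := fun _ => writeB) ?_ ?_
  · have H : ∀ b ∈ [Block.inS, .inL, .outS, .outL],
        ∀ i ∈ List.range 8, (i : ℤ) < b.len 5 8 →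
        (statesB b i, if ((i + 1 : ℕ) : ℤ) < b.len 5 8 then statesB b (i + 1)
          else statesB .inS 0, (readB b i).toNat, (writeB b i).toNat) ∈ edgesB' := by
      decide +kernel
    intro a b c i ha hb hc hi
    refine H b (mem_blocks hb) i ?_ hi
    rw [List.mem_range]
    cases b <;> simp at hb hi <;> omega
  · intro y a b i na nb ha hb hi
    have L : ∀ (j : ℤ) e, y < y + a.len 5 8 + i - j + e.len 5 8 → 0 ≤ j →
        (V (y + a.len 5 8 + i - j) e ↔ (i + a.len 5 8 - j = 0 ∧ e = a) ∨ ((i : ℤ) - j = 0 ∧ e = b)) :=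
      fun j e h1 h2 => by
        rw [hV.local_iff ha hb h1 (by omega)]
        refine or_congr (and_congr_left' ?_) (and_congr_left' ?_) <;> omega
    have la := a.len_ge (p := 5) (q := 8) (by norm_num) (by norm_num)
    constructor
    · rw [Bool.eq_iff_iff, hd, L _ _ (by simp; omega) (by norm_num),
        L _ _ (by simp; omega) (by norm_num), L _ _ (by simp; omega) (by norm_num),
        L _ _ (by simp; omega) (by norm_num), L _ _ (by simp; omega) (by norm_num)]
      cases a <;> cases b <;> simp [readB] at na nb hi ⊢ <;> omega
    · rw [Bool.eq_iff_iff, ← not_iff_not, Bool.not_eq_true, Bool.not_eq_true, hd', L _ _ (by simp; omega) (by norm_num),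
        L _ _ (by simp; omega) (by norm_num), L _ _ (by simp; omega) (by norm_num),
        L _ _ (by simp; omega) (by norm_num), L _ _ (by simp; omega) (by norm_num)]
      cases a <;> cases b <;> simp [writeB] at na nb hi ⊢ <;> omega

theorem mem_of_mem_stackEdges {E E' : List Edge} {e : Edge} (h : e ∈ stackEdges E E') :
    e ∈ compEdges E E' := by
  have key : ∀ n (F : List Edge), e ∈ trimEdges^[n] F → e ∈ F := by
    intro n
    induction n with
    | zero => exact fun F hF => hF
    | succ n ih => exact fun F hF => (List.mem_filter.1 (ih _ hF)).1
  exact key _ _ h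

/-- The states of the upper transducer are less than 4, so a composed state is recovered by quotient
and remainder modulo 4. The intermediate row can then be chosen cell by cell. -/
theorem Run.unstack {E : List Edge} {c : Fin 2} {r r'' : ℤ → ℕ}
    (h : Run (stackEdges E (tileEdges c)) r r'') :
    ∃ r', Run E r r' ∧ Run (tileEdges c) r' r'' := by
  have h4 : ∀ c : Fin 2, ∀ e ∈ tileEdges c, e.1 < 4 ∧ e.2.1 < 4 := by decide
  obtain ⟨h, H⟩ := h
  have : ∀ x, ∃ d, (h x / 4, h (x + 1) / 4, r x, d) ∈ E ∧
      (h x % 4, h (x + 1) % 4, d, r'' x) ∈ tileEdges c := by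
    intro x
    have := mem_of_mem_stackEdges (H x)
    simp only [compEdges, List.mem_flatMap, List.mem_map, List.mem_filter, beq_iff_eq] at this
    obtain ⟨⟨a1, a2, a3, a4⟩, ha, ⟨b1, b2, b3, b4⟩, ⟨hb, rfl⟩, e⟩ := this
    have := h4 c _ hb
    simp only [Prod.mk.injEq] at e this
    obtain ⟨e1, e2, e3, e4⟩ := e
    refine ⟨a4, ?_, ?_⟩
    · rw [← e1, ← e2, ← e3, show (4 * a1 + b1) / 4 = a1 by omega,
        show (4 * a2 + b2) / 4 = a2 by omega]
      exact ha
    · rw [← e1, ← e2, ← e4, show (4 * a1 + b1) % 4 = b1 by omega,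
        show (4 * a2 + b2) % 4 = b2 by omega]
      exact hb
  choose r' hr using this
  exact ⟨r', ⟨_, fun x => (hr x).1⟩, ⟨_, fun x => (hr x).2⟩⟩

theorem Run.of_subset {E E' : List Edge} {r r' : ℤ → ℕ} (h : Run E r r') (hE : ∀ e ∈ E, e ∈ E') :
    Run E' r r' := by
  obtain ⟨h, H⟩ := h
  exact ⟨h, fun x => hE _ (H x)⟩

/-- The components given by a word relate a row to another one. -/
def RunWord : List (Fin 2) → (ℤ → ℕ) → (ℤ → ℕ) → Prop
  | [], r, r' => r = r'
  | c :: w, r, r' => ∃ r₁, Run (tileEdges c) r r₁ ∧ RunWord w r₁ r'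

theorem RunWord.append {w w' : List (Fin 2)} {r r' r'' : ℤ → ℕ} (h : RunWord w r r')
    (h' : RunWord w' r' r'') : RunWord (w ++ w') r r'' := by
  induction w generalizing r with
  | nil => rw [RunWord] at h; subst h; exact h'
  | cons c w ih =>
    obtain ⟨r₁, h1, h2⟩ := h
    exact ⟨r₁, h1, ih h2⟩

theorem RunWord.shift {w : List (Fin 2)} {r r' : ℤ → ℕ} (h : RunWord w r r') (a : ℤ) :
    RunWord w (fun x => r (x + a)) (fun x => r' (x + a)) := by
  induction w generalizing r with
  | nil => rw [RunWord] at h; subst h; rfl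
  | cons c w ih =>
    obtain ⟨r₁, ⟨h, H⟩, h2⟩ := h
    refine ⟨_, ⟨fun x => h (x + a), fun x => ?_⟩, ih h2⟩
    have := H (x + a)
    rwa [add_right_comm] at this

theorem runWord_one {r r' : ℤ → ℕ} (h : Run edgesA r r') : RunWord (levelWord 1) r r' := by
  obtain ⟨r4, h, h5⟩ := (h.of_subset (E' := stackEdges (stackEdges (stackEdges (stackEdges
    (tileEdges 1) (tileEdges 0)) (tileEdges 0)) (tileEdges 0)) (tileEdges 0))
    (by decide +kernel)).unstack
  obtain ⟨r3, h, h4⟩ := h.unstack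
  obtain ⟨r2, h, h3⟩ := h.unstack
  obtain ⟨r1, h1, h2⟩ := h.unstack
  exact ⟨_, h1, _, h2, _, h3, _, h4, _, h5, rfl⟩

theorem runWord_two {r r' : ℤ → ℕ} (h : Run edgesB' r r') : RunWord (levelWord 2) r r' := by
  obtain ⟨r3, h, h4⟩ := (h.of_subset (E' := stackEdges (stackEdges (stackEdges
    (tileEdges 1) (tileEdges 0)) (tileEdges 0)) (tileEdges 0)) (by decide +kernel)).unstack
  obtain ⟨r2, h, h3⟩ := h.unstack
  obtain ⟨r1, h1, h2⟩ := h.unstack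
  exact ⟨_, h1, _, h2, _, h3, _, h4, rfl⟩

/-- On a path of the lowest level the rows agree up to a translation. -/
theorem LevelPath.eq_of_zero {V : ℤ → Block → Prop} {d d' : ℤ → Bool} (h : LevelPath 0 V d d')
    (x : ℤ) : d x = d' (x + 2) := by
  have hn := h.noMix (by norm_num)
  have hV : IsPath 2 3 V := h.path
  have h1 : d x = true ↔ _ := (h.inRow x).trans (covered_true x)
  have h2 : d' (x + 2) = false ↔ _ := (h.outRow (x + 2)).trans (covered_false (x + 2))
  simp only [InMark, OutMark, iff_false_intro (hn _), or_false, lenSeq] at h1 h2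
  obtain ⟨z, b, hb, l1, l2⟩ := hV.cover (by norm_num) (by norm_num) x
  have key : ∀ y c, V y c → y ≤ x → x < y + c.len 2 3 → y = z ∧ c = b := by
    intro y c hc l3 l4
    rcases le_total y z with h3 | h3
    · exact (hV.sep hc hb h3).resolve_right (by omega)
    · exact ((hV.sep hb hc h3).resolve_right (by omega)).imp Eq.symm Eq.symm
  obtain ⟨i, rfl⟩ := Int.le.dest l1
  cases b
  · have : d (z + i) = true := h1.2 (by
      rcases (show i = 0 ∨ i = 1 by simp at l2; omega) with rfl | rfl <;> simp [hb])
    rw [this]; symm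
    rw [← Bool.not_eq_false, h2]
    rintro (h | h | h | h | h) <;> have := (key _ _ h (by omega) (by simp <;> omega)).2 <;> simp at this
  · have : d (z + i) = true := h1.2 (by
      rcases (show i = 0 ∨ i = 1 ∨ i = 2 by simp at l2; omega) with rfl | rfl | rfl <;> simp [hb])
    rw [this]; symm
    rw [← Bool.not_eq_false, h2]
    rintro (h | h | h | h | h) <;> have := (key _ _ h (by omega) (by simp <;> omega)).2 <;> simp at this
  · have : d' (z + i + 2) = false := h2.2 (by
      rcases (show i = 0 ∨ i = 1 by simp at l2; omega) with rfl | rfl <;> ring_nf <;> simp [hb])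
    rw [this]
    rw [← Bool.not_eq_true, h1]
    rintro (h | h | h | h | h) <;> have := (key _ _ h (by omega) (by simp <;> omega)).2 <;> simp at this
  · have : d' (z + i + 2) = false := h2.2 (by
      rcases (show i = 0 ∨ i = 1 ∨ i = 2 by simp at l2; omega) with rfl | rfl | rfl <;> ring_nf <;> simp [hb])
    rw [this]
    rw [← Bool.not_eq_true, h1]
    rintro (h | h | h | h | h) <;> have := (key _ _ h (by omega) (by simp <;> omega)).2 <;> simp at this
  · exact (hn _ hb).elim

theorem exists_isRow (c : Bool) (M : ℤ → Bool → Prop) : ∃ d, IsRow c M d := by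
  classical
  refine ⟨fun x => if ∃ y t, M y t ∧ Covers c y t x then c else !c, fun x => ?_⟩
  dsimp only
  split_ifs with h
  · exact ⟨fun _ => h, fun _ => rfl⟩
  · cases c <;> simpa using h

/-- The rows related by a block path without mixed blocks are related by a strip of tiles. -/
theorem LevelPath.exists_runWord (k : ℕ) {V : ℤ → Block → Prop} {d d' : ℤ → Bool}
    (h : LevelPath k V d d') (hn : NoMix V) :
    ∃ s, RunWord (levelWord k) (digitRow d) (digitRow fun x => d' (x + s)) := by
  induction k using Nat.strong_induction_on generalizing V d d' with
  | _ k ih =>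
    match k with
    | 0 => exact ⟨2, funext fun x => by simp only [digitRow, h.eq_of_zero]⟩
    | 1 =>
      refine ⟨5, ?_⟩
      convert (runWord_one (h.path.run_edgesA hn h.inRow h.outRow)).shift 2 using 2 <;>
        simp only [digitRow] <;> ring_nf
    | 2 =>
      refine ⟨6, ?_⟩
      convert (runWord_two (h.path.run_edgesB hn h.inRow h.outRow)).shift 2 using 2 <;>
        simp only [digitRow] <;> ring_nf
    | k + 3 =>
      obtain ⟨hp, hpq, -⟩ := lenSeq_ineq k
      have hW := h.path
      have hin := h.inRow
      have hout := h.outRow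
      rw [lenSeq_add_four, lenSeq_add_three] at hW hin hout
      simp only [polarity, Bool.not_not] at hin hout
      -- The substitutions give pure paths of levels `k + 1`, `k`, `k + 1` with matching marks. The
      -- two intermediate rows are defined by the marks of the middle path.
      have h₁ := substFirst_isPath hW hn hp hpq
      have h₀ := substMiddle_isPath hW hn hp hpq
      have h₂ := substLast_isPath hW hn hp hpq
      obtain ⟨d₁, hd₁⟩ := exists_isRow (polarity k) (InMark (lenSeq k) (lenSeq (k + 1))
        (substitute (lenSeq k) (lenSeq (k + 1)) substMiddle V))
      obtain ⟨d₂, hd₂⟩ := exists_isRow (!polarity k) (OutMark (lenSeq k) (lenSeq (k + 1))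
        (substitute (lenSeq k) (lenSeq (k + 1)) substMiddle V))
      obtain ⟨s₁, r₁⟩ := ih (k + 1) (by omega) (V := substitute (lenSeq (k + 1))
        (lenSeq k + lenSeq (k + 1)) substFirst V) (d := d) (d' := d₁)
        ⟨h₁, hin.congr fun x t => (substFirst_inMark hn x t).symm, by
          simp only [polarity, Bool.not_not]
          exact hd₁.congr fun x t => (substFirst_outMark hW hn x t).symm, fun _ => noMix_substFirst⟩
        noMix_substFirst
      obtain ⟨s₀, r₀⟩ := ih k (by omega) (V := substitute (lenSeq k) (lenSeq (k + 1))
        substMiddle V) ⟨h₀, hd₁, hd₂, fun _ => noMix_substMiddle⟩ noMix_substMiddle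
      obtain ⟨s₂, r₂⟩ := ih (k + 1) (by omega) (V := substitute (lenSeq (k + 1))
        (lenSeq k + lenSeq (k + 1)) substLast V) (d := d₂) (d' := d')
        ⟨h₂, hd₂.congr (substMiddle_outMark hW hn), by
          simp only [polarity, Bool.not_not]
          exact hout.congr fun x t => (substLast_outMark hn x t).symm, fun _ => noMix_substLast⟩
        noMix_substLast
      refine ⟨s₂ + s₀ + s₁, ?_⟩
      rw [levelWord]
      refine (r₁.append (r₀.shift s₁)).append ?_
      convert r₂.shift (s₀ + s₁) using 2 <;> simp only [digitRow] <;> ring_nf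

/-- The periodic path of short output blocks. -/
theorem isPath_outS {p q : ℤ} (hp : 0 < p) :
    IsPath p q (fun x b => p ∣ x ∧ b = .outS) ∧ NoMix (fun x b => p ∣ x ∧ b = .outS) := by
  refine ⟨⟨⟨0, .outS, by simp⟩, ?_, ?_, ?_⟩, fun x h => by simp at h⟩
  · rintro x b ⟨h, rfl⟩
    exact ⟨.outS, by simpa using h, rfl⟩
  · rintro x b ⟨h, rfl⟩
    exact ⟨.outS, by simpa using h, rfl⟩
  · rintro _ b _ c ⟨⟨x, rfl⟩, rfl⟩ ⟨⟨y, rfl⟩, rfl⟩ h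
    rcases h.eq_or_lt with h | h
    · exact Or.inl ⟨h, rfl⟩
    · right
      have : x < y := lt_of_mul_lt_mul_left h hp.le
      simp only [Block.len_outS]
      nlinarith

/-- Any path without `mix` will do. The simplest one, available at every level, consists of blocks
`outS` only. -/
theorem exists_runWord_levelWord (k : ℕ) : ∃ r r', RunWord (levelWord k) r r' := by
  obtain ⟨hV, hn⟩ := isPath_outS (q := lenSeq (k + 1)) (lenSeq_ineq k).1
  obtain ⟨d, hd⟩ := exists_isRow (polarity k) (InMark (lenSeq k) (lenSeq (k + 1))
    fun x b => lenSeq k ∣ x ∧ b = .outS)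
  obtain ⟨d', hd'⟩ := exists_isRow (!polarity k) (OutMark (lenSeq k) (lenSeq (k + 1))
    fun x b => lenSeq k ∣ x ∧ b = .outS)
  obtain ⟨s, h⟩ := LevelPath.exists_runWord k ⟨hV, hd, hd', fun _ => hn⟩ hn
  exact ⟨_, _, h⟩

theorem RunWord.of_append {w w' : List (Fin 2)} {r r'' : ℤ → ℕ} (h : RunWord (w ++ w') r r'') :
    ∃ r', RunWord w r r' ∧ RunWord w' r' r'' := by
  induction w generalizing r with
  | nil => exact ⟨r, rfl, h⟩
  | cons c w ih =>
    obtain ⟨r₁, h1, h2⟩ := h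
    obtain ⟨r', h3, h4⟩ := ih h2
    exact ⟨r', ⟨r₁, h1, h3⟩, h4⟩

/-! ### Compactness: tilings from strips -/

/-- The factor of `u` of length `n` at `y`. -/
def factorAt (u : ℤ → Fin 2) : ℤ → ℕ → List (Fin 2)
  | _, 0 => []
  | y, n + 1 => u y :: factorAt u (y + 1) n

theorem Run.exists_tiles {c : Fin 2} {r r' : ℤ → ℕ} (h : Run (tileEdges c) r r') :
    ∃ t : ℤ → WangTile (Fin 4) (Fin 5), ∀ x, t x ∈ wangComponent c ∧ (t x).e = (t (x + 1)).w ∧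
      ((t x).s : ℕ) = r x ∧ ((t x).n : ℕ) = r' x := by
  have hb : ∀ c : Fin 2, ∀ e ∈ tileEdges c, e.1 < 4 ∧ e.2.1 < 4 ∧ e.2.2.1 < 5 ∧ e.2.2.2 < 5 := by
    decide
  obtain ⟨h, H⟩ := h
  have H' := fun x => hb c _ (H x)
  exact ⟨fun x => ⟨⟨h x, (H' x).1⟩, ⟨h (x + 1), (H' x).2.1⟩, ⟨r x, (H' x).2.2.1⟩,
    ⟨r' x, (H' x).2.2.2⟩⟩, fun x => ⟨mem_tileEdges.2 (H x), rfl, rfl, rfl⟩⟩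

theorem RunWord.exists_tiles {u : ℤ → Fin 2} {y : ℤ} {n : ℕ} {r r' : ℤ → ℕ}
    (h : RunWord (factorAt u y n) r r') : ∃ f : ℤ → ℤ → WangTile (Fin 4) (Fin 5),
      (∀ x z, y ≤ z → z < y + n → f x z ∈ wangComponent (u z)) ∧
      (∀ x z, y ≤ z → z < y + n → (f x z).e = (f (x + 1) z).w) ∧
      (∀ x z, y ≤ z → z + 1 < y + n → (f x z).n = (f x (z + 1)).s) ∧
      (0 < n → ∀ x, ((f x y).s : ℕ) = r x) := by
  induction n generalizing y r with
  | zero => exact ⟨fun _ _ => ⟨0, 0, 0, 0⟩, fun _ _ _ _ => by simp at *; omega,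
      fun _ _ _ _ => rfl, fun _ _ _ _ => rfl, fun h => by omega⟩
  | succ n ih =>
    obtain ⟨r₁, h1, h2⟩ := h
    obtain ⟨t, ht⟩ := h1.exists_tiles
    obtain ⟨f, f1, f2, f3, f4⟩ := ih h2
    push_cast
    refine ⟨fun x z => if z = y then t x else f x z, fun x z l1 l2 => ?_, fun x z l1 l2 => ?_,
      fun x z l1 l2 => ?_, fun _ x => ?_⟩
    · dsimp only
      split_ifs with hz
      · rw [hz]; exact (ht x).1
      · exact f1 x z (by omega) (by omega)
    · dsimp only
      split_ifs with hz
      · exact (ht x).2.1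
      · exact f2 x z (by omega) (by omega)
    · dsimp only
      rw [if_neg (show z + 1 ≠ y by omega)]
      split_ifs with hz
      · rw [hz, Fin.ext_iff, (ht x).2.2.2, f4 (by omega)]
      · exact f3 x z (by omega) (by omega)
    · simp [(ht x).2.2.1]

theorem wangComponent_subset (c : Fin 2) : wangComponent c ⊆ wangT := by
  rw [wangComponent]
  split_ifs
  · exact Set.subset_union_left
  · exact Set.subset_union_right

theorem wangComponent_finite (c : Fin 2) : (wangComponent c).Finite := by
  rw [wangComponent]
  split_ifs
  · simp [wangT0]
  · simp [wangT1]

/-- A word represents a tiling if its finite factors do. -/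
theorem representsTiling_of_factors {u : ℤ → Fin 2}
    (h : ∀ n : ℕ, ∃ r r', RunWord (factorAt u (-n) (2 * n)) r r') : RepresentsTiling u := by
  have H := fun n => (h n).choose_spec.choose_spec.exists_tiles
  choose F F1 F2 F3 _ using H
  -- Compactness by an ultrafilter: each cell has finitely many possible tiles, so one of them
  -- occurs for almost all strips, and a condition on two adjacent cells passes to this limit.
  set U := Filter.hyperfilter ℕ
  have ev : ∀ m : ℕ, ∀ᶠ n in (U : Filter ℕ), m < n := fun m =>
    Nat.hyperfilter_le_atTop (Filter.eventually_gt_atTop m)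
  have lim : ∀ x y, ∃ t ∈ wangComponent (u y), ∀ᶠ n in (U : Filter ℕ), F n x y = t := by
    intro x y
    rw [← Ultrafilter.eventually_exists_mem_iff (wangComponent_finite _)]
    filter_upwards [ev y.natAbs] with n hn
    exact ⟨_, F1 n x y (by omega) (by omega), rfl⟩
  choose f hf hF using lim
  refine ⟨f, ⟨fun x y => wangComponent_subset _ (hf x y), fun x y => ?_, fun x y => ?_⟩, hf⟩
  · obtain ⟨n, ⟨h1, h2⟩, h3⟩ := (((hF x y).and (hF (x + 1) y)).and (ev y.natAbs)).exists
    rw [← h1, ← h2]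
    exact F2 n x y (by omega) (by omega)
  · obtain ⟨n, ⟨h1, h2⟩, h3⟩ := (((hF x y).and (hF x (y + 1))).and (ev (y.natAbs + 1))).exists
    rw [← h1, ← h2]
    exact F3 n x y (by omega) (by omega)

/-! ### Factors of Sturmian words lie in level words -/

/-- The factors of a Sturmian word are coded by intervals of phases. -/
theorem IsSturmian.exists_codes {α : ℝ} {u : ℤ → Fin 2} (h : IsSturmian α u) (y : ℤ) (n : ℕ) :
    ∃ a b, a < b ∧ ∀ z, a < z → z < b → Codes α z (factorAt u y n) := by
  obtain ⟨-, ρ, h | h⟩ := h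
  · have key : ∃ ε > 0, ∀ t, 0 ≤ t → t < ε →
        Codes α (y * α + ρ - ⌊y * α + ρ⌋ + t) (factorAt u y n) := by
      induction n generalizing y with
      | zero =>
        have h1 := Int.floor_le (y * α + ρ)
        have h2 := Int.lt_floor_add_one (y * α + ρ)
        exact ⟨1 - (y * α + ρ - ⌊y * α + ρ⌋), by linarith, fun t _ _ => ⟨by linarith, by linarith⟩⟩
      | succ n ih =>
        have h1 := Int.floor_le (y * α + ρ)
        have h2 := Int.lt_floor_add_one (y * α + ρ)
        obtain ⟨ε, h3, h4⟩ := ih (y + 1)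
        refine ⟨min ε (1 - (y * α + ρ - ⌊y * α + ρ⌋)), lt_min h3 (by linarith), fun t h5 h6 => ?_⟩
        obtain ⟨h6, h7⟩ := lt_min_iff.1 h6
        refine ⟨⟨by linarith, by linarith⟩, ?_⟩
        convert h4 t h5 h6 using 1
        have hu : (((u y : ℕ) : ℤ) : ℝ) = _ := congrArg _ (h y)
        push_cast at hu ⊢
        rw [hu]; ring
    obtain ⟨ε, h1, h2⟩ := key
    refine ⟨_, y * α + ρ - ⌊y * α + ρ⌋ + ε, lt_add_of_pos_right _ h1, fun z h3 h4 => ?_⟩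
    have := h2 (z - (y * α + ρ - ⌊y * α + ρ⌋)) (by linarith) (by linarith)
    simpa using this
  -- For an upper mechanical word the natural phase lies in the half-open interval from 0 to 1 that
  -- contains 1, so it is lowered by a positive `t`. In the lower case it is raised, and `t = 0` is
  -- allowed.
  · have key : ∃ ε > 0, ∀ t, 0 < t → t < ε →
        Codes α (y * α + ρ - ⌈y * α + ρ⌉ + 1 - t) (factorAt u y n) := by
      induction n generalizing y with
      | zero =>
        have h1 := Int.le_ceil (y * α + ρ)
        have h2 := Int.ceil_lt_add_one (y * α + ρ)
        exact ⟨y * α + ρ - ⌈y * α + ρ⌉ + 1, by linarith, fun t _ _ => ⟨by linarith, by linarith⟩⟩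
      | succ n ih =>
        have h1 := Int.le_ceil (y * α + ρ)
        have h2 := Int.ceil_lt_add_one (y * α + ρ)
        obtain ⟨ε, h3, h4⟩ := ih (y + 1)
        refine ⟨min ε (y * α + ρ - ⌈y * α + ρ⌉ + 1), lt_min h3 (by linarith), fun t h5 h6 => ?_⟩
        obtain ⟨h6, h7⟩ := lt_min_iff.1 h6
        refine ⟨⟨by linarith, by linarith⟩, ?_⟩
        convert h4 t h5 h6 using 1
        have hu : (((u y : ℕ) : ℤ) : ℝ) = _ := congrArg _ (h y)
        push_cast at hu ⊢
        rw [hu]; ring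
    obtain ⟨ε, h1, h2⟩ := key
    refine ⟨y * α + ρ - ⌈y * α + ρ⌉ + 1 - ε, _, sub_lt_self _ h1, fun z h3 h4 => ?_⟩
    have := h2 (y * α + ρ - ⌈y * α + ρ⌉ + 1 - z) (by linarith) (by linarith)
    simpa using this

/-- The multiples of an irrational number are dense modulo `1`. -/
theorem Irrational.exists_nat_mul_add {α : ℝ} (hα : Irrational α) {a b : ℝ} (hab : a < b) :
    ∃ (i : ℕ) (m : ℤ), a < i * α + m ∧ i * α + m < b := by
  obtain ⟨n, hn⟩ := exists_nat_gt (1 / (b - a))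
  have hba := sub_pos.2 hab
  have hn0 : 0 < n := by
    have : (0 : ℝ) < n := (by positivity : 0 < 1 / (b - a)).trans hn
    exact_mod_cast this
  obtain ⟨k, hk, -, hd⟩ := Real.exists_nat_abs_mul_sub_round_le α hn0
  set j := round (k * α)
  have hlt : |k * α - j| < b - a := hd.trans_lt (by
    rw [div_lt_iff₀ (by positivity)]
    rw [div_lt_iff₀ hba] at hn
    nlinarith)
  have hne : k * α - j ≠ 0 := ((hα.natCast_mul hk.ne').sub_intCast j).ne_zero
  -- By Dirichlet's theorem `k * α - j` is a nonzero step shorter than the interval. Steps from the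
  -- integer `⌈b⌉` downwards, or from `⌊a⌋` upwards, therefore land in the interval.
  rcases hne.lt_or_gt with h | h
  · have h1 : 0 ≤ (⌈b⌉ - b) / (j - k * α) := div_nonneg (by linarith [Int.le_ceil b]) (by linarith)
    have h2 := Nat.floor_le h1
    have h3 := Nat.lt_floor_add_one ((⌈b⌉ - b) / (j - k * α))
    rw [le_div_iff₀ (by linarith)] at h2
    rw [div_lt_iff₀ (by linarith)] at h3
    rw [abs_of_neg h] at hlt
    refine ⟨(⌊(⌈b⌉ - b) / (j - k * α)⌋₊ + 1) * k, ⌈b⌉ - (⌊(⌈b⌉ - b) / (j - k * α)⌋₊ + 1) * j, ?_, ?_⟩ <;>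
      push_cast <;> linarith
  · have h1 : 0 ≤ (a - ⌊a⌋) / (k * α - j) := div_nonneg (by linarith [Int.floor_le a]) (by linarith)
    have h2 := Nat.floor_le h1
    have h3 := Nat.lt_floor_add_one ((a - ⌊a⌋) / (k * α - j))
    rw [le_div_iff₀ (by linarith)] at h2
    rw [div_lt_iff₀ (by linarith)] at h3
    rw [abs_of_pos h] at hlt
    refine ⟨(⌊(a - ⌊a⌋) / (k * α - j)⌋₊ + 1) * k, ⌊a⌋ - (⌊(a - ⌊a⌋) / (k * α - j)⌋₊ + 1) * j, ?_, ?_⟩ <;>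
      push_cast <;> linarith

/-- A word coded by an interval of phases is a factor of a word of some level. -/
theorem exists_levelWord_eq {a b : ℝ} {w : List (Fin 2)} (hab : a < b)
    (h : ∀ z, a < z → z < b → Codes sturmSlope z w) : ∃ k w₁ w₂, levelWord k = w₁ ++ (w ++ w₂) := by
  obtain ⟨i, m, h1, h2⟩ := sturmSlope_irrational.exists_nat_mul_add
    (a := a - (1 - sturmSlope)) (b := b - (1 - sturmSlope)) (by linarith)
  -- The level is odd, so its interval of phases starts at `1 - sturmSlope` however large it is, and
  -- its word has room for `w` after `i` letters.
  set k := 2 * (i + w.length) + 1 with hk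
  have hl := le_length_levelWord k
  have e : levelWord k = (levelWord k).take i ++ (((levelWord k).drop i).take w.length ++
    ((levelWord k).drop i).drop w.length) := by simp
  have l1 : ((levelWord k).take i).length = i := by simp; omega
  have l2 : (((levelWord k).drop i).take w.length).length = w.length := by simp; omega
  have c := (levelWord_codes k).1 (1 - sturmSlope) (by rw [phaseStart, if_pos (by omega)])
    (by rw [phaseStart, if_pos (by omega)]; linarith [phaseLen_pos k])
  rw [e] at c
  have c' := (codes_append.1 (codes_append.1 c).2).1
  rw [endPhase_eq, l1] at c'
  have c0 := h (1 - sturmSlope + i * sturmSlope + m) (by linarith) (by linarith)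
  have b1 := c'.head
  have b2 := c0.head
  -- Both phases lie in [0, 1) and differ by an integer, hence are equal.
  have hm : m = -(wordSum ((levelWord k).take i) : ℤ) := by
    have a1 : (m : ℝ) < ((1 - wordSum ((levelWord k).take i) : ℤ) : ℝ) := by push_cast; linarith
    have a2 : ((-1 - wordSum ((levelWord k).take i) : ℤ) : ℝ) < (m : ℝ) := by push_cast; linarith
    have a1 := Int.cast_lt.1 a1
    have a2 := Int.cast_lt.1 a2
    omega
  rw [hm] at c0
  push_cast at c0
  rw [← sub_eq_add_neg] at c0
  rw [c'.unique c0 l2] at e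
  exact ⟨k, _, _, e⟩

theorem IsSturmian.representsTiling {u : ℤ → Fin 2} (h : IsSturmian sturmSlope u) :
    RepresentsTiling u := by
  refine representsTiling_of_factors fun n => ?_
  obtain ⟨a, b, hab, hc⟩ := h.exists_codes (-n) (2 * n)
  obtain ⟨k, w₁, w₂, e⟩ := exists_levelWord_eq hab hc
  obtain ⟨r, r', hr⟩ := exists_runWord_levelWord k
  rw [e] at hr
  obtain ⟨r₁, -, hr⟩ := hr.of_append
  obtain ⟨r₂, hr, -⟩ := hr.of_append
  exact ⟨_, _, hr⟩

/-! ### Rows of tilings and aperiodicity -/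

/-- The colour 2 on the west edge identifies the second component, and it occurs on the west edge
exactly when it occurs on the east edge. It is therefore constant along rows. -/
theorem mem_wangComponent_iff {t : WangTile (Fin 4) (Fin 5)} (h : t ∈ wangT) (c : Fin 2) :
    (t ∈ wangComponent c ↔ (c = 1 ↔ t.w = 2)) ∧ (t.w = 2 ↔ t.e = 2) := by
  rcases RowSeq.eq_zero_or_one c with rfl | rfl
  · rw [wangComponent, if_pos rfl]
    rcases h with h | h
    · refine ⟨⟨fun _ => ?_, fun _ => h⟩, ?_⟩ <;> simp only [wangT0, Set.mem_insert_iff,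
        Set.mem_singleton_iff] at h <;>
      rcases h with rfl | rfl | rfl | rfl | rfl | rfl | rfl | rfl | rfl <;> decide
    · simp only [wangT1, Set.mem_insert_iff, Set.mem_singleton_iff] at h
      rcases h with rfl | rfl <;> simp [wangT0]
  · rw [wangComponent, if_neg (by decide)]
    rcases h with h | h
    · simp only [wangT0, Set.mem_insert_iff, Set.mem_singleton_iff] at h
      rcases h with rfl | rfl | rfl | rfl | rfl | rfl | rfl | rfl | rfl <;> simp [wangT1]
    · refine ⟨⟨fun _ => ?_, fun _ => h⟩, ?_⟩ <;> simp only [wangT1, Set.mem_insert_iff,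
        Set.mem_singleton_iff] at h <;> rcases h with rfl | rfl <;> decide

theorem wangComponent_unique {t : WangTile (Fin 4) (Fin 5)} {c c' : Fin 2}
    (h : t ∈ wangComponent c) (h' : t ∈ wangComponent c') : c = c' := by
  have a := (mem_wangComponent_iff (wangComponent_subset _ h) c).1.1 h
  have b := (mem_wangComponent_iff (wangComponent_subset _ h) c').1.1 h'
  rcases RowSeq.eq_zero_or_one c with rfl | rfl <;> rcases RowSeq.eq_zero_or_one c' with rfl | rfl <;>
    simp_all

namespace IsTiling

variable {f : ℤ → ℤ → WangTile (Fin 4) (Fin 5)}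

/-- Every row of a tiling lies in one component. -/
theorem exists_word (hf : IsTiling wangT f) : ∃ u : ℤ → Fin 2, ∀ x y, f x y ∈ wangComponent (u y) := by
  obtain ⟨h1, h2, -⟩ := hf
  have step : ∀ x y, (f x y).w = 2 ↔ (f (x + 1) y).w = 2 := fun x y => by
    rw [← h2, (mem_wangComponent_iff (h1 x y) 0).2]
  have all : ∀ x y, (f x y).w = 2 ↔ (f 0 y).w = 2 := by
    intro x y
    induction x using Int.induction_on with
    | zero => rfl
    | succ n ih => rw [← step, ih]
    | pred n ih => rw [step, sub_add_cancel, ih]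
  refine ⟨fun y => if (f 0 y).w = 2 then 1 else 0, fun x y => ?_⟩
  rw [(mem_wangComponent_iff (h1 x y) _).1, all]
  dsimp only
  split_ifs with h <;> simp [h]

theorem rowSeq (hf : IsTiling wangT f) {u : ℤ → Fin 2} (hu : ∀ x y, f x y ∈ wangComponent (u y)) :
    RowSeq u (fun y x => ((f x y).s : ℕ)) := by
  refine ⟨fun y => ⟨fun x => ((f x y).w : ℕ), fun x => ?_⟩⟩
  have := mem_tileEdges.1 (hu x y)
  rwa [hf.2.1, hf.2.2] at this

theorem isSturmian (hf : IsTiling wangT f) {u : ℤ → Fin 2} (hu : ∀ x y, f x y ∈ wangComponent (u y)) :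
    IsSturmian sturmSlope u := (hf.rowSeq hu).isSturmian

/-- A tiling has no vertical period. -/
theorem not_vertical_period (hf : IsTiling wangT f) {a : ℤ} {b : ℕ} (hb : 0 < b)
    (h : ∀ x y, f x y = f (x + a) (y + b)) : False := by
  obtain ⟨u, hu⟩ := hf.exists_word
  obtain ⟨C, hC⟩ := exists_isCount u
  have bal := (hf.rowSeq hu).balanced hC
  have per : ∀ y, u (y + b) = u y := fun y =>
    wangComponent_unique (hu (0 + a) (y + b)) (by rw [← h]; exact hu 0 y)
  have diff : ∀ y, C (y + b) - C y = C b - C 0 := by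
    intro y
    induction y using Int.induction_on with
    | zero => simp
    | succ n ih =>
      have h1 := hC n
      have h2 := hC (n + b)
      rw [per] at h2
      rw [add_right_comm]; omega
    | pred n ih =>
      have h1 := hC (-n - 1)
      have h2 := hC (-n - 1 + b)
      rw [per] at h2
      rw [sub_add_cancel] at h1
      rw [show (-n - 1 + b + 1 : ℤ) = -n + b by ring] at h2
      omega
  have mult : ∀ n : ℕ, C ((n * b : ℕ) : ℤ) - C 0 = n * (C b - C 0) := by
    intro n
    induction n with
    | zero => simp
    | succ n ih =>
      have := diff ((n * b : ℕ) : ℤ)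
      push_cast at this ih ⊢
      rw [add_mul, one_mul]
      linarith
  -- Over `n` periods the deviation from the slope is `n` times that over one period, which is
  -- nonzero by irrationality. For large `n` this contradicts balance.
  have hne : ((C b - C 0 : ℤ) : ℝ) - b * sturmSlope ≠ 0 :=
    ((sturmSlope_irrational.natCast_mul hb.ne').intCast_sub _).ne_zero
  obtain ⟨n, hn⟩ := exists_nat_gt (1 / |((C b - C 0 : ℤ) : ℝ) - b * sturmSlope|)
  have h1 := bal 0 (n * b)
  rw [zero_add, ← Int.cast_sub, mult] at h1
  rw [div_lt_iff₀ (abs_pos.2 hne)] at hn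
  have h2 : ((n * (C b - C 0) : ℤ) : ℝ) - (n * b : ℕ) * sturmSlope =
      n * (((C b - C 0 : ℤ) : ℝ) - b * sturmSlope) := by push_cast; ring
  rw [h2, abs_mul, Nat.abs_cast] at h1
  linarith

/-- A tiling has no horizontal period. -/
theorem not_horizontal_period (hf : IsTiling wangT f) {a : ℕ} (ha : 0 < a)
    (h : ∀ x y, f x y = f (x + a) y) : False := by
  have per : ∀ (n x y : ℤ), f (x + n * a) y = f x y := by
    intro n x y
    induction n using Int.induction_on with
    | zero => simp
    | succ n ih => rw [← ih, h (x + n * a) y]; congr 1; ring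
    | pred n ih => rw [← ih, h (x + (-n - 1) * a) y]; congr 1; ring
  have red : ∀ x y, f x y = f (x % a) y := fun x y => by
    rw [← per (x / a) (x % a) y, mul_comm, Int.emod_add_mul_ediv]
  have fin : wangT.Finite := by
    simpa [wangT, wangComponent] using (wangComponent_finite 0).union (wangComponent_finite 1)
  have := fin.to_subtype
  -- A row is determined by its first `a` tiles, so among infinitely many rows two coincide.
  obtain ⟨y, y', hne, e⟩ := Finite.exists_ne_map_eq_of_infinite
    (fun (y : ℤ) (i : Fin a) => (⟨f i y, hf.1 i y⟩ : wangT))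
  have rows : ∀ x, f x y = f x y' := fun x => by
    have h1 := Int.emod_nonneg x (show (a : ℤ) ≠ 0 by omega)
    have h2 := Int.emod_lt_of_pos x (show (0 : ℤ) < a by omega)
    have := congrFun e ⟨(x % a).toNat, by omega⟩
    simp only [Subtype.mk.injEq, Int.toNat_of_nonneg h1] at this
    rw [red x y, red x y', this]
  have key : ∀ (y : ℤ) (b : ℕ), 0 < b → (∀ x, f x y = f x (y + b)) → False := by
    intro y b hb e
    -- The strip between two equal rows, repeated vertically, is a tiling with the vertical period
    -- `b`.
    have T : IsTiling wangT (fun x z => f x (y + z % b)) := by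
      refine ⟨fun x z => hf.1 _ _, fun x z => hf.2.1 _ _, fun x z => ?_⟩
      rw [hf.2.2]
      have h1 := Int.emod_lt_of_pos z (show (0 : ℤ) < b by omega)
      have h2 := Int.emod_nonneg z (show (b : ℤ) ≠ 0 by omega)
      dsimp only
      rw [← Int.emod_add_emod z b 1, add_assoc]
      rcases (show z % b + 1 < b ∨ z % b + 1 = b by omega) with h3 | h3
      · rw [Int.emod_eq_of_lt (by omega) h3]
      · rw [h3, Int.emod_self, add_zero, e]
    exact T.not_vertical_period (a := 0) hb fun x z => by simp
  rcases hne.lt_or_gt with h3 | h3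
  · refine key y (y' - y).toNat (by omega) fun x => ?_
    rw [rows]; congr 1; omega
  · refine key y' (y - y').toNat (by omega) fun x => ?_
    rw [← rows]; congr 1; omega

theorem not_isPeriodicTiling (hf : IsTiling wangT f) : ¬ IsPeriodicTiling f := by
  rintro ⟨a, b, hne, h⟩
  have h' : ∀ x y, f x y = f (x + -a) (y + -b) := fun x y => by rw [h (x + -a)]; simp
  rcases lt_trichotomy b 0 with hb | rfl | hb
  · obtain ⟨n, hn⟩ := Int.eq_ofNat_of_zero_le (show 0 ≤ -b by omega)
    rw [hn] at h'
    exact hf.not_vertical_period (by omega) h'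
  · simp only [neg_zero, add_zero] at h h'
    rcases lt_trichotomy a 0 with ha | rfl | ha
    · obtain ⟨n, hn⟩ := Int.eq_ofNat_of_zero_le (show 0 ≤ -a by omega)
      rw [hn] at h'
      exact hf.not_horizontal_period (by omega) h'
    · exact hne rfl
    · obtain ⟨n, rfl⟩ := Int.eq_ofNat_of_zero_le ha.le
      exact hf.not_horizontal_period (by omega) h
  · obtain ⟨n, rfl⟩ := Int.eq_ofNat_of_zero_le hb.le
    exact hf.not_vertical_period (by omega) h

end IsTiling

/-! ### The main theorem -/

theorem representsTiling_iff {u : ℤ → Fin 2} : RepresentsTiling u ↔ IsSturmian sturmSlope u :=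
  ⟨fun ⟨_, hf, hu⟩ => hf.isSturmian hu, IsSturmian.representsTiling⟩

theorem appearsInTiling_iff {v : List (Fin 2)} :
    AppearsInTiling v ↔ ∃ u, IsSturmian sturmSlope u ∧ IsFactor v u := by
  constructor
  · rintro ⟨f, hf, k, hv⟩
    obtain ⟨u, hu⟩ := hf.exists_word
    exact ⟨u, hf.isSturmian hu, k, fun i hi => wangComponent_unique (hu 0 _) (hv i hi 0)⟩
  · rintro ⟨u, hu, k, hv⟩
    obtain ⟨f, hf, hu⟩ := hu.representsTiling
    exact ⟨f, hf, k, fun i hi x => hv i hi ▸ hu x _⟩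

theorem exists_isSturmian : ∃ u, IsSturmian sturmSlope u := by
  have h0 := slope_pos
  have h1 : sturmSlope < 1 := by
    have := slope_mul; nlinarith [Real.goldenRatio_pos]
  refine ⟨fun n => if ⌊((n : ℝ) + 1) * sturmSlope + 0⌋ = ⌊(n : ℝ) * sturmSlope + 0⌋ then 0 else 1,
    sturmSlope_irrational, 0, Or.inl fun n => ?_⟩
  dsimp only
  have a1 : ⌊(n : ℝ) * sturmSlope + 0⌋ ≤ ⌊((n : ℝ) + 1) * sturmSlope + 0⌋ :=
    Int.floor_mono (by linarith)
  have a2 : ⌊((n : ℝ) + 1) * sturmSlope + 0⌋ ≤ ⌊(n : ℝ) * sturmSlope + 0⌋ + 1 := by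
    rw [← Int.floor_add_one]
    exact Int.floor_mono (by linarith)
  split_ifs with h
  · rw [h]; simp
  · simp; simp at a1 a2 h; omega

theorem mainTheorem1 :
    IsAperiodicWangSet wangT ∧
    {v : List (Fin 2) | AppearsInTiling v} =
      {v : List (Fin 2) | ∃ u : ℤ → Fin 2,
        IsSturmian (Real.goldenRatio ^ 2 / (5 * Real.goldenRatio ^ 2 - 1)) u ∧ IsFactor v u} ∧
    {u : ℤ → Fin 2 | RepresentsTiling u} =
      {u : ℤ → Fin 2 | IsSturmian (Real.goldenRatio ^ 2 / (5 * Real.goldenRatio ^ 2 - 1)) u} := by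
  rw [sturmSlope_eq]
  refine ⟨⟨?_, fun f hf => hf.not_isPeriodicTiling⟩, Set.ext fun v => appearsInTiling_iff,
    Set.ext fun u => representsTiling_iff⟩
  obtain ⟨u, hu⟩ := exists_isSturmian
  obtain ⟨f, hf, -⟩ := hu.representsTiling
  exact ⟨f, hf⟩
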